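/- Let $k$ be an algebraically closed field of characteristic $3$, let $G$ be a simply connected simple algebraic group of type $E_6$ over $k$, and let $\mathfrak g=\mathrm{Lie}(G)$, a $78$-dimensional Lie algebra with one-dimensional centre $\mathfrak z(\mathfrak g)$. Let $e\in\mathfrak g$ lie in the nilpotent orbit $\mathcal O(A_2^2+A_1)$, that is, in the $G$-orbit of $\sum_{i\neq 4}e_{\alpha_i}$, where $\alpha_1,\dots,\alpha_6$ are the simple roots in Bourbaki's numbering. Write $\mathfrak g_e=\{x\in\mathfrak g:[x,e]=0\}$, $\mathfrak n_e=\{x\in\mathfrak g:[x,e]\in ke\}$, let $A=\mathrm{rad}(\mathfrak g_e)$ be the solvable radical of $\mathfrak g_e$, and let $\mathfrak w=N_{\mathfrak g}(A)=\{x\in\mathfrak g:[x,A]\subseteq A\}$. For $m\ge1$ let $O(m;1)=k[x_1,\dots,x_m]/(x_1^3,\dots,x_m^3)$ with partial derivatives $\partial_i$, let $W(m;1)=\mathrm{Der}_k\,O(m;1)$, and for $D=\sum f_i\partial_i\in W(m;1)$ let $\mathrm{div}(D)=\sum\partial_i f_i$. Put $H(2;1)=\{D\in W(2;1):\mathrm{div}(D)=0\}$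 (of dimension $10$), $CH(2;1)=H(2;1)\oplus k(x_1\partial_1+x_2\partial_2)$ and $S(3;1)=\{D\in W(3;1):\mathrm{div}(D)=0\}$. Let $\Omega^1(3;1)=\bigoplus_{i=1}^3O(3;1)\,dx_i$. Skryabin's Lie algebra $\mathcal S_2(1)$ is $W(3;1)\oplus\Omega^1(3;1)$, where $W(3;1)$ is a subalgebra, $[D,\lambda]=D\lambda+\mathrm{div}(D)\lambda$ for $D\in W(3;1)$, $\lambda\in\Omega^1(3;1)$ ($D\lambda$ being the Lie derivative), and $$\Big[\sum f_i\,dx_i,\sum g_j\,dx_j\Big]=(f_2g_3-f_3g_2)\partial_1+(f_3g_1-f_1g_3)\partial_2+(f_1g_2-f_2g_1)\partial_3 .$$ Let $\mathcal S_3(1,\omega_S)=S(3;1)\oplus d\,O(3;1)$, a subalgebra of $\mathcal S_2(1)$, and let $\mathcal S_3(1,\omega_S)^{(1)}$ be its derived subalgebra. Let $L$ be a finite-dimensional simple Lie algebra, $M_{(0)}$ a maximal subalgebra of $L$ with non-zero radical and $M_{(-1)}\supsetneq M_{(0)}$ an $M_{(0)}$-invariant subspace of $L$ with $M_{(-1)}/M_{(0)}$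 an irreducible $M_{(0)}$-module. The associated Weisfeiler filtration of $L$ is given by $M_{(-i-1)}=[M_{(-i)},M_{(-1)}]+M_{(-i)}$ for $i\ge1$ and $M_{(i+1)}=\{x\in M_{(i)}:[x,M_{(-1)}]\subseteq M_{(i)}\}$ for $i\ge0$; its graded algebra is $\bigoplus_{i\in\mathbb Z}M_{(i)}/M_{(i+1)}$ with the induced bracket. **Theorem.** With these notations: (a) $\dim A=17$ and $\mathfrak g_e/A\cong H(2;1)$. (b) $A=\mathrm{rad}(\mathfrak n_e)$ and $\mathfrak n_e/A\cong CH(2;1)$. (c) $A=\mathrm{rad}(\mathfrak w)$ and $\mathfrak w/A\cong W(2;1)$. (d) $\mathfrak w$ is a maximal subalgebra of $\mathfrak g$. (e) Let $L_{-1}=\{x\in\mathfrak g:[x,A]\subseteq\mathfrak w\}$. The Lie algebra $\mathfrak g/\mathfrak z(\mathfrak g)$ is simple, the images $M_{(0)}$ of $\mathfrak w$ and $M_{(-1)}$ of $L_{-1}$ in it satisfy the conditions above, and the graded algebra of the associated Weisfeiler filtration of $\mathfrak g/\mathfrak z(\mathfrak g)$ is isomorphic to $\mathcal S_3(1,\omega_S)^{(1)}$.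 All isomorphisms are isomorphisms of Lie algebras over $k$. -/

import Mathlib

/-! ### The Lie algebra of a simply connected group of type `E₆` -/

namespace LieE6

/-- The root lattice of type `E₆`, in coordinates with respect to the simple roots
`α₁, …, α₆` (Bourbaki numbering, shifted to start at `0`). -/
abbrev Lat : Type := Fin 6 → ℤ

/-- The Weyl group invariant form on the root lattice, given by the Cartan matrix. -/
def form (a b : Lat) : ℤ := ∑ i, ∑ j, a i * CartanMatrix.E₆ i j * b j

/-- A bilinear form `B` with `B(a, b) + B(b, a) = (a, b)`, used to fix signs. -/
def half (a b : Lat) : ℤ :=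
  ∑ i, a i * b i + ∑ i, ∑ j, if i < j then a i * CartanMatrix.E₆ i j * b j else 0

/-- The roots are the lattice vectors of square length `2`. -/
abbrev Root : Type := {a : Lat // form a a = 2}

/-- The sign `ε(a, b) = (-1) ^ B(a, b)`. -/
def sgn (a b : Lat) : ℤ := ((half a b).negOnePow : ℤ)

/-- The `i`-th simple root. -/
def simpleVec (i : Fin 6) : Lat := Pi.single i 1

lemma form_eq (a b : Lat) : form a b =
    2 * (a 0 * b 0 + a 1 * b 1 + a 2 * b 2 + a 3 * b 3 + a 4 * b 4 + a 5 * b 5)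
    - (a 0 * b 2 + a 2 * b 0) - (a 2 * b 3 + a 3 * b 2) - (a 3 * b 4 + a 4 * b 3)
    - (a 4 * b 5 + a 5 * b 4) - (a 1 * b 3 + a 3 * b 1) := by
  simp [form, Fin.sum_univ_six, CartanMatrix.E₆]
  ring

lemma half_eq (a b : Lat) : half a b =
    (a 0 * b 0 + a 1 * b 1 + a 2 * b 2 + a 3 * b 3 + a 4 * b 4 + a 5 * b 5)
    - a 0 * b 2 - a 2 * b 3 - a 3 * b 4 - a 4 * b 5 - a 1 * b 3 := by
  simp [half, Fin.sum_univ_six, CartanMatrix.E₆]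
  ring

lemma form_add_left (a b c : Lat) : form (a + b) c = form a c + form b c := by
  simp only [form_eq, Pi.add_apply]; ring

lemma form_add_right (a b c : Lat) : form a (b + c) = form a b + form a c := by
  simp only [form_eq, Pi.add_apply]; ring

lemma form_neg_right (a b : Lat) : form a (-b) = - form a b := by
  simp only [form_eq, Pi.neg_apply]; ring

lemma form_comm (a b : Lat) : form a b = form b a := by
  simp only [form_eq]; ring

lemma half_add_half (a b : Lat) : half a b + half b a = form a b := by
  simp only [form_eq, half_eq]; ring

lemma sgn_add_left (a b c : Lat) : sgn (a + b) c = sgn a c * sgn b c := by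
  have : half (a + b) c = half a c + half b c := by
    simp only [half_eq, Pi.add_apply]; ring
  simp [sgn, this, Int.negOnePow_add]

lemma sgn_add_right (a b c : Lat) : sgn a (b + c) = sgn a b * sgn a c := by
  have : half a (b + c) = half a b + half a c := by
    simp only [half_eq, Pi.add_apply]; ring
  simp [sgn, this, Int.negOnePow_add]

lemma sgn_neg_left (a b : Lat) : sgn (-a) b = sgn a b := by
  have : half (-a) b = - half a b := by
    simp only [half_eq, Pi.neg_apply]; ring
  simp [sgn, this, Int.negOnePow_neg]

lemma sgn_neg_right (a b : Lat) : sgn a (-b) = sgn a b := by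
  have : half a (-b) = - half a b := by
    simp only [half_eq, Pi.neg_apply]; ring
  simp [sgn, this, Int.negOnePow_neg]

lemma sgn_self (a : Lat) (ha : form a a = 2) : sgn a a = -1 := by
  have h := half_add_half a a
  have : half a a = 1 := by omega
  simp [sgn, this]

lemma sgn_mul_self (a b : Lat) : sgn a b * sgn a b = 1 := by
  simp only [sgn, ← Units.val_mul]
  simp

lemma sgn_even (a b : Lat) (h : Even (form a b)) : sgn b a = sgn a b := by
  have : half b a = form a b - half a b := by have := half_add_half a b; omega
  simp [sgn, this, Int.negOnePow_sub, Int.negOnePow_even _ h]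

lemma sgn_odd (a b : Lat) (h : Odd (form a b)) : sgn b a = - sgn a b := by
  have : half b a = form a b - half a b := by have := half_add_half a b; omega
  simp [sgn, this, Int.negOnePow_sub, Int.negOnePow_odd _ h]

lemma six_mul_form (a : Lat) : 6 * form a a =
    3 * (2 * a 0 - a 2) ^ 2 + (3 * a 2 - 2 * a 3) ^ 2 + 3 * (2 * a 5 - a 4) ^ 2
    + (3 * a 4 - 2 * a 3) ^ 2 + 3 * (2 * a 1 - a 3) ^ 2 + a 3 ^ 2 := by
  simp only [form_eq]; ring

lemma form_self_nonneg (a : Lat) : 0 ≤ form a a := by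
  have h := six_mul_form a
  have : 0 ≤ 6 * form a a := by rw [h]; positivity
  omega

lemma eq_zero_of_form (a : Lat) (h0 : form a a = 0) : a = 0 := by
  have h := six_mul_form a
  rw [h0] at h
  have h3 : a 3 = 0 := by nlinarith [sq_nonneg (2 * a 0 - a 2), sq_nonneg (3 * a 2 - 2 * a 3), sq_nonneg (2 * a 5 - a 4), sq_nonneg (3 * a 4 - 2 * a 3), sq_nonneg (2 * a 1 - a 3), sq_nonneg (a 3)]
  have h2 : 3 * a 2 - 2 * a 3 = 0 := by nlinarith [sq_nonneg (2 * a 0 - a 2), sq_nonneg (3 * a 2 - 2 * a 3), sq_nonneg (2 * a 5 - a 4), sq_nonneg (3 * a 4 - 2 * a 3), sq_nonneg (2 * a 1 - a 3), sq_nonneg (a 3)]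
  have h4 : 3 * a 4 - 2 * a 3 = 0 := by nlinarith [sq_nonneg (2 * a 0 - a 2), sq_nonneg (3 * a 2 - 2 * a 3), sq_nonneg (2 * a 5 - a 4), sq_nonneg (3 * a 4 - 2 * a 3), sq_nonneg (2 * a 1 - a 3), sq_nonneg (a 3)]
  have h1 : 2 * a 1 - a 3 = 0 := by nlinarith [sq_nonneg (2 * a 0 - a 2), sq_nonneg (3 * a 2 - 2 * a 3), sq_nonneg (2 * a 5 - a 4), sq_nonneg (3 * a 4 - 2 * a 3), sq_nonneg (2 * a 1 - a 3), sq_nonneg (a 3)]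
  have h5 : 2 * a 5 - a 4 = 0 := by nlinarith [sq_nonneg (2 * a 0 - a 2), sq_nonneg (3 * a 2 - 2 * a 3), sq_nonneg (2 * a 5 - a 4), sq_nonneg (3 * a 4 - 2 * a 3), sq_nonneg (2 * a 1 - a 3), sq_nonneg (a 3)]
  have h6 : 2 * a 0 - a 2 = 0 := by nlinarith [sq_nonneg (2 * a 0 - a 2), sq_nonneg (3 * a 2 - 2 * a 3), sq_nonneg (2 * a 5 - a 4), sq_nonneg (3 * a 4 - 2 * a 3), sq_nonneg (2 * a 1 - a 3), sq_nonneg (a 3)]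
  funext i
  fin_cases i <;> simp <;> omega

lemma form_add_self (a b : Lat) : form (a + b) (a + b) = form a a + form b b + 2 * form a b := by
  simp only [form_eq, Pi.add_apply]; ring

lemma form_ge (a b : Lat) (ha : form a a = 2) (hb : form b b = 2) : -2 ≤ form a b := by
  have := form_self_nonneg (a + b)
  rw [form_add_self] at this
  omega

lemma form_neg_self (a : Lat) : form (-a) (-a) = form a a := by
  simp only [form_eq, Pi.neg_apply]; ring

lemma form_le (a b : Lat) (ha : form a a = 2) (hb : form b b = 2) : form a b ≤ 2 := by
  have := form_ge a (-b) ha (by rw [form_neg_self, hb])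
  rw [form_neg_right] at this
  omega

lemma add_eq_zero_of_form (a b : Lat) (ha : form a a = 2) (hb : form b b = 2)
    (h : form a b = -2) : a + b = 0 := by
  apply eq_zero_of_form
  rw [form_add_self]
  omega

lemma form_of_add_eq_zero (a b : Lat) (ha : form a a = 2) (h : a + b = 0) : form a b = -2 := by
  have : b = -a := by rw [eq_neg_iff_add_eq_zero, add_comm]; exact h
  rw [this, form_neg_right, ha]

lemma form_simpleVec (i : Fin 6) : form (simpleVec i) (simpleVec i) = 2 := by
  revert i; decide

/-- The simple roots, as roots. -/
def simpleRoot (i : Fin 6) : Root := ⟨simpleVec i, form_simpleVec i⟩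

/-- The free `k`-module on the symbols `h₁, …, h₆` and `e_α`, for `α` a root. -/
def E6 (k : Type*) [Field k] : Type _ := (Fin 6 ⊕ Root) →₀ k

variable {k : Type*} [Field k]

noncomputable instance : AddCommGroup (E6 k) :=
  inferInstanceAs (AddCommGroup ((Fin 6 ⊕ Root) →₀ k))

noncomputable instance : Module k (E6 k) :=
  inferInstanceAs (Module k ((Fin 6 ⊕ Root) →₀ k))

/-- The tautological basis of `E6 k`. -/
noncomputable def basis (k : Type*) [Field k] : Module.Basis (Fin 6 ⊕ Root) k (E6 k) :=
  Module.Basis.ofRepr (LinearEquiv.refl k ((Fin 6 ⊕ Root) →₀ k))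

/-- The basis vectors `h₁, …, h₆` and `e_α`. -/
noncomputable def bvec (k : Type*) [Field k] (x : Fin 6 ⊕ Root) : E6 k := basis k x

/-- The coroot `h_a = ∑ aᵢ hᵢ`. -/
noncomputable def coroot (k : Type*) [Field k] (a : Lat) : E6 k :=
  ∑ i, (a i : k) • bvec k (Sum.inl i)

/-- The root vector `e_a`, with the convention `e_a = 0` if `a` is not a root. -/
noncomputable def rootVec (k : Type*) [Field k] (a : Lat) : E6 k :=
  if h : form a a = 2 then bvec k (Sum.inr ⟨a, h⟩) else 0

/-- The brackets of the basis vectors: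
`[hᵢ, hⱼ] = 0`, `[hᵢ, e_b] = (αᵢ, b) e_b`, `[e_a, e_{-a}] = - h_a` and
`[e_a, e_b] = ε(a, b) e_{a+b}` for `a + b ≠ 0`.
(Replacing `e_{-a}` by `- e_{-a}` for the positive roots `a` gives a Chevalley basis.) -/
noncomputable def basisBracket (k : Type*) [Field k] : Fin 6 ⊕ Root → Fin 6 ⊕ Root → E6 k
  | Sum.inl _, Sum.inl _ => 0
  | Sum.inl i, Sum.inr b => (form (simpleVec i) b.1 : k) • bvec k (Sum.inr b)
  | Sum.inr a, Sum.inl i => -((form (simpleVec i) a.1 : k) • bvec k (Sum.inr a))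
  | Sum.inr a, Sum.inr b =>
      if a.1 + b.1 = 0 then -coroot k a.1 else (sgn a.1 b.1 : k) • rootVec k (a.1 + b.1)

/-- The bilinear extension of `basisBracket`. -/
noncomputable def bracketMap (k : Type*) [Field k] : E6 k →ₗ[k] E6 k →ₗ[k] E6 k :=
  (basis k).constr k fun x => (basis k).constr k (basisBracket k x)

lemma bracketMap_bvec (x y : Fin 6 ⊕ Root) :
    bracketMap k (bvec k x) (bvec k y) = basisBracket k x y := by
  simp [bracketMap, bvec, Module.Basis.constr_basis]

lemma E6_induction {p : E6 k → Prop} (x : E6 k) (h0 : p 0) (hadd : ∀ x y, p x → p y → p (x + y))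
    (hs : ∀ (c : k) i, p (c • bvec k i)) : p x := by
  rw [← (basis k).linearCombination_repr x, Finsupp.linearCombination_apply, Finsupp.sum]
  exact Finset.sum_induction _ p hadd h0 fun i _ => hs _ i

lemma coroot_add (a b : Lat) : coroot k (a + b) = coroot k a + coroot k b := by
  simp [coroot, add_smul, Finset.sum_add_distrib]

lemma coroot_zero : coroot k 0 = 0 := by simp [coroot]

lemma rootVec_root (a : Root) : rootVec k a.1 = bvec k (Sum.inr a) := by
  simp [rootVec, a.2]

lemma basisBracket_skew (x y : Fin 6 ⊕ Root) :
    basisBracket k x y = - basisBracket k y x := by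
  rcases x with i | a <;> rcases y with j | b
  · simp [basisBracket]
  · simp [basisBracket]
  · simp [basisBracket]
  · simp only [basisBracket]
    by_cases h : a.1 + b.1 = 0
    · rw [if_pos h, if_pos (by rw [add_comm]; exact h)]
      have := coroot_add (k := k) a.1 b.1
      rw [h, coroot_zero] at this
      rw [neg_neg, neg_eq_iff_add_eq_zero, ← this]
    · rw [if_neg h, if_neg (by rw [add_comm]; exact h), add_comm b.1 a.1]
      by_cases hr : form (a.1 + b.1) (a.1 + b.1) = 2
      · have hf : form a.1 b.1 = -1 := by
          rw [form_add_self, a.2, b.2] at hr; omega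
        rw [sgn_odd a.1 b.1 (by rw [hf]; decide)]
        simp
      · simp [rootVec, hr]

lemma basisBracket_self (x : Fin 6 ⊕ Root) : basisBracket k x x = 0 := by
  rcases x with i | a
  · rfl
  · have h1 : ¬ (a.1 + a.1 = 0) := by
      intro h
      have := form_of_add_eq_zero _ _ a.2 h
      have := a.2
      omega
    have h2 : ¬ form (a.1 + a.1) (a.1 + a.1) = 2 := by
      rw [form_add_self, a.2]; omega
    simp [basisBracket, h1, rootVec, h2]

lemma bracketMap_skew (x y : E6 k) : bracketMap k x y = - bracketMap k y x := by
  induction x using E6_induction with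
  | h0 => simp
  | hadd x x' h h' => simp only [map_add, LinearMap.add_apply, h, h']; abel
  | hs c i =>
    induction y using E6_induction with
    | h0 => simp
    | hadd y y' h h' => simp only [map_add, LinearMap.add_apply, h, h']; abel
    | hs d j =>
      simp only [map_smul, LinearMap.smul_apply, bracketMap_bvec]
      rw [basisBracket_skew, smul_neg, smul_neg, smul_comm]

lemma bracketMap_self (x : E6 k) : bracketMap k x x = 0 := by
  induction x using E6_induction with
  | h0 => simp
  | hadd x x' h h' =>
    simp only [map_add, LinearMap.add_apply, h, h']
    rw [bracketMap_skew x x']; abel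
  | hs c i => simp [map_smul, LinearMap.smul_apply, bracketMap_bvec, basisBracket_self]

/-- The weight of a basis vector under `hᵢ`. -/
def wt (i : Fin 6) : Fin 6 ⊕ Root → ℤ
  | Sum.inl _ => 0
  | Sum.inr a => form (simpleVec i) a.1

lemma bracketMap_h_bvec (i : Fin 6) (x : Fin 6 ⊕ Root) :
    bracketMap k (bvec k (Sum.inl i)) (bvec k x) = (wt i x : k) • bvec k x := by
  rw [bracketMap_bvec]
  rcases x with j | a <;> simp [basisBracket, wt]

lemma bracketMap_h_rootVec (i : Fin 6) (a : Lat) :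
    bracketMap k (bvec k (Sum.inl i)) (rootVec k a) = (form (simpleVec i) a : k) • rootVec k a := by
  by_cases h : form a a = 2
  · rw [rootVec, dif_pos h, bracketMap_h_bvec]; rfl
  · simp [rootVec, h]

lemma bracketMap_h_coroot (i : Fin 6) (a : Lat) :
    bracketMap k (bvec k (Sum.inl i)) (coroot k a) = 0 := by
  simp [coroot, map_sum, bracketMap_bvec, basisBracket]

lemma bracketMap_h_basisBracket (i : Fin 6) (x y : Fin 6 ⊕ Root) :
    bracketMap k (bvec k (Sum.inl i)) (basisBracket k x y) =
      ((wt i x + wt i y : ℤ) : k) • basisBracket k x y := by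
  rcases x with j | a <;> rcases y with l | b
  · simp [basisBracket]
  · simp [basisBracket, bracketMap_h_bvec, wt, smul_smul, mul_comm]
  · simp [basisBracket, bracketMap_h_bvec, wt, smul_smul, mul_comm]
  · simp only [basisBracket]
    split_ifs with h
    · have e : b.1 = -a.1 := by rw [eq_neg_iff_add_eq_zero, add_comm]; exact h
      simp [bracketMap_h_coroot, wt, e, form_neg_right]
    · rw [map_smul, bracketMap_h_rootVec, form_add_right, smul_comm]
      rfl

lemma form_coroot (a : Root) (b : Lat) :
    bracketMap k (bvec k (Sum.inr a)) (coroot k b) = -((form b a.1 : k) • bvec k (Sum.inr a)) := by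
  have : form b a.1 = ∑ i, b i * form (simpleVec i) a.1 := by
    simp only [form_eq, simpleVec, Fin.sum_univ_six]
    simp
    ring
  simp only [coroot, map_sum, map_smul, bracketMap_bvec, basisBracket, this, smul_neg,
    Finset.sum_neg_distrib, smul_smul, ← Finset.sum_smul]
  push_cast
  rfl

/-- The coefficient of `e_{a+b+c}` in `[e_a, [e_b, e_c]]`. -/
def jcoef (a b c : Lat) : ℤ :=
  if form b c = -2 then form a b else if form b c = -1 then sgn b c * (sgn a b * sgn a c) else 0

lemma triple_of_ne (a b c : Root) (h : a.1 + b.1 + c.1 ≠ 0) :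
    bracketMap k (bvec k (Sum.inr a)) (basisBracket k (Sum.inr b) (Sum.inr c)) =
      (jcoef a.1 b.1 c.1 : k) • rootVec k (a.1 + b.1 + c.1) := by
  simp only [basisBracket]
  split_ifs with h0
  · have hf := form_of_add_eq_zero _ _ b.2 h0
    rw [map_neg, form_coroot, neg_neg, jcoef, if_pos hf, add_assoc, h0, add_zero, rootVec_root,
      form_comm]
  · have hf : form b.1 c.1 ≠ -2 := fun hf => h0 (add_eq_zero_of_form _ _ b.2 c.2 hf)
    rw [jcoef, if_neg hf]
    split_ifs with h1
    · have hr : form (b.1 + c.1) (b.1 + c.1) = 2 := by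
        rw [form_add_self, b.2, c.2, h1]; norm_num
      rw [rootVec, dif_pos hr, map_smul, bracketMap_bvec]
      simp only [basisBracket]
      rw [if_neg (by rwa [← add_assoc]), smul_smul, sgn_add_right, ← add_assoc]
      push_cast
      rfl
    · have hr : ¬ form (b.1 + c.1) (b.1 + c.1) = 2 := by
        rw [form_add_self, b.2, c.2]; omega
      simp [rootVec, hr]

lemma triple_of_eq (a b c : Root) (h : a.1 + b.1 + c.1 = 0) :
    bracketMap k (bvec k (Sum.inr a)) (basisBracket k (Sum.inr b) (Sum.inr c)) =
      -((sgn b.1 c.1 : k) • coroot k a.1) := by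
  have e : b.1 + c.1 = -a.1 := by
    rw [eq_neg_iff_add_eq_zero, ← h]; abel
  have ha : form (b.1 + c.1) (b.1 + c.1) = 2 := by rw [e, form_neg_self, a.2]
  have h0 : b.1 + c.1 ≠ 0 := by
    intro h0
    rw [h0] at ha
    simp [form_eq] at ha
  simp only [basisBracket]
  rw [if_neg h0, rootVec, dif_pos ha, map_smul, bracketMap_bvec]
  simp only [basisBracket]
  rw [if_pos (by rw [← add_assoc]; exact h), smul_neg]

lemma jcoef_cyclic (a b c : Lat) (ha : form a a = 2) (hb : form b b = 2) (hc : form c c = 2)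
    (h : form (a + b + c) (a + b + c) = 2) :
    jcoef a b c + jcoef b c a + jcoef c a b = 0 := by
  have hs : form a b + form b c + form c a = -2 := by
    rw [form_add_self, form_add_self, form_add_left, form_comm a c] at h
    omega
  have e1 : ∀ a b c : Lat, form b b = 2 → form c c = 2 → form b c = -2 →
      sgn b c = -1 ∧ sgn c a = sgn b a := by
    intro a b c hb hc h
    have h0 := add_eq_zero_of_form b c hb hc h
    have : c = -b := by rw [eq_neg_iff_add_eq_zero, add_comm]; exact h0
    rw [this, sgn_neg_right, sgn_neg_left]
    exact ⟨sgn_self b hb, rfl⟩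
  have p1 := form_ge a b ha hb
  have p2 := form_le a b ha hb
  have q1 := form_ge b c hb hc
  have q2 := form_le b c hb hc
  have r1 := form_ge c a hc ha
  have r2 := form_le c a hc ha
  have u := sgn_mul_self a b
  have v := sgn_mul_self b c
  have w := sgn_mul_self c a
  have u0 := sgn_even a b
  have u1 := sgn_odd a b
  have v0 := sgn_even b c
  have v1 := sgn_odd b c
  have w0 := sgn_even c a
  have w1 := sgn_odd c a
  have x1 := e1 a b c hb hc
  have x2 := e1 b c a hc ha
  have x3 := e1 c a b ha hb
  unfold jcoef
  generalize form a b = p at *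
  generalize form b c = q at *
  generalize form c a = r at *
  generalize sgn a b = A at *
  generalize sgn b c = B at *
  generalize sgn c a = C at *
  generalize sgn b a = A' at *
  generalize sgn c b = B' at *
  generalize sgn a c = C' at *
  obtain rfl : r = -2 - p - q := by omega
  clear h hs ha hb hc e1
  interval_cases p <;> interval_cases q <;>
    first
    | (exfalso; omega)
    | (norm_num [Int.even_iff, Int.odd_iff] at *; done)
    | (norm_num [Int.even_iff, Int.odd_iff] at *; grind)

noncomputable instance : Bracket (E6 k) (E6 k) := ⟨fun x y => bracketMap k x y⟩

lemma lie_def (x y : E6 k) : ⁅x, y⁆ = bracketMap k x y := rfl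

/-- The cyclic sum in the Jacobi identity vanishes on basis vectors with first entry `hᵢ`. -/
lemma jacobi_h (i : Fin 6) (y z : Fin 6 ⊕ Root) :
    bracketMap k (bvec k (Sum.inl i)) (basisBracket k y z) +
      bracketMap k (bvec k y) (basisBracket k z (Sum.inl i)) +
      bracketMap k (bvec k z) (basisBracket k (Sum.inl i) y) = 0 := by
  have hz : basisBracket k (Sum.inl i) z = (wt i z : k) • bvec k z := by
    rw [← bracketMap_bvec, bracketMap_h_bvec]
  have hy : basisBracket k (Sum.inl i) y = (wt i y : k) • bvec k y := by
    rw [← bracketMap_bvec, bracketMap_h_bvec]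
  rw [bracketMap_h_basisBracket, basisBracket_skew z, hz, hy, map_neg, map_smul, map_smul,
    bracketMap_bvec, bracketMap_bvec, basisBracket_skew z y]
  push_cast
  module

lemma jacobi_root (a b c : Root) :
    bracketMap k (bvec k (Sum.inr a)) (basisBracket k (Sum.inr b) (Sum.inr c)) +
      bracketMap k (bvec k (Sum.inr b)) (basisBracket k (Sum.inr c) (Sum.inr a)) +
      bracketMap k (bvec k (Sum.inr c)) (basisBracket k (Sum.inr a) (Sum.inr b)) = 0 := by
  have r1 : b.1 + c.1 + a.1 = a.1 + b.1 + c.1 := by abel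
  have r2 : c.1 + a.1 + b.1 = a.1 + b.1 + c.1 := by abel
  by_cases h : a.1 + b.1 + c.1 = 0
  · rw [triple_of_eq a b c h, triple_of_eq b c a (r1.trans h), triple_of_eq c a b (r2.trans h)]
    have hc : c.1 = -(a.1 + b.1) := by rw [eq_neg_iff_add_eq_zero, ← h]; abel
    have hf : form a.1 b.1 = -1 := by
      have := c.2
      rw [hc, form_neg_self, form_add_self, a.2, b.2] at this
      omega
    have hba : sgn b.1 a.1 = - sgn a.1 b.1 := sgn_odd _ _ (by rw [hf]; decide)
    have e1 : sgn b.1 c.1 = sgn a.1 b.1 := by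
      rw [hc, sgn_neg_right, sgn_add_right, sgn_self b.1 b.2, hba]; ring
    have e2 : sgn c.1 a.1 = sgn a.1 b.1 := by
      rw [hc, sgn_neg_left, sgn_add_left, sgn_self a.1 a.2, hba]; ring
    rw [e1, e2, ← neg_add, ← neg_add, ← smul_add, ← smul_add, ← coroot_add, ← coroot_add, h,
      coroot_zero, smul_zero, neg_zero]
  · rw [triple_of_ne a b c h, triple_of_ne b c a (by rwa [r1]), triple_of_ne c a b (by rwa [r2]),
      r1, r2, ← add_smul, ← add_smul]
    by_cases hr : form (a.1 + b.1 + c.1) (a.1 + b.1 + c.1) = 2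
    · have := jcoef_cyclic a.1 b.1 c.1 a.2 b.2 c.2 hr
      have h3 : (jcoef a.1 b.1 c.1 : k) + jcoef b.1 c.1 a.1 + jcoef c.1 a.1 b.1 = 0 := by
        exact_mod_cast congrArg (Int.cast : ℤ → k) this
      rw [h3, zero_smul]
    · simp [rootVec, hr]

lemma jacobi_basis (x y z : Fin 6 ⊕ Root) :
    bracketMap k (bvec k x) (basisBracket k y z) +
      bracketMap k (bvec k y) (basisBracket k z x) +
      bracketMap k (bvec k z) (basisBracket k x y) = 0 := by
  rcases x with i | a
  · exact jacobi_h i y z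
  rcases y with i | b
  · rw [← jacobi_h (k := k) i z (Sum.inr a)]; abel
  rcases z with i | c
  · rw [← jacobi_h (k := k) i (Sum.inr a) (Sum.inr b)]; abel
  exact jacobi_root a b c

lemma jacobi (x y z : E6 k) :
    bracketMap k x (bracketMap k y z) + bracketMap k y (bracketMap k z x) +
      bracketMap k z (bracketMap k x y) = 0 := by
  induction x using E6_induction with
  | h0 => simp
  | hadd x x' h h' =>
    simp only [map_add, LinearMap.add_apply]
    rw [← add_zero (0 : E6 k)]
    nth_rewrite 1 [← h]
    rw [← h']
    abel
  | hs c i =>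
    induction y using E6_induction with
    | h0 => simp
    | hadd y y' h h' =>
      simp only [map_add, LinearMap.add_apply]
      rw [← add_zero (0 : E6 k)]
      nth_rewrite 1 [← h]
      rw [← h']
      abel
    | hs d j =>
      induction z using E6_induction with
      | h0 => simp
      | hadd z z' h h' =>
        simp only [map_add, LinearMap.add_apply]
        rw [← add_zero (0 : E6 k)]
        nth_rewrite 1 [← h]
        rw [← h']
        abel
      | hs e l =>
        simp only [map_smul, LinearMap.smul_apply, bracketMap_bvec]
        have := jacobi_basis (k := k) i j l
        have h2 := congrArg (fun v => (c * d * e) • v) this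
        simp only [smul_zero, smul_add] at h2
        rw [← h2]
        module

noncomputable instance : LieRing (E6 k) where
  add_lie x y z := by simp [lie_def]
  lie_add x y z := by simp [lie_def]
  lie_self x := bracketMap_self x
  leibniz_lie x y z := by
    simp only [lie_def]
    have h := jacobi x y z
    rw [bracketMap_skew z x, map_neg, bracketMap_skew z] at h
    rw [← sub_eq_zero, ← h]
    abel

noncomputable instance : LieAlgebra k (E6 k) where
  lie_smul c x y := by simp [lie_def]

/-! ### The adjoint group and the orbit -/

/-- The root vector `e_a`, for `a` a root. -/
noncomputable def e (k : Type*) [Field k] (a : Root) : E6 k := bvec k (Sum.inr a)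

lemma ad_e_sq_bvec (a : Root) (x : Fin 6 ⊕ Root) :
    ∃ c : k, ⁅e k a, ⁅e k a, bvec k x⁆⁆ = c • e k a := by
  simp only [lie_def, e, bracketMap_bvec]
  rcases x with i | b
  · exact ⟨0, by simp [basisBracket, bracketMap_self]⟩
  · have hn : a.1 + a.1 + b.1 ≠ 0 := by
      intro h
      have hb : b.1 = -(a.1 + a.1) := by rw [eq_neg_iff_add_eq_zero, ← h]; abel
      have := b.2
      rw [hb, form_neg_self, form_add_self, a.2] at this
      omega
    rw [triple_of_ne a a b hn]
    by_cases hf : form a.1 b.1 = -2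
    · have h0 := add_eq_zero_of_form _ _ a.2 b.2 hf
      exact ⟨jcoef a.1 a.1 b.1, by rw [add_assoc, h0, add_zero, rootVec_root]⟩
    · refine ⟨0, ?_⟩
      rw [zero_smul]
      by_cases hf1 : form a.1 b.1 = -1
      · have : ¬ form (a.1 + a.1 + b.1) (a.1 + a.1 + b.1) = 2 := by
          rw [form_add_self, form_add_self, form_add_left, a.2, b.2, hf1]; omega
        simp [rootVec, this]
      · simp [jcoef, hf, hf1]

lemma ad_e_cube (a : Root) (x : E6 k) : ⁅e k a, ⁅e k a, ⁅e k a, x⁆⁆⁆ = 0 := by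
  induction x using E6_induction with
  | h0 => simp
  | hadd x y hx hy => simp [hx, hy]
  | hs c i =>
    obtain ⟨d, hd⟩ := ad_e_sq_bvec (k := k) a i
    simp [hd]

/-- The root element `x_a(t) = exp(t ad e_a) = 1 + t ad e_a + (t² / 2) (ad e_a)²`
of the adjoint group, as a linear endomorphism. -/
noncomputable def rootElementMap (a : Root) (t : k) : E6 k →ₗ[k] E6 k :=
  LinearMap.id + t • LieAlgebra.ad k (E6 k) (e k a) +
    (t ^ 2 / 2) • (LieAlgebra.ad k (E6 k) (e k a) ∘ₗ LieAlgebra.ad k (E6 k) (e k a))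

lemma rootElementMap_apply (a : Root) (t : k) (x : E6 k) :
    rootElementMap a t x = x + t • ⁅e k a, x⁆ + (t ^ 2 / 2) • ⁅e k a, ⁅e k a, x⁆⁆ := by
  simp [rootElementMap]

lemma rootElementMap_neg [CharP k 3] (a : Root) (t : k) (x : E6 k) :
    rootElementMap a (-t) (rootElementMap a t x) = x := by
  have h2 : (2 : k) ≠ 0 := by
    intro h
    have h3 : ((3 : ℕ) : k) = 0 := CharP.cast_eq_zero k 3
    have : (1 : k) = 0 := by push_cast at h3; linear_combination h3 - h
    exact one_ne_zero this
  simp only [rootElementMap_apply, lie_add, lie_smul, ad_e_cube, smul_zero, add_zero]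
  match_scalars <;> field_simp <;> ring

/-- The root element `x_a(t)`, as a linear automorphism. -/
noncomputable def rootElement [CharP k 3] (a : Root) (t : k) : E6 k ≃ₗ[k] E6 k :=
  LinearEquiv.ofLinearMap (rootElementMap a t) (rootElementMap a (-t))
    (LinearMap.ext fun x => by simpa using rootElementMap_neg a (-t) x)
    (LinearMap.ext fun x => by simpa using rootElementMap_neg a t x)

/-- The image of the simply connected group `G` of type `E₆` in `GL(𝔤)` under the adjoint
representation: since `k` will be algebraically closed, it is generated by the root elements. -/
noncomputable def adjointGroup (k : Type*) [Field k] [CharP k 3] : Subgroup (E6 k ≃ₗ[k] E6 k) :=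
  Subgroup.closure {g | ∃ (a : Root) (t : k), g = rootElement a t}

/-- The representative `∑_{i ≠ 4} e_{αᵢ}` of the nilpotent orbit `A₂² + A₁`: a regular nilpotent
element of the Levi subalgebra of type `A₂ + A₂ + A₁`. -/
noncomputable def orbitRep (k : Type*) [Field k] : E6 k :=
  ∑ i ∈ Finset.univ.erase (3 : Fin 6), e k (simpleRoot i)

/-- The nilpotent orbit `A₂² + A₁` of `G` in `𝔤`. -/
def orbitA2A2A1 (k : Type*) [Field k] [CharP k 3] : Set (E6 k) :=
  {x | ∃ g ∈ adjointGroup k, x = g (orbitRep k)}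

end LieE6

/-! ### Centralisers, normalisers, radicals -/

namespace LieSub

variable {k L : Type*} [Field k] [LieRing L] [LieAlgebra k L]

/-- The centraliser `𝔤_e` of an element `e`. -/
def centralizer (k : Type*) {L : Type*} [Field k] [LieRing L] [LieAlgebra k L] (e : L) :
    LieSubalgebra k L where
  carrier := {x | ⁅x, e⁆ = 0}
  add_mem' {x y} hx hy := by
    simp only [Set.mem_ofPred_eq] at hx hy ⊢
    rw [add_lie, hx, hy, add_zero]
  zero_mem' := by simp
  smul_mem' c x hx := by
    simp only [Set.mem_ofPred_eq] at hx ⊢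
    rw [smul_lie, hx, smul_zero]
  lie_mem' {x y} hx hy := by
    change ⁅x, e⁆ = 0 at hx
    change ⁅y, e⁆ = 0 at hy
    change ⁅⁅x, y⁆, e⁆ = 0
    rw [lie_lie, hx, hy, lie_zero, lie_zero, sub_zero]

/-- The normaliser `N_𝔤(V) = {x | [x, V] ⊆ V}` of a subspace `V`. -/
def normalizer (V : Submodule k L) : LieSubalgebra k L where
  carrier := {x | ∀ v ∈ V, ⁅x, v⁆ ∈ V}
  add_mem' {x y} hx hy v hv := by
    rw [add_lie]
    exact V.add_mem (hx v hv) (hy v hv)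
  zero_mem' v _ := by simp
  smul_mem' c x hx v hv := by
    rw [smul_lie]
    exact V.smul_mem c (hx v hv)
  lie_mem' {x y} hx hy v hv := by
    rw [lie_lie]
    exact V.sub_mem (hx _ (hy v hv)) (hy _ (hx v hv))

/-- The solvable radical of a subalgebra, as a subspace of the ambient Lie algebra. -/
noncomputable def rad (M : LieSubalgebra k L) : Submodule k L :=
  (LieAlgebra.radical k M).toSubmodule.map M.toSubmodule.subtype

/-- The projection of a Lie algebra onto its quotient by an ideal. -/
def proj (I : LieIdeal k L) : L →ₗ⁅k⁆ L ⧸ I :=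
  { (LieSubmodule.Quotient.mk' I : L →ₗ[k] L ⧸ I) with
    map_lie' := fun {x y} => LieSubmodule.Quotient.mk_bracket I x y }

/-- The subspace `{x | [x, A] ⊆ M}`. -/
def transporter (A : Submodule k L) (M : LieSubalgebra k L) : Submodule k L where
  carrier := {x | ∀ a ∈ A, ⁅x, a⁆ ∈ M}
  add_mem' {x y} hx hy a ha := by
    rw [add_lie]
    exact M.add_mem (hx a ha) (hy a ha)
  zero_mem' a _ := by simp
  smul_mem' c x hx a ha := by
    rw [smul_lie]
    exact M.smul_mem c (hx a ha)

end LieSub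

/-! ### Filtered Lie algebras and their associated graded Lie algebras -/

/-- A descending filtration of a Lie algebra `L` by subspaces `F i`, `i ∈ ℤ`,
with `[F i, F j] ⊆ F (i + j)`. -/
structure LieFiltration (k L : Type*) [Field k] [LieRing L] [LieAlgebra k L] where
  /-- the subspaces of the filtration -/
  F : ℤ → Submodule k L
  succ_le : ∀ i, F (i + 1) ≤ F i
  lie_mem : ∀ i j x y, x ∈ F i → y ∈ F j → ⁅x, y⁆ ∈ F (i + j)

namespace LieFiltration

open DirectSum

variable {k L : Type*} [Field k] [LieRing L] [LieAlgebra k L] (Φ : LieFiltration k L)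

/-- The homogeneous component `F i / F (i + 1)`. -/
abbrev Piece (i : ℤ) : Type _ := Φ.F i ⧸ (Φ.F (i + 1)).submoduleOf (Φ.F i)

/-- The associated graded space `⨁ i, F i / F (i + 1)`. -/
def Gr : Type _ := ⨁ i : ℤ, Φ.Piece i

noncomputable instance : AddCommGroup Φ.Gr := inferInstanceAs (AddCommGroup (⨁ i : ℤ, Φ.Piece i))

noncomputable instance : Module k Φ.Gr := inferInstanceAs (Module k (⨁ i : ℤ, Φ.Piece i))

/-- The inclusion of a homogeneous component. -/
noncomputable def incl (i : ℤ) : Φ.Piece i →ₗ[k] Φ.Gr := DirectSum.lof k ℤ Φ.Piece i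

/-- The symbol map `F i → F i / F (i + 1) ⊆ gr`. -/
noncomputable def symb (i : ℤ) : Φ.F i →ₗ[k] Φ.Gr := Φ.incl i ∘ₗ Submodule.mkQ _

/-- The bracket of `F i` with `F j`, as a map to the graded space. -/
noncomputable def preBracket (i j : ℤ) : Φ.F i →ₗ[k] Φ.F j →ₗ[k] Φ.Gr :=
  LinearMap.mk₂ k (fun x y => Φ.symb (i + j) ⟨⁅x.1, y.1⁆, Φ.lie_mem i j x y x.2 y.2⟩)
    (fun x x' y => by rw [← map_add]; congr 1; ext; simp)
    (fun c x y => by rw [← map_smul]; congr 1; ext; simp)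
    (fun x y y' => by rw [← map_add]; congr 1; ext; simp)
    (fun c x y => by rw [← map_smul]; congr 1; ext; simp)

lemma symb_eq_zero (i : ℤ) (x : Φ.F i) (h : x.1 ∈ Φ.F (i + 1)) : Φ.symb i x = 0 := by
  have : (Submodule.mkQ ((Φ.F (i + 1)).submoduleOf (Φ.F i))) x = 0 := by
    rw [Submodule.mkQ_apply, Submodule.Quotient.mk_eq_zero]
    exact h
  rw [symb, LinearMap.comp_apply, this, map_zero]

lemma symb_congr {i j : ℤ} (h : i = j) (v : L) (hi : v ∈ Φ.F i) (hj : v ∈ Φ.F j) :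
    Φ.symb i ⟨v, hi⟩ = Φ.symb j ⟨v, hj⟩ := by
  subst h; rfl

/-- The bracket `[x + F (i + 1), y + F (j + 1)] = [x, y] + F (i + j + 1)` of components. -/
noncomputable def pieceBracket (i j : ℤ) : Φ.Piece i →ₗ[k] Φ.Piece j →ₗ[k] Φ.Gr :=
  Submodule.liftQ _
    (LinearMap.flip (Submodule.liftQ _ (LinearMap.flip (Φ.preBracket i j)) (by
      intro y hy
      rw [LinearMap.mem_ker]
      ext x
      refine Φ.symb_eq_zero _ _ ?_
      have := Φ.lie_mem i (j + 1) x y x.2 hy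
      rwa [← add_assoc] at this)))
    (by
      intro x hx
      rw [LinearMap.mem_ker]
      ext y
      refine Φ.symb_eq_zero _ _ ?_
      have := Φ.lie_mem (i + 1) j x y hx y.2
      rwa [add_right_comm] at this)

/-- The bracket of the associated graded Lie algebra, as a bilinear map. -/
noncomputable def grBracket : Φ.Gr →ₗ[k] Φ.Gr →ₗ[k] Φ.Gr :=
  DirectSum.toModule k ℤ (Φ.Gr →ₗ[k] Φ.Gr) fun i =>
    LinearMap.flip (DirectSum.toModule k ℤ (Φ.Piece i →ₗ[k] Φ.Gr) fun j =>
      LinearMap.flip (Φ.pieceBracket i j))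

lemma grBracket_symb (i j : ℤ) (x : Φ.F i) (y : Φ.F j) :
    Φ.grBracket (Φ.symb i x) (Φ.symb j y) =
      Φ.symb (i + j) ⟨⁅x.1, y.1⁆, Φ.lie_mem i j x y x.2 y.2⟩ := by
  have h1 : Φ.grBracket (Φ.symb i x) = (LinearMap.flip
      (DirectSum.toModule k ℤ (Φ.Piece i →ₗ[k] Φ.Gr) fun j =>
      LinearMap.flip (Φ.pieceBracket i j))) (Submodule.mkQ _ x) :=
    DirectSum.toModule_lof k i _
  rw [h1]
  have h2 := DirectSum.toModule_lof k (M := Φ.Piece) (N := Φ.Piece i →ₗ[k] Φ.Gr)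
    (φ := fun j => LinearMap.flip (Φ.pieceBracket i j)) j (Submodule.mkQ _ y)
  exact congrArg (fun f => f (Submodule.mkQ _ x)) h2

lemma gr_induction {p : Φ.Gr → Prop} (x : Φ.Gr) (h0 : p 0)
    (hadd : ∀ x y, p x → p y → p (x + y)) (hs : ∀ i x, p (Φ.symb i x)) : p x := by
  refine DirectSum.induction_on (motive := p) x h0 (fun i x => ?_) hadd
  obtain ⟨y, rfl⟩ := Submodule.mkQ_surjective _ x
  exact hs i y

lemma grBracket_skew (x y : Φ.Gr) : Φ.grBracket x y = - Φ.grBracket y x := by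
  induction x using gr_induction with
  | h0 => simp
  | hadd x x' h h' => simp only [map_add, LinearMap.add_apply, h, h']; abel
  | hs i x =>
    induction y using gr_induction with
    | h0 => simp
    | hadd y y' h h' => simp only [map_add, LinearMap.add_apply, h, h']; abel
    | hs j y =>
      rw [grBracket_symb, grBracket_symb, ← map_neg]
      have h := Φ.lie_mem i j x y x.2 y.2
      have h' := Φ.lie_mem j i y x y.2 x.2
      rw [Φ.symb_congr (add_comm i j) _ h (by rw [add_comm j i]; exact h)]
      congr 1
      ext
      simp

lemma grBracket_self (x : Φ.Gr) : Φ.grBracket x x = 0 := by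
  induction x using gr_induction with
  | h0 => simp
  | hadd x x' h h' =>
    simp only [map_add, LinearMap.add_apply, h, h']
    rw [grBracket_skew Φ x x']; abel
  | hs i x =>
    rw [grBracket_symb]
    apply Φ.symb_eq_zero
    simp

lemma grBracket_leibniz (x y z : Φ.Gr) :
    Φ.grBracket x (Φ.grBracket y z) =
      Φ.grBracket (Φ.grBracket x y) z + Φ.grBracket y (Φ.grBracket x z) := by
  induction x using gr_induction with
  | h0 => simp
  | hadd x x' h h' => simp only [map_add, LinearMap.add_apply, h, h']; abel
  | hs i x =>
    induction y using gr_induction with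
    | h0 => simp
    | hadd y y' h h' => simp only [map_add, LinearMap.add_apply, h, h']; abel
    | hs j y =>
      induction z using gr_induction with
      | h0 => simp
      | hadd z z' h h' => simp only [map_add, h, h']; abel
      | hs l z =>
        simp only [grBracket_symb]
        have e1 : i + j + l = i + (j + l) := by ring
        have e2 : j + (i + l) = i + (j + l) := by ring
        have m1 := Φ.lie_mem _ _ _ _ (Φ.lie_mem i j x y x.2 y.2) z.2
        have m2 := Φ.lie_mem _ _ _ _ y.2 (Φ.lie_mem i l x z x.2 z.2)
        rw [Φ.symb_congr e1 _ m1 (e1 ▸ m1), Φ.symb_congr e2 _ m2 (e2 ▸ m2), ← map_add]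
        congr 1
        ext
        simp

noncomputable instance : LieRing Φ.Gr where
  bracket x y := Φ.grBracket x y
  add_lie x y z := by change Φ.grBracket _ _ = Φ.grBracket _ _ + Φ.grBracket _ _; simp
  lie_add x y z := by change Φ.grBracket _ _ = Φ.grBracket _ _ + Φ.grBracket _ _; simp
  lie_self x := Φ.grBracket_self x
  leibniz_lie x y z := Φ.grBracket_leibniz x y z

noncomputable instance : LieAlgebra k Φ.Gr where
  lie_smul c x y := by change Φ.grBracket _ _ = _ • Φ.grBracket _ _; simp

end LieFiltration

/-! ### The Weisfeiler filtration -/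

namespace Weisfeiler

variable {k L : Type*} [Field k] [LieRing L] [LieAlgebra k L]

/-- `L` is simple, `M` is a maximal subalgebra of `L` with non-zero radical and `V ⊋ M` is an
`M`-invariant subspace of `L` such that the `M`-module `V / M` is irreducible. -/
structure IsWeisfeilerPair (M : LieSubalgebra k L) (V : Submodule k L) : Prop where
  simple : LieAlgebra.IsSimple k L
  maximal : IsCoatom M
  radical_ne_bot : LieAlgebra.radical k M ≠ ⊥
  lt : M.toSubmodule < V
  invariant : ∀ x ∈ M, ∀ v ∈ V, ⁅x, v⁆ ∈ V
  irreducible : ∀ U : Submodule k L, M.toSubmodule ≤ U → U ≤ V →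
    (∀ x ∈ M, ∀ u ∈ U, ⁅x, u⁆ ∈ U) → U = M.toSubmodule ∨ U = V

/-- `{x ∈ U | [x, V] ⊆ U}` -/
def stab (V U : Submodule k L) : Submodule k L where
  carrier := {x | x ∈ U ∧ ∀ v ∈ V, ⁅x, v⁆ ∈ U}
  add_mem' {x y} hx hy := ⟨U.add_mem hx.1 hy.1, fun v hv => by
    rw [add_lie]; exact U.add_mem (hx.2 v hv) (hy.2 v hv)⟩
  zero_mem' := ⟨U.zero_mem, fun v _ => by simp⟩
  smul_mem' c x hx := ⟨U.smul_mem c hx.1, fun v hv => by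
    rw [smul_lie]; exact U.smul_mem c (hx.2 v hv)⟩

/-- `M₍₀₎ = M` and `M₍ₙ₊₁₎ = {x ∈ M₍ₙ₎ | [x, M₍₋₁₎] ⊆ M₍ₙ₎}`, where `M₍₋₁₎ = V`. -/
def pos (M : LieSubalgebra k L) (V : Submodule k L) : ℕ → Submodule k L
  | 0 => M.toSubmodule
  | n + 1 => stab V (pos M V n)

/-- `neg V n = M₍₋ₙ₋₁₎`, where `M₍₋₁₎ = V` and `M₍₋ₙ₋₁₎ = [M₍₋ₙ₎, M₍₋₁₎] + M₍₋ₙ₎`. -/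
def neg (V : Submodule k L) : ℕ → Submodule k L
  | 0 => V
  | n + 1 => Submodule.span k {z | ∃ x ∈ neg V n, ∃ v ∈ V, ⁅x, v⁆ = z} ⊔ neg V n

/-- The subspaces `M₍ᵢ₎` of the Weisfeiler filtration. -/
def fil (M : LieSubalgebra k L) (V : Submodule k L) : ℤ → Submodule k L
  | Int.ofNat n => pos M V n
  | Int.negSucc n => neg V n

variable {M : LieSubalgebra k L} {V : Submodule k L}

lemma fil_succ_le (hle : M.toSubmodule ≤ V) (i : ℤ) : fil M V (i + 1) ≤ fil M V i := by
  rcases i with n | n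
  · exact fun x hx => hx.1
  · rcases n with _ | n
    · exact hle
    · have : Int.negSucc (n + 1) + 1 = Int.negSucc n := by omega
      rw [this]
      exact le_sup_right

lemma fil_lie_one (hinv : ∀ x ∈ M, ∀ v ∈ V, ⁅x, v⁆ ∈ V) (i : ℤ) (x v : L)
    (hx : x ∈ fil M V i) (hv : v ∈ V) : ⁅x, v⁆ ∈ fil M V (i - 1) := by
  rcases i with n | n
  · rcases n with _ | n
    · exact hinv x hx v hv
    · have : Int.ofNat (n + 1) - 1 = Int.ofNat n := by simp
      rw [this]
      exact hx.2 v hv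
  · have : Int.negSucc n - 1 = Int.negSucc (n + 1) := by omega
    rw [this]
    exact Submodule.mem_sup_left (Submodule.subset_span ⟨x, hx, v, hv, rfl⟩)

lemma fil_lie_neg (hle : M.toSubmodule ≤ V) (hinv : ∀ x ∈ M, ∀ v ∈ V, ⁅x, v⁆ ∈ V) (n : ℕ) :
    ∀ (i : ℤ) (x y : L), x ∈ fil M V i → y ∈ neg V n → ⁅x, y⁆ ∈ fil M V (i + Int.negSucc n) := by
  induction n with
  | zero => exact fun i x y hx hy => fil_lie_one hinv i x y hx hy
  | succ n ih =>
    intro i x y hx hy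
    have e : i + Int.negSucc (n + 1) = i + Int.negSucc n - 1 := by omega
    obtain ⟨a, ha, b, hb, rfl⟩ := Submodule.mem_sup.1 hy
    rw [lie_add]
    refine Submodule.add_mem _ ?_ ?_
    · induction ha using Submodule.span_induction with
      | mem z hz =>
        obtain ⟨u, hu, v, hv, rfl⟩ := hz
        rw [leibniz_lie]
        refine Submodule.add_mem _ ?_ ?_
        · rw [e]
          exact fil_lie_one hinv _ _ _ (ih i x u hx hu) hv
        · rw [← lie_skew]
          refine Submodule.neg_mem _ ?_
          have := ih (i - 1) ⁅x, v⁆ u (fil_lie_one hinv i x v hx hv) hu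
          rwa [e, show i + Int.negSucc n - 1 = i - 1 + Int.negSucc n by omega]
      | zero => simp
      | add p q hp hq h1 h2 =>
        rw [lie_add]
        exact Submodule.add_mem _ (h1 (Submodule.add_mem _ (Submodule.mem_sup_left hp)
          (Submodule.mem_sup_right hb))) (h2 (Submodule.add_mem _ (Submodule.mem_sup_left hq)
          (Submodule.mem_sup_right hb)))
      | smul c p hp h1 =>
        rw [lie_smul]
        exact Submodule.smul_mem _ c (h1 (Submodule.add_mem _ (Submodule.mem_sup_left hp)
          (Submodule.mem_sup_right hb)))
    · have := fil_succ_le hle (i + Int.negSucc (n + 1))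
      rw [show i + Int.negSucc (n + 1) + 1 = i + Int.negSucc n by omega] at this
      exact this (ih i x b hx hb)

lemma fil_lie_pos (hinv : ∀ x ∈ M, ∀ v ∈ V, ⁅x, v⁆ ∈ V) (n : ℕ) :
    ∀ (i j : ℕ) (x y : L), i + j = n → x ∈ pos M V i → y ∈ pos M V j → ⁅x, y⁆ ∈ pos M V n := by
  induction n with
  | zero =>
    intro i j x y h hx hy
    obtain ⟨rfl, rfl⟩ : i = 0 ∧ j = 0 := by omega
    exact M.lie_mem hx hy
  | succ n ih =>
    have key : ∀ (i j : ℕ) (x y v : L), i + j = n + 1 → x ∈ pos M V i → y ∈ pos M V j →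
        v ∈ V → ⁅x, ⁅y, v⁆⁆ ∈ pos M V n := by
      intro i j x y v h hx hy hv
      rcases j with _ | j
      · have h1 : ⁅y, v⁆ ∈ V := hinv y hy v hv
        obtain rfl : i = n + 1 := by omega
        exact hx.2 _ h1
      · exact ih i j x _ (by omega) hx (hy.2 v hv)
    intro i j x y h hx hy
    refine ⟨?_, fun v hv => ?_⟩
    · rcases i with _ | i
      · obtain rfl : j = n + 1 := by omega
        exact ih 0 n x y (by omega) hx hy.1
      · exact ih i j x y (by omega) hx.1 hy
    · rw [lie_lie]
      exact Submodule.sub_mem _ (key i j x y v h hx hy hv) (key j i y x v (by omega) hy hx hv)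

/-- The Weisfeiler filtration associated with the pair `(M, V)`. -/
def filtration (h : IsWeisfeilerPair M V) : LieFiltration k L where
  F := fil M V
  succ_le := fil_succ_le h.lt.le
  lie_mem i j x y hx hy := by
    rcases j with j | j
    · rcases i with i | i
      · exact fil_lie_pos h.invariant (i + j) i j x y rfl hx hy
      · rw [← lie_skew, add_comm]
        exact Submodule.neg_mem _ (fil_lie_neg h.lt.le h.invariant i _ y x hy hx)
    · exact fil_lie_neg h.lt.le h.invariant j i x y hx hy

end Weisfeiler

/-! ### Lie algebras of Cartan type in characteristic 3 -/

namespace Cartan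

/-- The ideal `(x₁³, …, xₘ³)` of the polynomial ring. -/
noncomputable def cubes (k : Type*) [Field k] (m : ℕ) : Ideal (MvPolynomial (Fin m) k) :=
  Ideal.span (Set.range fun i => MvPolynomial.X i ^ 3)

/-- The truncated polynomial ring `k[x₁, …, xₘ] / (x₁³, …, xₘ³)`. In characteristic `3` it is the
divided power algebra `O(m; 1)`. -/
def O (k : Type*) [Field k] (m : ℕ) : Type _ := MvPolynomial (Fin m) k ⧸ cubes k m

variable {k : Type*} [Field k] {m : ℕ}

noncomputable instance : CommRing (O k m) :=
  inferInstanceAs (CommRing (MvPolynomial (Fin m) k ⧸ cubes k m))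

noncomputable instance : Algebra k (O k m) :=
  inferInstanceAs (Algebra k (MvPolynomial (Fin m) k ⧸ cubes k m))

/-- The quotient map from the polynomial ring to the truncated polynomial ring. -/
noncomputable def mk (k : Type*) [Field k] (m : ℕ) : MvPolynomial (Fin m) k →ₐ[k] O k m :=
  Ideal.Quotient.mkₐ k (cubes k m)

lemma mk_surjective : Function.Surjective (mk k m) :=
  Ideal.Quotient.mkₐ_surjective k (cubes k m)

lemma mk_eq_zero (f : MvPolynomial (Fin m) k) : mk k m f = 0 ↔ f ∈ cubes k m :=
  Ideal.Quotient.eq_zero_iff_mem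

/-- The generators `xᵢ`. -/
noncomputable def x (k : Type*) [Field k] {m : ℕ} (i : Fin m) : O k m := mk k m (MvPolynomial.X i)

lemma ext_x {D E : Derivation k (O k m) (O k m)} (h : ∀ i, D (x k i) = E (x k i)) : D = E := by
  ext f
  obtain ⟨f, rfl⟩ := mk_surjective f
  induction f using MvPolynomial.induction_on with
  | C a =>
    have : mk k m (MvPolynomial.C a) = algebraMap k (O k m) a := (mk k m).commutes a
    rw [this, D.map_algebraMap, E.map_algebraMap]
  | add p q hp hq => simp only [map_add, hp, hq]
  | mul_X p i hp =>
    rw [map_mul, D.leibniz, E.leibniz, hp]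
    have := h i
    rw [x] at this
    rw [this]

lemma pderiv_cubes [CharP k 3] (i : Fin m) (f : MvPolynomial (Fin m) k) (hf : f ∈ cubes k m) :
    MvPolynomial.pderiv i f ∈ cubes k m := by
  induction hf using Submodule.span_induction with
  | mem f hf =>
    obtain ⟨j, rfl⟩ := hf
    have h3 : (3 : MvPolynomial (Fin m) k) = 0 := by
      have := CharP.cast_eq_zero (MvPolynomial (Fin m) k) 3
      exact_mod_cast this
    simp [Derivation.leibniz_pow, h3]
  | zero => simp
  | add f g _ _ hf hg => rw [map_add]; exact Ideal.add_mem _ hf hg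
  | smul a f hf h =>
    rw [smul_eq_mul, Derivation.leibniz, smul_eq_mul, smul_eq_mul]
    exact Ideal.add_mem _ (Ideal.mul_mem_left _ _ h) (Ideal.mul_mem_right _ _ hf)

/-- The partial derivative `∂ᵢ` of the truncated polynomial ring. -/
noncomputable def pd (k : Type*) [Field k] [CharP k 3] {m : ℕ} (i : Fin m) :
    Derivation k (O k m) (O k m) :=
  Derivation.liftOfSurjective (f := mk k m) mk_surjective (d := MvPolynomial.pderiv i)
    (fun f hf => (mk_eq_zero _).2 (pderiv_cubes i f ((mk_eq_zero f).1 hf)))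

section

variable [CharP k 3]

lemma pd_x (i j : Fin m) : pd k i (x k j) = if i = j then 1 else 0 := by
  rw [pd, x, Derivation.liftOfSurjective_apply, MvPolynomial.pderiv_X]
  by_cases h : i = j
  · subst h; simp
  · simp [h, Ne.symm h]

lemma sum_smul_apply (g : Fin m → O k m) (f : O k m) :
    (∑ i, g i • pd k i : Derivation k (O k m) (O k m)) f = ∑ i, g i * pd k i f := by
  have h := map_sum (Derivation.coeFnAddMonoidHom (R := k) (A := O k m) (M := O k m))
    (fun i => g i • pd k i) Finset.univ
  have h' := congrFun h f
  rw [Finset.sum_apply] at h'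
  exact h'

lemma sum_apply (D : Derivation k (O k m) (O k m)) (f : O k m) :
    D f = ∑ i, D (x k i) * pd k i f := by
  have : D = ∑ i, D (x k i) • pd k i := by
    apply ext_x
    intro j
    rw [sum_smul_apply]
    simp [pd_x]
  conv_lhs => rw [this]
  rw [sum_smul_apply]

lemma pd_comm (i j : Fin m) (f : O k m) : pd k i (pd k j f) = pd k j (pd k i f) := by
  have : ⁅pd k i, pd k j⁆ = (0 : Derivation k (O k m) (O k m)) := by
    apply ext_x
    intro l
    rw [Derivation.commutator_apply, pd_x, pd_x]
    split_ifs <;> simp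
  have h := congrArg (fun D : Derivation k (O k m) (O k m) => D f) this
  simp only [Derivation.commutator_apply] at h
  exact sub_eq_zero.1 h

end

/-- The Lie algebra `W(m; 1)` of derivations of the truncated polynomial ring. -/
abbrev W (k : Type*) [Field k] (m : ℕ) : Type _ := Derivation k (O k m) (O k m)

lemma W_lie_smul (c : k) (D E : W k m) : ⁅D, c • E⁆ = c • ⁅D, E⁆ := by
  apply ext_x
  intro i
  simp only [Derivation.commutator_apply, Derivation.smul_apply, Derivation.map_smul, smul_sub]

/-- The divergence `div (∑ fᵢ ∂ᵢ) = ∑ ∂ᵢ fᵢ`. -/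
noncomputable def dvg [CharP k 3] : W k m →ₗ[k] O k m where
  toFun D := ∑ i, pd k i (D (x k i))
  map_add' D E := by simp [Finset.sum_add_distrib]
  map_smul' c D := by simp [Finset.smul_sum]

section

variable [CharP k 3]

lemma dvg_apply (D : W k m) : dvg D = ∑ i, pd k i (D (x k i)) := rfl

lemma dvg_lie (D E : W k m) : dvg ⁅D, E⁆ = D (dvg E) - E (dvg D) := by
  simp only [dvg_apply, Derivation.commutator_apply, map_sum, map_sub, Finset.sum_sub_distrib]
  have key : ∀ D E : W k m, ∑ i, pd k i (D (E (x k i))) =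
      ∑ i, D (pd k i (E (x k i))) + ∑ i, ∑ j, pd k i (D (x k j)) * pd k j (E (x k i)) := by
    intro D E
    rw [← Finset.sum_add_distrib]
    refine Finset.sum_congr rfl fun i _ => ?_
    rw [sum_apply D (E (x k i)), sum_apply D (pd k i (E (x k i))), map_sum,
      ← Finset.sum_add_distrib]
    refine Finset.sum_congr rfl fun j _ => ?_
    rw [Derivation.leibniz, pd_comm i j]
    simp only [smul_eq_mul]
    ring
  have sw : ∑ i, ∑ j, pd k i (D (x k j)) * pd k j (E (x k i)) =
      ∑ i, ∑ j, pd k i (E (x k j)) * pd k j (D (x k i)) := by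
    rw [Finset.sum_comm]
    exact Finset.sum_congr rfl fun i _ => Finset.sum_congr rfl fun j _ => mul_comm _ _
  rw [key D E, key E D, sw]
  ring

end

/-- The Lie algebra of derivations of divergence zero. -/
noncomputable def S (k : Type*) [Field k] [CharP k 3] (m : ℕ) : LieSubalgebra k (W k m) where
  toSubmodule := LinearMap.ker dvg
  lie_mem' {D E} hD hE := by
    change dvg D = 0 at hD
    change dvg E = 0 at hE
    change dvg ⁅D, E⁆ = 0
    rw [dvg_lie, hD, hE, map_zero, map_zero, sub_zero]

/-- The Lie algebra `H(2; 1)` of the derivations `f₁∂₁ + f₂∂₂` with `∂₁f₁ + ∂₂f₂ = 0`. -/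
noncomputable abbrev H (k : Type*) [Field k] [CharP k 3] : LieSubalgebra k (W k 2) := S k 2

/-- The degree derivation `x₁∂₁ + … + xₘ∂ₘ`. -/
noncomputable def deg (k : Type*) [Field k] [CharP k 3] (m : ℕ) : W k m := ∑ i, x k i • pd k i

lemma dvg_deg [CharP k 3] : dvg (deg k m) = (m : O k m) := by
  simp only [dvg_apply, deg, sum_smul_apply]
  simp [pd_x]

lemma deg_lie_mem [CharP k 3] {D : W k m} (hD : D ∈ S k m) : ⁅deg k m, D⁆ ∈ S k m := by
  change dvg D = 0 at hD
  change dvg ⁅deg k m, D⁆ = 0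
  rw [dvg_lie, hD, dvg_deg, map_zero, Derivation.map_natCast, sub_zero]

/-- The Lie algebra `CH(2; 1) = H(2; 1) + k (x₁∂₁ + x₂∂₂)`. -/
noncomputable def CH (k : Type*) [Field k] [CharP k 3] : LieSubalgebra k (W k 2) where
  toSubmodule := (H k).toSubmodule ⊔ k ∙ deg k 2
  lie_mem' {D' E'} hD' hE' := by
    obtain ⟨D, hD, _, hc, rfl⟩ := Submodule.mem_sup.1 hD'
    obtain ⟨E, hE, _, hd, rfl⟩ := Submodule.mem_sup.1 hE'
    obtain ⟨c, rfl⟩ := Submodule.mem_span_singleton.1 hc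
    obtain ⟨d, rfl⟩ := Submodule.mem_span_singleton.1 hd
    refine Submodule.mem_sup_left ?_
    have h1 : ⁅deg k 2, E⁆ ∈ H k := deg_lie_mem hE
    have h2 : ⁅D, deg k 2⁆ ∈ H k := by
      rw [← lie_skew]
      exact (H k).neg_mem (deg_lie_mem hD)
    have h3 : ⁅D, E⁆ ∈ H k := (H k).lie_mem hD hE
    change ⁅D + c • deg k 2, E + d • deg k 2⁆ ∈ H k
    have h4 : ⁅D + c • deg k 2, E + d • deg k 2⁆ =
        ⁅D, E⁆ + c • ⁅deg k 2, E⁆ + d • ⁅D, deg k 2⁆ := by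
      rw [add_lie, lie_add, lie_add, smul_lie, smul_lie, W_lie_smul, W_lie_smul, lie_self,
        smul_zero, smul_zero, add_zero]
      abel
    rw [h4]
    exact (H k).add_mem ((H k).add_mem h3 ((H k).smul_mem c h1)) ((H k).smul_mem d h2)

/-! ### The graded Lie algebras of Skryabin -/

/-- Differential forms `f₁dx₁ + f₂dx₂ + f₃dx₃` of degree `1` in three variables. -/
abbrev Form (k : Type*) [Field k] : Type _ := Fin 3 → O k 3

/-- The vector field
`[∑ fᵢdxᵢ, ∑ gᵢdxᵢ] = (f₂g₃ - f₃g₂) ∂₁ + (f₃g₁ - f₁g₃) ∂₂ + (f₁g₂ - f₂g₁) ∂₃`. -/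
noncomputable def cross [CharP k 3] (f g : Form k) : W k 3 :=
  ∑ i : Fin 3, (f (i + 1) * g (i + 2) - f (i + 2) * g (i + 1)) • pd k i

/-- The twisted action of vector fields on `1`-forms: the Lie derivative
`D (f dxⱼ) = D(f) dxⱼ + f d(D xⱼ)` plus multiplication by `div D`. -/
noncomputable def act [CharP k 3] (D : W k 3) (f : Form k) : Form k := fun i =>
  D (f i) + ∑ j, f j * pd k i (D (x k j)) + dvg D * f i

/-- The vector space `W(3; 1) ⊕ Ω¹(3; 1)` underlying the Lie algebra `𝒮₂(1)`. -/
def S2 (k : Type*) [Field k] : Type _ := W k 3 × Form k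

noncomputable instance : AddCommGroup (S2 k) := inferInstanceAs (AddCommGroup (W k 3 × Form k))

noncomputable instance : Module k (S2 k) := inferInstanceAs (Module k (W k 3 × Form k))

section

variable [CharP k 3]

lemma three_eq_zero : (3 : O k 3) = 0 := by
  have h : ((3 : ℕ) : k) = 0 := CharP.cast_eq_zero k 3
  have := congrArg (algebraMap k (O k 3)) h
  rw [map_natCast, map_zero] at this
  exact_mod_cast this

lemma cross_apply (f g : Form k) (h : O k 3) : cross f g h =
    (f 1 * g 2 - f 2 * g 1) * pd k 0 h + (f 2 * g 0 - f 0 * g 2) * pd k 1 h +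
      (f 0 * g 1 - f 1 * g 0) * pd k 2 h := by
  rw [cross, sum_smul_apply, Fin.sum_univ_three]
  rfl

lemma act_apply (D : W k 3) (f : Form k) (i : Fin 3) : act D f i =
    D (f i) + (f 0 * pd k i (D (x k 0)) + f 1 * pd k i (D (x k 1)) + f 2 * pd k i (D (x k 2))) +
      (pd k 0 (D (x k 0)) + pd k 1 (D (x k 1)) + pd k 2 (D (x k 2))) * f i := by
  rw [act, dvg_apply, Fin.sum_univ_three, Fin.sum_univ_three]

lemma pd_apply (D : W k 3) (f : O k 3) (i : Fin 3) : pd k i (D f) = D (pd k i f) +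
    (pd k i (D (x k 0)) * pd k 0 f + pd k i (D (x k 1)) * pd k 1 f +
      pd k i (D (x k 2)) * pd k 2 f) := by
  rw [sum_apply D f, sum_apply D (pd k i f)]
  simp only [Fin.sum_univ_three, map_add, Derivation.leibniz, smul_eq_mul]
  rw [pd_comm i 0, pd_comm i 1, pd_comm i 2]
  ring

lemma act_lie (D E : W k 3) (f : Form k) :
    act ⁅D, E⁆ f = act D (act E f) - act E (act D f) := by
  funext i
  simp only [Pi.sub_apply, act_apply, Derivation.commutator_apply, map_add, map_sub,
    Derivation.leibniz, smul_eq_mul]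
  simp only [pd_apply D (E _), pd_apply E (D _)]
  ring

lemma lie_cross (D : W k 3) (f g : Form k) :
    ⁅D, cross f g⁆ = cross (act D f) g + cross f (act D g) := by
  apply ext_x
  intro l
  have h3 := three_eq_zero (k := k)
  have h : (cross (act D f) g + cross f (act D g)) (x k l) = ⁅D, cross f g⁆ (x k l) +
      3 * ((pd k 0 (D (x k 0)) + pd k 1 (D (x k 1)) + pd k 2 (D (x k 2))) *
        cross f g (x k l)) := by
    rw [Derivation.commutator_apply, Derivation.add_apply]
    simp only [cross_apply, pd_x, act_apply]
    fin_cases l <;> simp [Derivation.leibniz] <;> ring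
  rw [h, h3, zero_mul, add_zero]

/-- The coefficient of the `3`-form `f ∧ g ∧ h`. -/
noncomputable def det3 (f g h : Form k) : O k 3 :=
  (f 1 * g 2 - f 2 * g 1) * h 0 + (f 2 * g 0 - f 0 * g 2) * h 1 + (f 0 * g 1 - f 1 * g 0) * h 2

lemma act_cross_cyclic (f g h : Form k) :
    act (cross f g) h + act (cross g h) f + act (cross h f) g = 0 := by
  funext i
  have h3 := three_eq_zero (k := k)
  have : (act (cross f g) h + act (cross g h) f + act (cross h f) g) i =
      3 * pd k i (det3 f g h) := by
    simp only [Pi.add_apply, act_apply, cross_apply, pd_x, det3]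
    fin_cases i <;> simp [Derivation.leibniz] <;> ring
  rw [this, h3, zero_mul, Pi.zero_apply]

lemma cross_self (f : Form k) : cross f f = 0 := by
  apply ext_x
  intro l
  rw [cross_apply, Derivation.zero_apply]
  ring

lemma cross_skew (f g : Form k) : cross f g = - cross g f := by
  apply ext_x
  intro l
  rw [cross_apply, Derivation.neg_apply, cross_apply]
  ring

lemma cross_add_left (f f' g : Form k) : cross (f + f') g = cross f g + cross f' g := by
  apply ext_x
  intro l
  simp only [cross_apply, Derivation.add_apply, Pi.add_apply]
  ring

lemma cross_smul_right (c : k) (f g : Form k) : cross f (c • g) = c • cross f g := by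
  apply ext_x
  intro l
  simp only [cross_apply, Derivation.smul_apply, Pi.smul_apply, smul_add, mul_smul_comm,
    smul_mul_assoc, ← smul_sub]

lemma cross_add_right (f g g' : Form k) : cross f (g + g') = cross f g + cross f g' := by
  rw [cross_skew, cross_add_left, cross_skew f g, cross_skew f g']
  abel

lemma act_add_left (D E : W k 3) (f : Form k) : act (D + E) f = act D f + act E f := by
  funext i
  simp only [act_apply, Derivation.add_apply, Pi.add_apply, map_add]
  ring

lemma act_add_right (D : W k 3) (f g : Form k) : act D (f + g) = act D f + act D g := by
  funext i
  simp only [act_apply, Pi.add_apply, map_add]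
  ring

lemma act_smul_left (c : k) (D : W k 3) (f : Form k) : act (c • D) f = c • act D f := by
  funext i
  simp only [act_apply, Derivation.smul_apply, Derivation.map_smul, mul_smul_comm,
    smul_mul_assoc, ← smul_add]
  rw [Pi.smul_apply, act_apply]

lemma act_smul_right (c : k) (D : W k 3) (f : Form k) : act D (c • f) = c • act D f := by
  funext i
  simp only [act_apply, Pi.smul_apply, Derivation.map_smul, smul_add, mul_smul_comm, smul_mul_assoc]

lemma act_sub_right (D : W k 3) (f g : Form k) : act D (f - g) = act D f - act D g := by
  rw [eq_sub_iff_add_eq, ← act_add_right, sub_add_cancel]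

lemma cross_sub_right (f g h : Form k) : cross f (g - h) = cross f g - cross f h := by
  rw [eq_sub_iff_add_eq, ← cross_add_right, sub_add_cancel]

lemma cross_sub_left (f g h : Form k) : cross (f - g) h = cross f h - cross g h := by
  rw [eq_sub_iff_add_eq, ← cross_add_left, sub_add_cancel]

lemma jacobi_fst (D E F : W k 3) (f g h : Form k) :
    ⁅D, ⁅E, F⁆ + cross g h⁆ + cross f (act E h - act F g) =
      (⁅⁅D, E⁆ + cross f g, F⁆ + cross (act D g - act E f) h) +
      (⁅E, ⁅D, F⁆ + cross f h⁆ + cross g (act D h - act F f)) := by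
  rw [lie_add, lie_add, add_lie, leibniz_lie D, ← lie_skew (cross f g) F, lie_cross,
    lie_cross, lie_cross, cross_sub_right, cross_sub_right, cross_sub_left, cross_skew g (act F f)]
  abel

lemma jacobi_snd (D E F : W k 3) (f g h : Form k) :
    act D (act E h - act F g) - act (⁅E, F⁆ + cross g h) f =
      (act (⁅D, E⁆ + cross f g) h - act F (act D g - act E f)) +
      (act E (act D h - act F f) - act (⁅D, F⁆ + cross f h) g) := by
  have hc := act_cross_cyclic f g h
  have h' : act (cross h f) g = - act (cross f h) g := by
    rw [cross_skew, ← neg_one_smul k, act_smul_left, neg_one_smul]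
  rw [h'] at hc
  simp only [act_add_left, act_lie, act_sub_right]
  rw [← sub_eq_zero, ← neg_eq_zero, ← hc]
  abel

end

/-- The bracket `[D, E] = DE - ED`, `[D, λ] = D λ + div(D) λ` and
`[∑ fᵢdxᵢ, ∑ gᵢdxᵢ] = (f₂g₃ - f₃g₂) ∂₁ + (f₃g₁ - f₁g₃) ∂₂ + (f₁g₂ - f₂g₁) ∂₃` of `𝒮₂(1)`. -/
noncomputable instance [CharP k 3] : LieRing (S2 k) where
  bracket a b := (⁅a.1, b.1⁆ + cross a.2 b.2, act a.1 b.2 - act b.1 a.2)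
  add_lie a b c := by
    refine Prod.ext ?_ ?_
    · change ⁅a.1 + b.1, c.1⁆ + cross (a.2 + b.2) c.2 =
        (⁅a.1, c.1⁆ + cross a.2 c.2) + (⁅b.1, c.1⁆ + cross b.2 c.2)
      rw [add_lie, cross_add_left]; abel
    · change act (a.1 + b.1) c.2 - act c.1 (a.2 + b.2) =
        (act a.1 c.2 - act c.1 a.2) + (act b.1 c.2 - act c.1 b.2)
      rw [act_add_left, act_add_right]; abel
  lie_add a b c := by
    refine Prod.ext ?_ ?_
    · change ⁅a.1, b.1 + c.1⁆ + cross a.2 (b.2 + c.2) =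
        (⁅a.1, b.1⁆ + cross a.2 b.2) + (⁅a.1, c.1⁆ + cross a.2 c.2)
      rw [lie_add, cross_add_right]; abel
    · change act a.1 (b.2 + c.2) - act (b.1 + c.1) a.2 =
        (act a.1 b.2 - act b.1 a.2) + (act a.1 c.2 - act c.1 a.2)
      rw [act_add_left, act_add_right]; abel
  lie_self a := by
    refine Prod.ext ?_ ?_
    · change ⁅a.1, a.1⁆ + cross a.2 a.2 = 0
      rw [lie_self, cross_self, add_zero]
    · change act a.1 a.2 - act a.1 a.2 = 0
      rw [sub_self]
  leibniz_lie a b c := Prod.ext (jacobi_fst a.1 b.1 c.1 a.2 b.2 c.2)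
    (jacobi_snd a.1 b.1 c.1 a.2 b.2 c.2)

noncomputable instance [CharP k 3] : LieAlgebra k (S2 k) where
  lie_smul c a b := by
    refine Prod.ext ?_ ?_
    · change ⁅a.1, c • b.1⁆ + cross a.2 (c • b.2) = c • (⁅a.1, b.1⁆ + cross a.2 b.2)
      rw [W_lie_smul, cross_smul_right, smul_add]
    · change act a.1 (c • b.2) - act (c • b.1) a.2 = c • (act a.1 b.2 - act b.1 a.2)
      rw [act_smul_left, act_smul_right, smul_sub]

section

variable [CharP k 3]

/-- The differential `df = ∑ ∂ᵢf dxᵢ`. -/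
noncomputable def d (k : Type*) [Field k] [CharP k 3] : O k 3 →ₗ[k] Form k where
  toFun f i := pd k i f
  map_add' f g := by funext i; simp
  map_smul' c f := by funext i; simp

lemma d_apply (f : O k 3) (i : Fin 3) : d k f i = pd k i f := rfl

lemma dvg_cross_d (f g : O k 3) : dvg (cross (d k f) (d k g)) = 0 := by
  simp only [dvg_apply, Fin.sum_univ_three, cross_apply, pd_x, d_apply]
  simp [Derivation.leibniz]
  rw [pd_comm 1 0 f, pd_comm 2 0 f, pd_comm 2 1 f, pd_comm 1 0 g, pd_comm 2 0 g, pd_comm 2 1 g]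
  ring

lemma act_d {D : W k 3} (hD : dvg D = 0) (f : O k 3) : act D (d k f) = d k (D f) := by
  funext i
  rw [act, d_apply, hD, zero_mul, add_zero, Fin.sum_univ_three]
  simp only [d_apply]
  rw [pd_apply D f]
  ring

end

/-- The Lie algebra `𝒮₃(1, ω_S) = S(3; 1) ⊕ dO(3; 1)`. -/
noncomputable def S3 (k : Type*) [Field k] [CharP k 3] : LieSubalgebra k (S2 k) where
  carrier := {a | dvg a.1 = 0 ∧ ∃ f, d k f = a.2}
  add_mem' := by
    rintro a b ⟨ha, f, hf⟩ ⟨hb, g, hg⟩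
    refine ⟨?_, f + g, ?_⟩
    · change dvg (a.1 + b.1) = 0
      rw [map_add, ha, hb, add_zero]
    · rw [map_add, hf, hg]; rfl
  zero_mem' := ⟨map_zero _, 0, map_zero _⟩
  smul_mem' := by
    rintro c a ⟨ha, f, hf⟩
    refine ⟨?_, c • f, ?_⟩
    · change dvg (c • a.1) = 0
      rw [map_smul, ha, smul_zero]
    · rw [map_smul, hf]; rfl
  lie_mem' := by
    rintro a b ⟨ha, f, hf⟩ ⟨hb, g, hg⟩
    refine ⟨?_, a.1 g - b.1 f, ?_⟩
    · change dvg (⁅a.1, b.1⁆ + cross a.2 b.2) = 0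
      rw [← hf, ← hg, map_add, dvg_cross_d, dvg_lie, ha, hb, map_zero, map_zero, sub_zero,
        add_zero]
    · change _ = act a.1 b.2 - act b.1 a.2
      rw [map_sub, ← act_d ha, ← act_d hb, hf, hg]

/-- The derived algebra `𝒮₃(1, ω_S)⁽¹⁾`. -/
noncomputable abbrev S3derived (k : Type*) [Field k] [CharP k 3] : LieIdeal k (S3 k) :=
  LieAlgebra.derivedSeries k (S3 k) 1

end Cartan

/-! ### The subalgebras attached to an element of the Lie algebra of type `E₆` -/

namespace LieE6

variable {k : Type*} [Field k]

/-- The centraliser `𝔤_e`. -/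
noncomputable def cent (e : E6 k) : LieSubalgebra k (E6 k) := LieSub.centralizer k e

/-- The normaliser `𝔫_e` of the line `k e`. -/
noncomputable def norm (e : E6 k) : LieSubalgebra k (E6 k) := LieSub.normalizer (k ∙ e)

/-- The radical `A` of `𝔤_e`. -/
noncomputable def A (e : E6 k) : Submodule k (E6 k) := LieSub.rad (cent e)

/-- The normaliser `𝔴 = N_𝔤(A)`. -/
noncomputable def w (e : E6 k) : LieSubalgebra k (E6 k) := LieSub.normalizer (A e)

/-- The subspace `{x ∈ 𝔤 | [x, A] ⊆ 𝔴}`. -/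
noncomputable def lMinusOne (e : E6 k) : Submodule k (E6 k) := LieSub.transporter (A e) (w e)

/-- The image of `𝔴` in the quotient of `𝔤` by its centre. -/
noncomputable def wBar (e : E6 k) : LieSubalgebra k (E6 k ⧸ LieAlgebra.center k (E6 k)) :=
  (w e).map (LieSub.proj (LieAlgebra.center k (E6 k)))

/-- The image of `{x ∈ 𝔤 | [x, A] ⊆ 𝔴}` in the quotient of `𝔤` by its centre. -/
noncomputable def lMinusOneBar (e : E6 k) :
    Submodule k (E6 k ⧸ LieAlgebra.center k (E6 k)) :=
  (lMinusOne e).map (LieSub.proj (LieAlgebra.center k (E6 k)) : E6 k →ₗ[k] _)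

end LieE6

/-! Everything is read off from one filtration of 𝔤. There is a basis b₀, …, b₇₇ with b₀ = e, whose
vectors carry degrees 2, 1, 0, −1, −2, −3, −4 (with 8, 9, 18, 9, 18, 8, 8 vectors), such that the
spans `Fil b j` of the vectors of degree at least j satisfy [Fil i, Fil j] ⊆ Fil (i + j). Modulo
higher degree the vectors multiply like explicit elements of 𝒮₃(1, ω_S), graded by the exponent l of
x₃: the fields f∂₁ and f∂₂ have degree −2l, f∂₃ has degree 2 − 2l, and df has degree 1 − 2l. The
vector e corresponds to ∂₃, degree 0 to W(2;1), and b₈ to d(1) = 0; b₈ spans the centre.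

In these terms A = Fil 1, 𝔴 = Fil 0 and L₋₁ = Fil (−1). Bracketing with ∂₃ is injective on negative
degrees (`nilPivot_spec`), so 𝔤_e and 𝔫_e lie in Fil 0. There [x, e] = div(x)e, with the coefficient
div(x) in O(2;1) and x replaced by its part in W(2;1) (`topPart_lie_nil`): divergence zero gives
H(2;1), constant divergence gives CH(2;1). Fil 1 is a solvable ideal of Fil 0. A larger solvable
ideal of a subalgebra between 𝔤_e and Fil 0 would, after differentiation, contain ∂₁ and x₁∂₂ modulo
Fil 1, which the descent along its derived series excludes (`le_Fil_one_of_abelian`, `radical_eq`).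
Brackets with degree 1 detect degrees −1 and −2, which identifies the normaliser of Fil 1 and the
transporter (`normalizer_Fil_one`, `transporter_Fil_one`).

For maximality and simplicity, a subspace stable under enough brackets and not inside Fil 0 is
pushed into Fil (−1) but not into Fil 0. Differentiation turns the element obtained there into dx₃,
and multiplication by fields of degree 0 recovers all of degree −1 (`Fil_neg_one_le`). Since ∂₃, ∂₁,
∂₂ and d(x₁²x₂²x₃) generate 𝔤, maximality follows, and an ideal outside the centre is everything
(`eq_top_of_ideal`). Transitivity modulo the centre and generation of the negative part by degree −1
show that the Weisfeiler filtration is the image of `Fil` (`fil_eq`). Its graded algebra is the span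
of the 77 nonzero models. That span is the derived algebra of the 81-dimensional 𝒮₃(1, ω_S), by a
count of dimensions and a few brackets (`mem_S3derived_iff`).

The finite input is computed with integral coefficients modulo 3. Compatibility of brackets with
degrees and models is checked only for the four generators (`rows_spec`) and spreads by the Jacobi
identity (`HasLead.lie`). Elements of the group act as automorphisms, so the same basis exists for
every point of the orbit. -/

/-! ### Integral linear combinations, given by lists -/

namespace IntComb

variable {k : Type*} [Field k] {I J K M N : Type*} [AddCommGroup M] [Module k M]
  [AddCommGroup N] [Module k N]

/-- The linear combination of the vectors `v i` with the integral coefficients given by a list. -/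
def lc (k : Type*) [Field k] {I M : Type*} [AddCommGroup M] [Module k M] (v : I → M)
    (xs : List (ℤ × I)) : M :=
  (xs.map fun t => (t.1 : k) • v t.2).sum

/-- Multiplication of a formal linear combination by an integer. -/
def scale {I : Type*} (c : ℤ) (xs : List (ℤ × I)) : List (ℤ × I) :=
  xs.map fun t => (c * t.1, t.2)

/-- Substitution of formal linear combinations for the indices. -/
def bind {I J : Type*} (t : I → List (ℤ × J)) (xs : List (ℤ × I)) : List (ℤ × J) :=
  xs.flatMap fun a => scale a.1 (t a.2)

/-- Bilinear extension of a product of indices. -/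
def mul {I J K : Type*} (t : I → J → List (ℤ × K)) (xs : List (ℤ × I)) (ys : List (ℤ × J)) :
    List (ℤ × K) :=
  bind (fun i => bind (t i) ys) xs

/-- The coefficient of an index. -/
def coef {I : Type*} [DecidableEq I] (i : I) (xs : List (ℤ × I)) : ℤ :=
  (xs.map fun t => if t.2 = i then t.1 else 0).sum

/-- All coefficients are divisible by `3`. -/
def isZero {I : Type*} [DecidableEq I] (xs : List (ℤ × I)) : Bool :=
  xs.all fun t => coef t.2 xs % 3 == 0

@[simp] lemma lc_nil (v : I → M) : lc k v [] = 0 := rfl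

@[simp] lemma lc_cons (v : I → M) (t : ℤ × I) (xs : List (ℤ × I)) :
    lc k v (t :: xs) = (t.1 : k) • v t.2 + lc k v xs := by
  simp [lc]

@[simp] lemma lc_append (v : I → M) (xs ys : List (ℤ × I)) :
    lc k v (xs ++ ys) = lc k v xs + lc k v ys := by
  simp [lc]

@[simp] lemma lc_scale (v : I → M) (c : ℤ) (xs : List (ℤ × I)) :
    lc k v (scale c xs) = (c : k) • lc k v xs := by
  induction xs with
  | nil => simp [scale]
  | cons t xs ih =>
    have : scale c (t :: xs) = (c * t.1, t.2) :: scale c xs := rfl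
    rw [this, lc_cons, ih, lc_cons, smul_add, smul_smul]
    push_cast
    rfl

lemma lc_congr {v w : I → M} (xs : List (ℤ × I)) (h : ∀ t ∈ xs, v t.2 = w t.2) :
    lc k v xs = lc k w xs := by
  rw [lc, lc]
  congr 1
  exact List.map_congr_left fun t ht => by rw [h t ht]

lemma lc_bind (v : J → M) (t : I → List (ℤ × J)) (xs : List (ℤ × I)) :
    lc k v (bind t xs) = lc k (fun i => lc k v (t i)) xs := by
  induction xs with
  | nil => rfl
  | cons a xs ih =>
    have : bind t (a :: xs) = scale a.1 (t a.2) ++ bind t xs := rfl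
    rw [this, lc_append, lc_scale, ih, lc_cons]

lemma map_lc (f : M →ₗ[k] N) (v : I → M) (xs : List (ℤ × I)) :
    f (lc k v xs) = lc k (fun i => f (v i)) xs := by
  induction xs with
  | nil => simp
  | cons a xs ih => simp [ih]

/-- A bracket of linear combinations, from the brackets of the vectors. -/
lemma lie_lc {L : Type*} [LieRing L] [LieAlgebra k L] (v : I → L) (w : J → L) (u : K → L)
    (t : I → J → List (ℤ × K)) (xs : List (ℤ × I)) (ys : List (ℤ × J))
    (h : ∀ a ∈ xs, ∀ b ∈ ys, ⁅v a.2, w b.2⁆ = lc k u (t a.2 b.2)) :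
    ⁅lc k v xs, lc k w ys⁆ = lc k u (mul t xs ys) := by
  rw [mul, lc_bind]
  induction xs with
  | nil => simp
  | cons a xs ih =>
    rw [lc_cons, lc_cons, add_lie, smul_lie, ih fun c hc => h c (by simp [hc]), lc_bind]
    congr 2
    have := map_lc (LieModule.toEnd k L L (v a.2) : L →ₗ[k] L) w ys
    simp only [LieModule.toEnd_apply_apply] at this
    rw [this]
    exact lc_congr (v := fun i => ⁅v a.2, w i⁆) ys fun b hb => h a (by simp) b hb

variable [DecidableEq I]

@[simp] lemma coef_nil (i : I) : coef i [] = 0 := rfl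

lemma coef_cons (i : I) (t : ℤ × I) (xs : List (ℤ × I)) :
    coef i (t :: xs) = (if t.2 = i then t.1 else 0) + coef i xs := by
  simp [coef]

lemma lc_eq_sum (v : I → M) (xs : List (ℤ × I)) (s : Finset I) (h : ∀ t ∈ xs, t.2 ∈ s) :
    lc k v xs = ∑ i ∈ s, (coef i xs : k) • v i := by
  induction xs with
  | nil => simp
  | cons a xs ih =>
    rw [lc_cons, ih fun t ht => h t (by simp [ht])]
    simp only [coef_cons, Int.cast_add, add_smul, Finset.sum_add_distrib]
    congr 1
    rw [Finset.sum_eq_single a.2]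
    · simp
    · intro i _ hi
      rw [if_neg (Ne.symm hi), Int.cast_zero, zero_smul]
    · exact fun hn => absurd (h a (by simp)) hn

lemma intCast_eq_zero [CharP k 3] {n : ℤ} : (n : k) = 0 ↔ n % 3 = 0 := by
  rw [CharP.intCast_eq_zero_iff k 3, Int.dvd_iff_emod_eq_zero]
  rfl

/-- This is the bridge from computations with integers to identities over `k`. An index may occur
several times in the list, so only its total coefficient is tested. -/
lemma lc_eq_zero [CharP k 3] (v : I → M) (xs : List (ℤ × I)) (h : isZero xs = true) :
    lc k v xs = 0 := by
  rw [lc_eq_sum v xs (xs.map Prod.snd).toFinset (by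
    intro t ht
    rw [List.mem_toFinset]
    exact List.mem_map_of_mem ht)]
  refine Finset.sum_eq_zero fun i hi => ?_
  rw [List.mem_toFinset, List.mem_map] at hi
  obtain ⟨t, ht, rfl⟩ := hi
  have := List.all_eq_true.1 h t ht
  rw [intCast_eq_zero.2 (by simpa using this), zero_smul]

lemma lc_eq_lc [CharP k 3] (v : I → M) (xs ys : List (ℤ × I))
    (h : isZero (xs ++ scale (-1) ys) = true) : lc k v xs = lc k v ys := by
  have := lc_eq_zero (k := k) v _ h
  rw [lc_append, lc_scale] at this
  push_cast at this
  rw [neg_one_smul, ← sub_eq_add_neg] at this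
  exact sub_eq_zero.1 this

end IntComb

/-! ### A basis of the Lie algebra of type `E₆` adapted to the orbit `A₂² + A₁` -/

namespace LieE6

open IntComb

/-- The lattice vector with the hexadecimal digits `aᵢ + 8`. -/
def lat (n : ℕ) : Lat := fun i => ((n / 16 ^ (5 - i.1) % 16 : ℕ) : ℤ) - 8

/-- The number with the hexadecimal digits `aᵢ + 8`, as an integer. -/
def encInt (a : Lat) : ℤ :=
  a 0 * 1048576 + a 1 * 65536 + a 2 * 4096 + a 3 * 256 + a 4 * 16 + a 5 + 8947848

/-- The number with the hexadecimal digits `aᵢ + 8`. -/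
def enc (a : Lat) : ℕ := (encInt a).toNat

/-- The basis vectors `h₁, …, h₆` (for `n = 0, …, 5`) and the root vectors, by their codes. -/
noncomputable def gen (k : Type*) [Field k] (n : ℕ) : E6 k :=
  if h : n < 6 then bvec k (Sum.inl ⟨n, h⟩) else rootVec k (lat n)

/-- The coordinates of the vectors `h₁, …, h₆` and `e_α` with respect to the adapted basis. -/
def coordTable : List (ℕ × List (ℤ × ℕ)) :=
  [(0, [(-1, 8), (-1, 27), (-1, 39), (-1, 51), (1, 58)]),
  (1, [(-1, 20), (-1, 27), (-1, 51), (1, 58)]),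
  (2, [(1, 8), (-1, 20), (-1, 39), (-1, 51), (1, 58)]), (3, [(1, 58)]),
  (4, [(-1, 8), (-1, 20), (1, 39), (-1, 51), (1, 58)]),
  (5, [(1, 8), (-1, 27), (1, 39), (-1, 51), (1, 58)]),
  (0x888889, [(-1, 0), (-1, 12), (1, 31), (1, 43)]),
  (0x888898, [(-1, 0), (-1, 12), (-1, 24), (-1, 43)]), (0x888988, [(-1, 72)]),
  (0x889888, [(-1, 0), (1, 12), (-1, 24), (1, 43)]), (0x898888, [(-1, 0), (-1, 24), (1, 31)]),
  (0x988888, [(-1, 0), (1, 12), (1, 31), (-1, 43)]), (0x888899, [(-1, 4), (-1, 16)]),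
  (0x888998, [(-1, 53), (1, 65), (1, 76)]), (0x889988, [(1, 53), (1, 65), (-1, 76)]),
  (0x898988, [(-1, 76)]), (0x989888, [(1, 4), (-1, 16)]), (0x888999, [(-1, 57), (1, 69)]),
  (0x889998, [(1, 50)]), (0x898998, [(-1, 26), (1, 38), (1, 50), (1, 57), (1, 69)]),
  (0x899988, [(1, 26), (1, 38), (-1, 50), (-1, 57), (1, 69)]), (0x989988, [(-1, 57), (-1, 69)]),
  (0x889999, [(1, 11), (-1, 23), (-1, 30), (-1, 42), (-1, 61)]),
  (0x898999, [(1, 23), (-1, 30), (-1, 42), (1, 61)]), (0x899998, [(1, 30), (1, 61)]),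
  (0x989998, [(1, 11), (1, 23), (1, 30), (-1, 42), (1, 61)]),
  (0x999988, [(1, 23), (-1, 30), (1, 42), (1, 61)]), (0x899999, [(1, 3), (1, 15), (-1, 34)]),
  (0x899a98, [(-1, 75)]), (0x989999, [(-1, 3), (-1, 34)]),
  (0x999998, [(-1, 3), (1, 15), (1, 34)]), (0x899a99, [(1, 56), (-1, 68)]), (0x999999, [(1, 7)]),
  (0x999a98, [(-1, 56), (-1, 68)]), (0x899aa9, [(1, 29), (1, 41), (-1, 60)]),
  (0x999a99, [(-1, 60)]), (0x99aa98, [(1, 29), (-1, 41), (-1, 60)]),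
  (0x999aa9, [(-1, 14), (1, 33)]), (0x99aa99, [(-1, 14), (-1, 33)]), (0x99aaa9, [(1, 6)]),
  (0x99aba9, [(-1, 59)]), (0x9aaba9, [(-1, 32)]),
  (0x888887, [(1, 35), (-1, 47), (-1, 54), (1, 66), (-1, 77)]),
  (0x888878, [(1, 54), (1, 66), (-1, 77)]), (0x888788, [(1, 5)]),
  (0x887888, [(1, 54), (-1, 66), (-1, 77)]), (0x878888, [(-1, 54), (-1, 77)]),
  (0x788888, [(-1, 35), (-1, 47), (-1, 54), (-1, 66), (-1, 77)]),
  (0x888877, [(-1, 62), (-1, 73)]), (0x888778, [(-1, 1), (1, 13), (-1, 25)]),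
  (0x887788, [(1, 1), (1, 13), (1, 25)]), (0x878788, [(-1, 1), (1, 25)]),
  (0x787888, [(-1, 62), (1, 73)]), (0x888777, [(1, 21), (-1, 28), (-1, 40), (1, 52)]),
  (0x887778, [(-1, 21), (1, 52)]), (0x878778, [(1, 9), (-1, 21), (-1, 28), (1, 40), (1, 52)]),
  (0x877788, [(1, 9), (1, 21), (1, 28), (1, 40), (-1, 52)]),
  (0x787788, [(1, 21), (-1, 28), (1, 40), (1, 52)]),
  (0x887777, [(-1, 17), (-1, 36), (-1, 48), (-1, 55), (1, 67)]),
  (0x878777, [(-1, 48), (-1, 67)]), (0x877778, [(1, 55)]),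
  (0x787778, [(1, 17), (-1, 36), (1, 48), (1, 55), (1, 67)]), (0x777788, [(-1, 48), (1, 67)]),
  (0x877777, [(1, 63), (-1, 74)]), (0x877678, [(1, 2)]), (0x787777, [(-1, 44), (-1, 74)]),
  (0x777778, [(1, 63), (1, 74)]), (0x877677, [(-1, 10), (1, 22)]), (0x777777, [(-1, 70)]),
  (0x777678, [(-1, 10), (-1, 22)]), (0x877667, [(-1, 18), (1, 37), (-1, 49)]),
  (0x777677, [(-1, 49)]), (0x776678, [(-1, 18), (-1, 37), (-1, 49)]),
  (0x777667, [(-1, 45), (-1, 64)]), (0x776677, [(1, 45), (-1, 64)]), (0x776667, [(-1, 71)]),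
  (0x776567, [(1, 19)]), (0x766567, [(-1, 46)])]

/-- The vectors of the adapted basis. -/
def adaptedTable : List (List (ℤ × ℕ)) :=
  [[(1, 0x988888), (1, 0x898888), (1, 0x889888), (1, 0x888898), (1, 0x888889)],
  [(-1, 0x888778), (1, 0x878788), (1, 0x887788)], [(1, 0x877678)],
  [(-1, 0x999998), (1, 0x989999), (1, 0x899999)], [(-1, 0x989888), (1, 0x888899)],
  [(1, 0x888788)], [(1, 0x99aaa9)], [(1, 0x999999)], [(-1, 0), (-1, 4), (1, 2), (1, 5)],
  [(-1, 0x877788), (1, 0x787788), (-1, 0x888777), (-1, 0x878778)],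
  [(1, 0x777678), (1, 0x877677)],
  [(-1, 0x999988), (-1, 0x989998), (1, 0x898999), (-1, 0x889999)],
  [(1, 0x988888), (1, 0x889888), (-1, 0x888898), (-1, 0x888889)],
  [(-1, 0x887788), (-1, 0x888778)], [(1, 0x99aa99), (1, 0x999aa9)],
  [(-1, 0x999998), (-1, 0x899999)], [(1, 0x888899), (1, 0x989888)],
  [(-1, 0x777788), (-1, 0x787778), (-1, 0x877778), (1, 0x887777), (-1, 0x878777)],
  [(1, 0x777677), (1, 0x776678), (1, 0x877667)], [(1, 0x776567)], [(-1, 1), (-1, 0), (-1, 5)],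
  [(1, 0x877788), (1, 0x787788), (1, 0x888777), (-1, 0x878778)], [(1, 0x777678), (-1, 0x877677)],
  [(-1, 0x989998), (-1, 0x899998), (1, 0x889999)],
  [(-1, 0x988888), (-1, 0x898888), (-1, 0x888889)],
  [(-1, 0x888778), (1, 0x887788), (-1, 0x878788)],
  [(1, 0x989988), (-1, 0x899988), (1, 0x889998), (1, 0x888999), (1, 0x898998)],
  [(-1, 1), (-1, 2), (-1, 4)], [(1, 0x887778), (-1, 0x877788), (1, 0x878778)],
  [(-1, 0x99aa98), (-1, 0x999a99), (-1, 0x899aa9)],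
  [(-1, 0x999988), (1, 0x989998), (-1, 0x889999), (-1, 0x898999)],
  [(1, 0x898888), (1, 0x888898), (1, 0x889888)], [(-1, 0x9aaba9)],
  [(1, 0x99aa99), (-1, 0x999aa9)], [(1, 0x989999), (1, 0x999998), (-1, 0x899999)],
  [(1, 0x788888), (1, 0x888878), (-1, 0x887888), (-1, 0x888887)],
  [(-1, 0x777788), (1, 0x787778), (1, 0x887777), (1, 0x878777)], [(1, 0x776678), (-1, 0x877667)],
  [(-1, 0x899988), (-1, 0x989988), (1, 0x888999), (-1, 0x898998)],
  [(-1, 0), (-1, 2), (1, 4), (1, 5)], [(-1, 0x787788), (1, 0x888777)],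
  [(1, 0x99aa98), (-1, 0x899aa9)], [(-1, 0x999988), (1, 0x898999)],
  [(1, 0x888889), (-1, 0x988888), (-1, 0x888898), (1, 0x889888)],
  [(1, 0x777778), (-1, 0x787777), (-1, 0x877777)], [(1, 0x777667), (-1, 0x776677)],
  [(-1, 0x766567)], [(1, 0x788888), (1, 0x878888), (1, 0x888887)],
  [(1, 0x777788), (1, 0x878777)], [(-1, 0x777677)], [(1, 0x889998)],
  [(1, 0), (1, 2), (1, 3), (1, 1), (1, 4), (1, 5)],
  [(1, 0x887778), (-1, 0x878778), (1, 0x877788), (1, 0x787788), (1, 0x888777)],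
  [(1, 0x888998), (-1, 0x898988), (-1, 0x889988)], [(1, 0x878888), (1, 0x888878), (1, 0x887888)],
  [(1, 0x877778)], [(-1, 0x899a99), (1, 0x999a98)], [(1, 0x888999), (1, 0x989988)], [(1, 3)],
  [(-1, 0x99aba9)], [(-1, 0x999a99)],
  [(1, 0x898999), (1, 0x999988), (1, 0x899998), (-1, 0x989998), (1, 0x889999)],
  [(1, 0x787888), (1, 0x888877)], [(-1, 0x777778), (-1, 0x877777)],
  [(1, 0x777667), (1, 0x776677)], [(-1, 0x888998), (-1, 0x889988)],
  [(-1, 0x888878), (1, 0x887888)], [(1, 0x878777), (-1, 0x777788)],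
  [(1, 0x899a99), (1, 0x999a98)], [(1, 0x989988), (-1, 0x888999)], [(-1, 0x777777)],
  [(-1, 0x776667)], [(-1, 0x888988)], [(-1, 0x787888), (1, 0x888877)],
  [(-1, 0x777778), (1, 0x877777)], [(-1, 0x899a98)], [(-1, 0x898988)],
  [(1, 0x878888), (-1, 0x888878), (-1, 0x887888)]]

/-- The codes of the roots. -/
def rootCodes : List ℕ := (coordTable.drop 6).map Prod.fst

/-- Lookup in `coordTable`. -/
def find (n : ℕ) : List (ℕ × List (ℤ × ℕ)) → List (ℤ × ℕ)
  | [] => []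
  | p :: ps => bif Nat.beq p.1 n then p.2 else find n ps

/-- The coordinates of the vector with code `n`. -/
def coords (n : ℕ) : List (ℤ × ℕ) := find n coordTable

/-- The vector of the adapted basis with number `n`. -/
def adapted (n : ℕ) : List (ℤ × ℕ) := adaptedTable.getD n []

/-- The value of the `i`-th simple root pairing, for the root with code `n`. -/
def pairing (i n : ℕ) : ℤ :=
  let a := lat n
  match i with
  | 0 => 2 * a 0 - a 2
  | 1 => 2 * a 1 - a 3
  | 2 => 2 * a 2 - a 0 - a 3
  | 3 => 2 * a 3 - a 1 - a 2 - a 4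
  | 4 => 2 * a 4 - a 3 - a 5
  | _ => 2 * a 5 - a 4

/-- The sign `ε(a, b)`, for the roots with codes `p` and `q`. -/
def sign (p q : ℕ) : ℤ :=
  let a := lat p
  let b := lat q
  if (a 0 * (b 0 - b 2) + a 1 * (b 1 - b 3) + a 2 * (b 2 - b 3) + a 3 * (b 3 - b 4) +
    a 4 * (b 4 - b 5) + a 5 * b 5) % 2 = 0 then 1 else -1

/-- The bracket of the basis vectors with codes `p` and `q`. -/
def codeBracket (p q : ℕ) : List (ℤ × ℕ) :=
  if p < 6 then
    if q < 6 then [] else [(pairing p q, q)]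
  else if q < 6 then [(-pairing q p, p)]
  -- The zero vector has code 0x888888 = 8947848, and 17895696 is twice that number, the sum of the
  -- codes of opposite roots. The code of a sum of roots is the sum of the codes minus 8947848.
  else if p + q = 17895696 then
    [(-lat p 0, 0), (-lat p 1, 1), (-lat p 2, 2), (-lat p 3, 3), (-lat p 4, 4), (-lat p 5, 5)]
  else if rootCodes.any (fun n => Nat.beq n (p + q - 8947848)) then
    [(sign p q, p + q - 8947848)]
  else []

/-- The structure constants of the adapted basis. -/
def structConst (m n : ℕ) : List (ℤ × ℕ) :=
  bind coords (mul codeBracket (adapted m) (adapted n))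

/-! ### Codes of roots, and brackets computed on codes. -/

lemma encInt_add (a b : Lat) : encInt (a + b) = encInt a + encInt b - 8947848 := by
  simp only [encInt, Pi.add_apply]; ring

/-- The digits aᵢ + 8 lie between 1 and 15, so the hexadecimal expansion is unique. Coordinates of
roots are at most 3 in absolute value, so sums of two roots stay within the bound. -/
lemma encInt_inj {a b : Lat} (ha : ∀ i, -7 ≤ a i ∧ a i ≤ 7) (hb : ∀ i, -7 ≤ b i ∧ b i ≤ 7)
    (h : encInt a = encInt b) : a = b := by
  simp only [encInt] at h
  have a0 := ha 0
  have a1 := ha 1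
  have a2 := ha 2
  have a3 := ha 3
  have a4 := ha 4
  have a5 := ha 5
  have b0 := hb 0
  have b1 := hb 1
  have b2 := hb 2
  have b3 := hb 3
  have b4 := hb 4
  have b5 := hb 5
  have e0 : a 0 = b 0 := by omega
  have e1 : a 1 = b 1 := by omega
  have e2 : a 2 = b 2 := by omega
  have e3 : a 3 = b 3 := by omega
  have e4 : a 4 = b 4 := by omega
  have e5 : a 5 = b 5 := by omega
  funext i
  fin_cases i <;> assumption

lemma rootCodes_spec : ∀ n ∈ rootCodes, 6 ≤ n ∧ form (lat n) (lat n) = 2 ∧ encInt (lat n) = n ∧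
    ∀ i, -3 ≤ lat n i ∧ lat n i ≤ 3 := by
  simp only [form_eq]
  decide +kernel

/-- Together with `rootCodes_simple` this makes the list exhaustive: each root is reached from ± a
simple root by steps along ± simple roots that stay among the roots. -/
lemma rootCodes_closed : ∀ n ∈ rootCodes, ∀ i : Fin 6,
    ∀ s ∈ [(1 : ℤ), -1], form (lat n + s • simpleVec i) (lat n + s • simpleVec i) = 2 →
      enc (lat n + s • simpleVec i) ∈ rootCodes ∧
        lat (enc (lat n + s • simpleVec i)) = lat n + s • simpleVec i := by
  simp only [form_eq]
  decide +kernel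

lemma rootCodes_simple : ∀ i : Fin 6, ∀ s ∈ [(1 : ℤ), -1], enc (s • simpleVec i) ∈ rootCodes ∧
    lat (enc (s • simpleVec i)) = s • simpleVec i := by
  decide +kernel

lemma form_eq_sum (a b : Lat) : form a b = ∑ i, a i * form (simpleVec i) b := by
  simp only [form_eq, simpleVec, Fin.sum_univ_six]
  simp
  ring

lemma form_smul_right (s : ℤ) (a b : Lat) : form a (s • b) = s * form a b := by
  simp only [form_eq, Pi.smul_apply, smul_eq_mul]; ring

/-- Every root is in the list. -/
lemma exists_rootCode (a : Lat) (ha : form a a = 2) : ∃ n ∈ rootCodes, lat n = a := by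
  induction hN : ∑ i, (a i).natAbs using Nat.strong_induction_on generalizing a with
  | _ N ih =>
    -- The terms aᵢ(αᵢ, a) add up to (a, a) = 2, so one of them is positive; `s` below is the common
    -- sign of its two factors.
    have h1 : ∃ i, 0 < a i * form (simpleVec i) a := by
      by_contra! h
      have := Finset.sum_nonpos fun i (_ : i ∈ Finset.univ) => h i
      rw [← form_eq_sum, ha] at this
      omega
    obtain ⟨i, hi⟩ := h1
    obtain ⟨s, hs, hsa, hsf⟩ : ∃ s ∈ [(1 : ℤ), -1], 0 < s * a i ∧
        0 < s * form (simpleVec i) a := by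
      rcases pos_and_pos_or_neg_and_neg_of_mul_pos hi with h | h
      · exact ⟨1, by simp, by simpa using h.1, by simpa using h.2⟩
      · exact ⟨-1, by simp, by simpa using h.1, by simpa using h.2⟩
    have hs1 : s = 1 ∨ s = -1 := by simpa using hs
    have hss : s * s = 1 := by rcases hs1 with rfl | rfl <;> rfl
    have hnn : form (s • simpleVec i) (s • simpleVec i) = 2 := by
      rw [form_smul_right, form_comm, form_smul_right, form_simpleVec, ← mul_assoc, hss]; rfl
    have hsf' : form a (s • simpleVec i) = s * form (simpleVec i) a := by
      rw [form_smul_right, form_comm]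
    have hle := form_le _ _ ha hnn
    have hneg : form a (-(s • simpleVec i)) = - form a (s • simpleVec i) := form_neg_right _ _
    -- With pairing 1 the difference a − sαᵢ is again a root, with smaller sum of absolute values.
    -- With pairing 2 the two roots coincide.
    rcases (by omega : form a (s • simpleVec i) = 1 ∨ form a (s • simpleVec i) = 2) with hf | hf
    · have hroot : form (a + -(s • simpleVec i)) (a + -(s • simpleVec i)) = 2 := by
        rw [form_add_self, form_neg_self, ha, hnn, hneg, hf]; norm_num
      have hlt : ∑ j, ((a + -(s • simpleVec i)) j).natAbs < N := by
        rw [← hN]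
        refine Finset.sum_lt_sum (fun j _ => ?_) ⟨i, Finset.mem_univ i, ?_⟩
        · by_cases hj : j = i
          · subst hj
            simp only [Pi.add_apply, Pi.neg_apply, Pi.smul_apply, simpleVec, Pi.single_eq_same,
              smul_eq_mul, mul_one]
            rcases hs1 with rfl | rfl <;> omega
          · simp [simpleVec, hj]
        · simp only [Pi.add_apply, Pi.neg_apply, Pi.smul_apply, simpleVec, Pi.single_eq_same,
            smul_eq_mul, mul_one]
          rcases hs1 with rfl | rfl <;> omega
      obtain ⟨n, hn, hna⟩ := ih _ hlt _ hroot rfl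
      have hadd : lat n + s • simpleVec i = a := by rw [hna]; abel
      have := rootCodes_closed n hn i s hs (by rw [hadd, ha])
      rw [hadd] at this
      exact ⟨_, this⟩
    · have h0 := add_eq_zero_of_form a (-(s • simpleVec i)) ha (by rw [form_neg_self, hnn])
        (by rw [hneg, hf])
      have : a = s • simpleVec i := by rw [← sub_eq_zero, sub_eq_add_neg, h0]
      rw [this]
      exact ⟨_, rootCodes_simple i s hs⟩

variable {k : Type*} [Field k]

lemma gen_h (i : Fin 6) : gen k i.1 = bvec k (Sum.inl i) := by
  simp [gen, i.2]

lemma gen_root {n : ℕ} (hn : 6 ≤ n) : gen k n = rootVec k (lat n) := by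
  rw [gen, dif_neg (by omega)]

lemma gen_enc (a : Root) : enc a.1 ∈ rootCodes ∧ gen k (enc a.1) = bvec k (Sum.inr a) := by
  obtain ⟨n, hn, hna⟩ := exists_rootCode a.1 a.2
  obtain ⟨h6, -, he, -⟩ := rootCodes_spec n hn
  have : enc a.1 = n := by rw [enc, ← hna, he]; rfl
  rw [this, gen_root h6, hna]
  exact ⟨hn, rootVec_root a⟩

lemma pairing_eq (i : Fin 6) (n : ℕ) : pairing i n = form (simpleVec i) (lat n) := by
  simp only [form_eq, simpleVec]
  fin_cases i <;> simp [pairing] <;> ring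

lemma sign_eq (p q : ℕ) : sign p q = sgn (lat p) (lat q) := by
  have : half (lat p) (lat q) = (lat p 0 * (lat q 0 - lat q 2) + lat p 1 * (lat q 1 - lat q 3) +
      lat p 2 * (lat q 2 - lat q 3) + lat p 3 * (lat q 3 - lat q 4) +
      lat p 4 * (lat q 4 - lat q 5) + lat p 5 * lat q 5) := by
    rw [half_eq]; ring
  rw [sgn, this, sign]
  split_ifs with h
  · rw [Int.negOnePow_even _ (Int.even_iff.2 h)]; rfl
  · rw [Int.negOnePow_odd _ (by rw [Int.odd_iff]; omega)]; rfl

/-- Brackets can from now on be evaluated on numbers. Completeness of the list of roots is what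
justifies the value 0 when the code of the sum is not found. -/
lemma lie_gen {p q : ℕ} (hp : p < 6 ∨ p ∈ rootCodes) (hq : q < 6 ∨ q ∈ rootCodes) :
    ⁅gen k p, gen k q⁆ = lc k (gen k) (codeBracket p q) := by
  rcases hp with hp | hp
  · have e1 := gen_h (k := k) ⟨p, hp⟩
    rcases hq with hq | hq
    · have e2 := gen_h (k := k) ⟨q, hq⟩
      dsimp only at e1 e2
      rw [e1, e2, lie_def, bracketMap_bvec, codeBracket, if_pos hp, if_pos hq]
      rfl
    · obtain ⟨h6, -⟩ := rootCodes_spec q hq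
      dsimp only at e1
      rw [e1, gen_root h6, lie_def, bracketMap_h_rootVec, codeBracket, if_pos hp,
        if_neg (by omega), lc_cons, lc_nil, add_zero, gen_root h6, ← pairing_eq]
  · obtain ⟨p6, pr, pe, pb⟩ := rootCodes_spec p hp
    rcases hq with hq | hq
    · have e2 := gen_h (k := k) ⟨q, hq⟩
      dsimp only at e2
      rw [e2, gen_root p6, ← lie_skew, lie_def, bracketMap_h_rootVec, codeBracket,
        if_neg (by omega), if_pos hq, lc_cons, lc_nil, add_zero, gen_root p6, ← pairing_eq]
      push_cast
      rw [neg_smul]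
    · obtain ⟨q6, qr, qe, qb⟩ := rootCodes_spec q hq
      have hsum := encInt_add (lat p) (lat q)
      rw [pe, qe] at hsum
      rw [gen_root p6, gen_root q6, rootVec, dif_pos pr, rootVec, dif_pos qr, lie_def,
        bracketMap_bvec, codeBracket, if_neg (by omega), if_neg (by omega)]
      simp only [basisBracket]
      by_cases h0 : lat p + lat q = 0
      · have : encInt (lat p + lat q) = 8947848 := by rw [h0]; rfl
        rw [if_pos h0, if_pos (by omega)]
        simp only [coroot, Fin.sum_univ_six, lc_cons, lc_nil, add_zero, ← gen_h]
        push_cast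
        simp only [neg_smul, Fin.isValue, Fin.val_zero, Fin.val_one]
        abel_nf
        rfl
      · have hne : p + q ≠ 17895696 := by
          intro h
          refine h0 (encInt_inj (fun i => ?_) (fun i => by simp) ?_)
          · have := pb i
            have := qb i
            simp only [Pi.add_apply]
            omega
          · rw [hsum]
            simp only [encInt, Pi.zero_apply]
            omega
        rw [if_neg h0, if_neg hne]
        split_ifs with hr
        · obtain ⟨n, hn, hnr⟩ := List.any_eq_true.1 hr
          have hnr : n = p + q - 8947848 := Nat.eq_of_beq_eq_true hnr
          rw [← hnr]
          obtain ⟨n6, nr, ne, nb⟩ := rootCodes_spec n hn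
          have : lat n = lat p + lat q := by
            refine encInt_inj (fun i => ?_) (fun i => ?_) ?_
            · have := nb i
              omega
            · have := pb i
              have := qb i
              simp only [Pi.add_apply]
              omega
            · rw [hsum, ne]
              omega
          rw [lc_cons, lc_nil, add_zero, gen_root n6, this, sign_eq]
        · have : ¬ form (lat p + lat q) (lat p + lat q) = 2 := by
            intro h
            obtain ⟨n, hn, hna⟩ := exists_rootCode _ h
            refine hr (List.any_eq_true.2 ⟨n, hn, ?_⟩)
            have := (rootCodes_spec n hn).2.2.1
            rw [hna] at this
            have : n = p + q - 8947848 := by omega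
            rw [this]
            exact Nat.beq_refl _
          rw [rootVec, dif_neg this, smul_zero, lc_nil]

end LieE6

/-! ### The change of basis and the adapted basis. -/

namespace LieE6

open IntComb

variable {k : Type*} [Field k]

/-- A basis indexed by `Fin 78`, extended by zero. -/
noncomputable def vec {L : Type*} [AddCommGroup L] [Module k L] (b : Module.Basis (Fin 78) k L)
    (n : ℕ) : L :=
  if h : n < 78 then b ⟨n, h⟩ else 0

lemma vec_val {L : Type*} [AddCommGroup L] [Module k L] (b : Module.Basis (Fin 78) k L)
    (n : Fin 78) : vec b n.1 = b n := by
  rw [vec, dif_pos n.2]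

/-- The unit vectors of `k⁷⁸`. -/
def unitVec (k : Type*) [Field k] (n : ℕ) : Fin 78 → k := fun m => if m.1 = n then 1 else 0

/-- The coordinate map. -/
noncomputable def coordMap (k : Type*) [Field k] : E6 k →ₗ[k] (Fin 78 → k) :=
  (basis k).constr k fun x =>
    lc k (unitVec k) (coords (Sum.elim (fun i : Fin 6 => i.1) (fun a : Root => enc a.1) x))

/-- The vectors of the adapted basis. -/
noncomputable def adaptedVec (k : Type*) [Field k] (n : ℕ) : E6 k := lc k (gen k) (adapted n)

/-- The map from coordinates to vectors. -/
noncomputable def vecMap (k : Type*) [Field k] : (Fin 78 → k) →ₗ[k] E6 k :=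
  Fintype.linearCombination k fun n : Fin 78 => adaptedVec k n.1

/-- The numbers of the basis vectors `h₁, …, h₆` and `e_α`. -/
def IsCode (n : ℕ) : Prop := n < 6 ∨ n ∈ rootCodes

instance : DecidablePred IsCode := fun n => inferInstanceAs (Decidable (n < 6 ∨ n ∈ rootCodes))

lemma coordMap_gen {n : ℕ} (hn : IsCode n) : coordMap k (gen k n) = lc k (unitVec k) (coords n) := by
  rcases hn with hn | hn
  · have e1 := gen_h (k := k) ⟨n, hn⟩
    dsimp only at e1
    rw [e1, bvec, coordMap, Module.Basis.constr_basis]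
    rfl
  · obtain ⟨h6, hr, he, -⟩ := rootCodes_spec n hn
    rw [gen_root h6, rootVec, dif_pos hr, bvec, coordMap, Module.Basis.constr_basis]
    simp only [Sum.elim_inr]
    rw [enc, he]
    rfl

lemma vecMap_unitVec {n : ℕ} (hn : n < 78) : vecMap k (unitVec k n) = adaptedVec k n := by
  rw [vecMap, Fintype.linearCombination_apply, Finset.sum_eq_single ⟨n, hn⟩]
  · simp [unitVec]
  · intro m _ hm
    rw [unitVec, if_neg (fun h => hm (Fin.ext h)), zero_smul]
  · simp

lemma adapted_isCode : ∀ n < 78, ∀ t ∈ adapted n, IsCode t.2 := by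
  decide +kernel

lemma coords_lt : ∀ n ∈ List.range 6 ++ rootCodes, ∀ t ∈ coords n, t.2 < 78 := by
  decide +kernel

/-- Together with `adapted_coords`: the two tables are inverse to each other modulo 3. Composing
them both ways shows that the adapted vectors form a basis without any determinant. -/
lemma coords_adapted : ∀ n < 78, isZero (bind coords (adapted n) ++ scale (-1) [(1, n)]) = true := by
  decide +kernel

lemma adapted_coords : ∀ n ∈ List.range 6 ++ rootCodes,
    isZero (bind adapted (coords n) ++ scale (-1) [(1, n)]) = true := by
  decide +kernel

lemma IsCode.mem {n : ℕ} (hn : IsCode n) : n ∈ List.range 6 ++ rootCodes := by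
  rw [List.mem_append, List.mem_range]; exact hn

/-- Vanishing of the cube of ad e_a does not by itself make the truncated exponential an
automorphism in characteristic 3; this stronger fact does. -/
lemma ad_e_sq (a : Root) (x : E6 k) : ∃ c : k, ⁅e k a, ⁅e k a, x⁆⁆ = c • e k a := by
  induction x using E6_induction with
  | h0 => exact ⟨0, by simp⟩
  | hadd x y hx hy =>
    obtain ⟨c, hc⟩ := hx
    obtain ⟨d, hd⟩ := hy
    exact ⟨c + d, by rw [lie_add, lie_add, hc, hd, add_smul]⟩
  | hs c i =>
    obtain ⟨d, hd⟩ := ad_e_sq_bvec (k := k) a i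
    exact ⟨c * d, by rw [lie_smul, lie_smul, hd, smul_smul]⟩

variable [CharP k 3]

lemma coordMap_adaptedVec {n : ℕ} (hn : n < 78) : coordMap k (adaptedVec k n) = unitVec k n := by
  rw [adaptedVec, map_lc, lc_congr (w := fun n => lc k (unitVec k) (coords n)) _
    fun t ht => coordMap_gen (adapted_isCode n hn t ht), ← lc_bind,
    lc_eq_lc (k := k) _ _ _ (coords_adapted n hn)]
  simp

lemma gen_eq {n : ℕ} (hn : IsCode n) : gen k n = lc k (adaptedVec k) (coords n) := by
  have := lc_eq_lc (k := k) (gen k) _ _ (adapted_coords n hn.mem)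
  rw [lc_bind, lc_cons, lc_nil, add_zero] at this
  rw [Int.cast_one, one_smul] at this
  exact this.symm

lemma vecMap_coordMap (x : E6 k) : vecMap k (coordMap k x) = x := by
  have key : ∀ n, IsCode n → vecMap k (coordMap k (gen k n)) = gen k n := by
    intro n hn
    rw [coordMap_gen hn, map_lc, gen_eq hn]
    exact lc_congr _ fun t ht => vecMap_unitVec (coords_lt n hn.mem t ht)
  induction x using E6_induction with
  | h0 => simp
  | hadd x y hx hy => simp [hx, hy]
  | hs c i =>
    rw [map_smul, map_smul]
    congr 1
    rcases i with i | a
    · rw [← gen_h]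
      exact key _ (Or.inl i.2)
    · rw [← (gen_enc a).2]
      exact key _ (Or.inr (gen_enc (k := k) a).1)

lemma coordMap_vecMap (f : Fin 78 → k) : coordMap k (vecMap k f) = f := by
  rw [vecMap, Fintype.linearCombination_apply, map_sum]
  funext m
  simp only [map_smul, coordMap_adaptedVec (Fin.is_lt _), Finset.sum_apply, Pi.smul_apply, unitVec]
  simp [Fin.val_inj]

/-- The adapted basis. -/
noncomputable def adaptedBasis (k : Type*) [Field k] [CharP k 3] : Module.Basis (Fin 78) k (E6 k) :=
  Module.Basis.ofEquivFun (LinearEquiv.ofLinearMap (coordMap k) (vecMap k)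
    (LinearMap.ext coordMap_vecMap) (LinearMap.ext vecMap_coordMap))

lemma vec_adaptedBasis {n : ℕ} (hn : n < 78) : vec (adaptedBasis k) n = adaptedVec k n := by
  rw [vec, dif_pos hn, adaptedBasis, Module.Basis.coe_ofEquivFun, ← vecMap_unitVec hn]
  change vecMap k _ = _
  congr 1
  funext m
  simp [unitVec, Pi.single_apply, Fin.ext_iff]

lemma codeBracket_isCode {p q : ℕ} (hp : IsCode p) (hq : IsCode q) :
    ∀ t ∈ codeBracket p q, IsCode t.2 := by
  intro t ht
  rw [codeBracket] at ht
  split_ifs at ht with h1 h2 h2 h3 h4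
  · simp at ht
  · obtain rfl : t = (pairing p q, q) := by simpa using ht
    exact hq
  · obtain rfl : t = (-pairing q p, p) := by simpa using ht
    exact hp
  · left
    simp only [List.mem_cons, List.not_mem_nil, or_false] at ht
    rcases ht with rfl | rfl | rfl | rfl | rfl | rfl <;> norm_num
  · obtain rfl : t = (sign p q, p + q - 8947848) := by simpa using ht
    obtain ⟨n, hn, hnr⟩ := List.any_eq_true.1 h4
    exact Or.inr (Nat.eq_of_beq_eq_true hnr ▸ hn)
  · simp at ht

/-- The structure constants of the adapted basis. -/
lemma lie_adaptedBasis {m n : ℕ} (hm : m < 78) (hn : n < 78) :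
    ⁅vec (adaptedBasis k) m, vec (adaptedBasis k) n⁆ =
      lc k (vec (adaptedBasis k)) (structConst m n) := by
  have key : ∀ c, IsCode c → gen k c = lc k (vec (adaptedBasis k)) (coords c) := by
    intro c hc
    rw [gen_eq hc]
    exact lc_congr _ fun t ht => (vec_adaptedBasis (coords_lt c hc.mem t ht)).symm
  rw [vec_adaptedBasis hm, vec_adaptedBasis hn, adaptedVec, adaptedVec,
    lie_lc (gen k) (gen k) (vec (adaptedBasis k)) (fun p q => bind coords (codeBracket p q))]
  · rw [structConst, mul, mul, lc_bind, lc_bind, lc_bind]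
    refine lc_congr (v := fun i => lc k (vec (adaptedBasis k))
      (bind (fun q => bind coords (codeBracket i q)) (adapted n))) _ fun t _ => ?_
    simp only [lc_bind]
  · intro s hs t ht
    rw [lie_gen (adapted_isCode m hm s hs) (adapted_isCode n hn t ht), lc_bind]
    exact lc_congr _ fun u hu => key _ (codeBracket_isCode (adapted_isCode m hm s hs)
      (adapted_isCode n hn t ht) u hu)

lemma adapted_zero : ∀ i : Fin 6, lat (enc (simpleVec i)) = simpleVec i ∧
    6 ≤ enc (simpleVec i) := by
  decide +kernel

lemma vec_adaptedBasis_zero : vec (adaptedBasis k) 0 = orbitRep k := by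
  have h : isZero (adapted 0 ++ scale (-1) ([0, 1, 2, 4, 5].map fun i : Fin 6 =>
      ((1 : ℤ), enc (simpleVec i)))) = true := by
    decide +kernel
  have hs : (Finset.univ.erase (3 : Fin 6)) = {0, 1, 2, 4, 5} := by decide
  have hg : ∀ i, gen k (enc (simpleVec i)) = e k (simpleRoot i) := by
    intro i
    rw [gen_root (adapted_zero i).2, (adapted_zero i).1]
    exact rootVec_root (simpleRoot i)
  rw [vec_adaptedBasis (by norm_num), adaptedVec, lc_eq_lc _ _ _ h, orbitRep, hs]
  simp [hg]

/-! ### The root elements are automorphisms -/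

/-- Expanding the right side, the terms in t and t² are the Leibniz rule. If (ad e_a)²x = c e_a and
(ad e_a)²y = d e_a, the two terms in t³ are opposite multiples of cd e_a, and the term in t⁴
contains [e_a, e_a] = 0. -/
lemma rootElement_lie (a : Root) (t : k) (x y : E6 k) :
    rootElement a t ⁅x, y⁆ = ⁅rootElement a t x, rootElement a t y⁆ := by
  have h2 : (2 : k) ≠ 0 := by
    intro h
    have h3 : ((3 : ℕ) : k) = 0 := CharP.cast_eq_zero k 3
    have : (1 : k) = 0 := by push_cast at h3; linear_combination h3 - h
    exact one_ne_zero this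
  change rootElementMap a t _ = ⁅rootElementMap a t x, rootElementMap a t y⁆
  simp only [rootElementMap_apply]
  obtain ⟨c, hc⟩ := ad_e_sq a x
  obtain ⟨d, hd⟩ := ad_e_sq a y
  have e1 : ⁅e k a, ⁅x, y⁆⁆ = ⁅⁅e k a, x⁆, y⁆ + ⁅x, ⁅e k a, y⁆⁆ := leibniz_lie _ _ _
  have e2 : ⁅e k a, ⁅e k a, ⁅x, y⁆⁆⁆ =
      ⁅c • e k a, y⁆ + (2 : k) • ⁅⁅e k a, x⁆, ⁅e k a, y⁆⁆ + ⁅x, d • e k a⁆ := by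
    rw [e1, lie_add, leibniz_lie (e k a) ⁅e k a, x⁆, leibniz_lie (e k a) x, hc, hd, two_smul]
    abel
  have e3 : ⁅⁅e k a, x⁆, e k a⁆ = -(c • e k a) := by rw [← lie_skew, hc]
  rw [e2, e1, hc, hd]
  simp only [add_lie, lie_add, smul_lie, lie_smul, hd, e3, lie_self]
  match_scalars <;> field_simp <;> ring

lemma adjointGroup_lie {g : E6 k ≃ₗ[k] E6 k} (hg : g ∈ adjointGroup k) (x y : E6 k) :
    g ⁅x, y⁆ = ⁅g x, g y⁆ := by
  induction hg using Subgroup.closure_induction generalizing x y with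
  | mem g hg =>
    obtain ⟨a, t, rfl⟩ := hg
    exact rootElement_lie a t x y
  | one => rfl
  | mul g h _ _ ihg ihh =>
    change g (h ⁅x, y⁆) = ⁅g (h x), g (h y)⁆
    rw [ihh, ihg]
  | inv g _ ih =>
    change g.symm ⁅x, y⁆ = ⁅g.symm x, g.symm y⁆
    apply g.injective
    rw [ih]
    simp

/-- The structure constants of the adapted basis, for a basis of a Lie algebra. -/
def HasStructConst {L : Type*} [LieRing L] [LieAlgebra k L] (b : Module.Basis (Fin 78) k L) :
    Prop :=
  ∀ m n, m < 78 → n < 78 → ⁅vec b m, vec b n⁆ = lc k (vec b) (structConst m n)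

/-- Every element of the orbit is the first vector of an adapted basis. -/
theorem exists_basis {x : E6 k} (hx : x ∈ orbitA2A2A1 k) :
    ∃ b : Module.Basis (Fin 78) k (E6 k), HasStructConst b ∧ vec b 0 = x := by
  obtain ⟨g, hg, rfl⟩ := hx
  -- The basis for an arbitrary point of the orbit is the image of the standard one under the group
  -- element; an automorphism preserves structure constants.
  have hv : ∀ n, vec ((adaptedBasis k).map g) n = g (vec (adaptedBasis k) n) := by
    intro n
    simp only [vec]
    split_ifs with h
    · simp
    · simp
  refine ⟨(adaptedBasis k).map g, fun m n hm hn => ?_, ?_⟩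
  · rw [hv, hv, ← adjointGroup_lie hg, lie_adaptedBasis hm hn]
    have := map_lc (g : E6 k →ₗ[k] E6 k) (vec (adaptedBasis k)) (structConst m n)
    simp only [LinearEquiv.coe_coe] at this
    rw [this]
    exact lc_congr _ fun t _ => (hv t.2).symm
  · rw [hv, vec_adaptedBasis_zero]

end LieE6

/-! ### Monomials in the Lie algebras of Cartan type -/

namespace Cartan

open IntComb

variable {k : Type*} [Field k] {m : ℕ}

/-- The monomial `x₁^α₁ ⋯ xₘ^αₘ`. -/
noncomputable def mon (k : Type*) [Field k] {m : ℕ} (α : Fin m → ℕ) : O k m := ∏ i, x k i ^ α i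

lemma mon_mul (α β : Fin m → ℕ) : mon k α * mon k β = mon k (α + β) := by
  simp only [mon, ← Finset.prod_mul_distrib, Pi.add_apply, pow_add]

lemma mon_zero : mon k (0 : Fin m → ℕ) = 1 := by
  simp [mon]

lemma x_cube (i : Fin m) : x k i ^ 3 = 0 := by
  rw [x, ← map_pow, mk_eq_zero]
  exact Ideal.subset_span ⟨i, rfl⟩

lemma mon_eq_zero {α : Fin m → ℕ} (i : Fin m) (h : 3 ≤ α i) : mon k α = 0 := by
  refine Finset.prod_eq_zero (Finset.mem_univ i) ?_
  obtain ⟨c, hc⟩ := Nat.exists_eq_add_of_le h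
  rw [hc, pow_add, x_cube, zero_mul]

lemma span_mon : Submodule.span k (Set.range fun α : Fin m → Fin 3 => mon k fun i => (α i).1) = ⊤ := by
  rw [eq_top_iff]
  rintro f -
  obtain ⟨f, rfl⟩ := mk_surjective f
  induction f using MvPolynomial.induction_on' with
  | monomial α c =>
    have : mk k m (MvPolynomial.monomial α c) = c • mon k α := by
      rw [MvPolynomial.monomial_eq, MvPolynomial.C_mul', map_smul, mon, Finsupp.prod_fintype _ _
        (fun i => pow_zero _), map_prod]
      simp only [map_pow]
      rfl
    rw [this]
    refine Submodule.smul_mem _ _ ?_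
    by_cases h : ∃ i, 3 ≤ α i
    · obtain ⟨i, hi⟩ := h
      rw [mon_eq_zero i hi]
      exact Submodule.zero_mem _
    · push Not at h
      exact Submodule.subset_span ⟨fun i => ⟨α i, h i⟩, rfl⟩
  | add p q hp hq => rw [map_add]; exact Submodule.add_mem _ hp hq

/-- Subtraction of exponents is truncated, and the two monomials may differ when βᵢ = 0; the scalar
βᵢ then vanishes. -/
lemma cast_smul_mon_mul (i : Fin m) (α β : Fin m → ℕ) :
    (β i : k) • (mon k α * mon k (β - Pi.single i 1)) =
      (β i : k) • mon k (α + β - Pi.single i 1) := by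
  rcases Nat.eq_zero_or_pos (β i) with h | h
  · simp [h]
  · rw [mon_mul]
    congr 2
    funext j
    by_cases hj : j = i
    · subst hj
      simp only [Pi.add_apply, Pi.sub_apply, Pi.single_eq_same]
      omega
    · simp [hj]

/-- The element `D + λ` of `𝒮₂(1)`. -/
def pair (D : W k 3) (f : Form k) : S2 k := (D, f)

lemma smul_pair (c : k) (D : W k 3) (f : Form k) : c • pair D f = pair (c • D) (c • f) := rfl

lemma pair_add_pair (D E : W k 3) (f g : Form k) :
    pair D f + pair E g = pair (D + E) (f + g) := rfl

lemma smul_single (c : k) (l : Fin 3) (f : O k 3) :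
    c • (Pi.single l f : Form k) = Pi.single l (c • f) := by
  funext i
  rcases eq_or_ne i l with rfl | h
  · rw [Pi.smul_apply, Pi.single_eq_same, Pi.single_eq_same]
  · rw [Pi.smul_apply, Pi.single_eq_of_ne h, Pi.single_eq_of_ne h, smul_zero]

variable [CharP k 3]

lemma pd_mon (i : Fin m) (α : Fin m → ℕ) :
    pd k i (mon k α) = (α i : k) • mon k (α - Pi.single i 1) := by
  have hi : mon k α = x k i ^ α i * ∏ j ∈ Finset.univ.erase i, x k j ^ α j := by
    rw [mon, Finset.mul_prod_erase _ (fun j => x k j ^ α j) (Finset.mem_univ i)]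
  have hz : pd k i (∏ j ∈ Finset.univ.erase i, x k j ^ α j) = 0 := by
    refine Finset.prod_induction _ (fun f => pd k i f = 0) ?_ ?_ ?_
    · intro a b ha hb
      rw [Derivation.leibniz, ha, hb, smul_zero, smul_zero, add_zero]
    · exact Derivation.map_one_eq_zero _
    · intro j hj
      rw [Derivation.leibniz_pow, pd_x, if_neg (Finset.ne_of_mem_erase hj).symm, smul_zero,
        smul_zero]
  have hi' : mon k (α - Pi.single i 1) =
      x k i ^ (α i - 1) * ∏ j ∈ Finset.univ.erase i, x k j ^ α j := by
    rw [mon, ← Finset.mul_prod_erase _ _ (Finset.mem_univ i)]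
    congr 1
    · simp
    · refine Finset.prod_congr rfl fun j hj => ?_
      simp [Finset.ne_of_mem_erase hj]
  rw [hi, hi', Derivation.leibniz, hz, smul_zero, zero_add, Derivation.leibniz_pow, pd_x,
    if_pos rfl, ← Nat.cast_smul_eq_nsmul k]
  simp only [smul_eq_mul, Algebra.smul_def, mul_one]
  ring

lemma mon_mul_pd_mon (i : Fin m) (α β : Fin m → ℕ) :
    mon k α * pd k i (mon k β) = (β i : k) • mon k (α + β - Pi.single i 1) := by
  rw [pd_mon, mul_smul_comm, cast_smul_mon_mul]

/-- The derivation `x^α ∂ᵢ`. -/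
noncomputable def vmon (k : Type*) [Field k] [CharP k 3] {m : ℕ} (i : Fin m) (α : Fin m → ℕ) :
    W k m := mon k α • pd k i

lemma vmon_apply (i : Fin m) (α : Fin m → ℕ) (f : O k m) : vmon k i α f = mon k α * pd k i f := rfl

lemma vmon_x (i j : Fin m) (α : Fin m → ℕ) :
    vmon k i α (x k j) = if i = j then mon k α else 0 := by
  rw [vmon_apply, pd_x]
  split_ifs <;> simp

lemma vmon_mon (i : Fin m) (α β : Fin m → ℕ) :
    vmon k i α (mon k β) = (β i : k) • mon k (α + β - Pi.single i 1) :=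
  mon_mul_pd_mon i α β

lemma dvg_vmon (i : Fin m) (α : Fin m → ℕ) :
    dvg (vmon k i α) = (α i : k) • mon k (α - Pi.single i 1) := by
  rw [dvg_apply, Finset.sum_eq_single i]
  · rw [vmon_x, if_pos rfl, pd_mon]
  · intro j _ hj
    rw [vmon_x, if_neg (Ne.symm hj), map_zero]
  · simp

lemma lie_vmon (i j : Fin m) (α β : Fin m → ℕ) : ⁅vmon k i α, vmon k j β⁆ =
    (β i : k) • vmon k j (α + β - Pi.single i 1) -
      (α j : k) • vmon k i (α + β - Pi.single j 1) := by
  apply ext_x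
  intro l
  rw [Derivation.commutator_apply, Derivation.sub_apply, Derivation.smul_apply,
    Derivation.smul_apply, vmon_x, vmon_x, vmon_x, vmon_x]
  congr 1
  · split_ifs
    · rw [vmon_mon]
    · simp
  · split_ifs
    · rw [vmon_mon, add_comm α β]
    · simp

/-! #### The Lie algebra `W(2; 1)` -/

/-- The derivation `x₁^a x₂^b ∂ᵢ`. -/
noncomputable def wmon (k : Type*) [Field k] [CharP k 3] (t : Fin 2 × ℕ × ℕ) : W k 2 :=
  vmon k t.1 ![t.2.1, t.2.2]

/-- The exponents, with the `i`-th one lowered. -/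
def low2 (i : Fin 2) (p : ℕ × ℕ) : ℕ × ℕ := if i = 0 then (p.1 - 1, p.2) else (p.1, p.2 - 1)

/-- The `i`-th exponent. -/
def exp2 (i : Fin 2) (p : ℕ × ℕ) : ℕ := if i = 0 then p.1 else p.2

/-- The brackets of monomials in `W(2; 1)`. -/
def wBracket (s t : Fin 2 × ℕ × ℕ) : List (ℤ × Fin 2 × ℕ × ℕ) :=
  let p := (s.2.1 + t.2.1, s.2.2 + t.2.2)
  [(exp2 s.1 t.2, t.1, low2 s.1 p), (-exp2 t.1 s.2, s.1, low2 t.1 p)]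

/-- Omission of the monomials that vanish. -/
def wTrunc (xs : List (ℤ × Fin 2 × ℕ × ℕ)) : List (ℤ × Fin 2 × ℕ × ℕ) :=
  xs.filter fun t => Nat.blt t.2.2.1 3 && Nat.blt t.2.2.2 3

lemma vec_low2 (i : Fin 2) (p : ℕ × ℕ) :
    (![(low2 i p).1, (low2 i p).2] : Fin 2 → ℕ) = ![p.1, p.2] - Pi.single i 1 := by
  funext j
  fin_cases i <;> fin_cases j <;> simp [low2]

lemma vec_exp2 (i : Fin 2) (p : ℕ × ℕ) : (![p.1, p.2] : Fin 2 → ℕ) i = exp2 i p := by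
  fin_cases i <;> simp [exp2]

lemma lie_wmon (s t : Fin 2 × ℕ × ℕ) : ⁅wmon k s, wmon k t⁆ = lc k (wmon k) (wBracket s t) := by
  have h : (![s.2.1, s.2.2] + ![t.2.1, t.2.2] : Fin 2 → ℕ) =
      ![s.2.1 + t.2.1, s.2.2 + t.2.2] := by simp
  rw [wmon, wmon, lie_vmon, wBracket, vec_exp2, vec_exp2, h]
  simp only [lc_cons, lc_nil, add_zero, wmon]
  rw [vec_low2, vec_low2]
  push_cast
  rw [neg_smul, sub_eq_add_neg]

/-- Formal brackets may contain exponents above 2. These terms are zero because xᵢ³ = 0, but not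
formally zero, so they are dropped before coefficients are compared. -/
lemma lc_wTrunc (xs : List (ℤ × Fin 2 × ℕ × ℕ)) :
    lc k (wmon k) (wTrunc xs) = lc k (wmon k) xs := by
  induction xs with
  | nil => rfl
  | cons t xs ih =>
    rw [lc_cons, wTrunc, List.filter_cons]
    split_ifs with h
    · rw [lc_cons, ← wTrunc, ih]
    · rw [← wTrunc, ih]
      have : mon k ![t.2.2.1, t.2.2.2] = 0 := by
        simp only [Bool.and_eq_true, Nat.blt_eq] at h
        rcases not_and_or.1 h with h | h
        · exact mon_eq_zero 0 (by simpa using h)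
        · exact mon_eq_zero 1 (by simpa using h)
      rw [wmon, vmon, this, zero_smul, smul_zero, zero_add]

/-! #### The Lie algebra `𝒮₂(1)` -/

/-- The exponents of a monomial in three variables. -/
def exps (p : ℕ × ℕ × ℕ) : Fin 3 → ℕ := ![p.1, p.2.1, p.2.2]

/-- The exponents, with the `i`-th one lowered. -/
def low3 (i : Fin 3) (p : ℕ × ℕ × ℕ) : ℕ × ℕ × ℕ :=
  if i = 0 then (p.1 - 1, p.2.1, p.2.2) else
    if i = 1 then (p.1, p.2.1 - 1, p.2.2) else (p.1, p.2.1, p.2.2 - 1)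

/-- The `i`-th exponent. -/
def exp3 (i : Fin 3) (p : ℕ × ℕ × ℕ) : ℕ :=
  if i = 0 then p.1 else if i = 1 then p.2.1 else p.2.2

/-- The sum of exponents. -/
def add3 (p q : ℕ × ℕ × ℕ) : ℕ × ℕ × ℕ := (p.1 + q.1, p.2.1 + q.2.1, p.2.2 + q.2.2)

/-- The monomials in `𝒮₂(1)`: the monomial derivation `x^p ∂ᵢ` for `(false, i, p)`, and the
monomial form `x^p dxᵢ` for `(true, i, p)`. -/
noncomputable def smon (k : Type*) [Field k] [CharP k 3] (t : Bool × Fin 3 × ℕ × ℕ × ℕ) : S2 k :=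
  match t with
  | (false, i, p) => pair (vmon k i (exps p)) 0
  | (true, i, p) => pair 0 (Pi.single i (mon k (exps p)))

/-- The twisted Lie derivative of `x^q dxⱼ` along `x^p ∂ᵢ`. -/
def actMon (i : Fin 3) (p : ℕ × ℕ × ℕ) (j : Fin 3) (q : ℕ × ℕ × ℕ) :
    List (ℤ × Bool × Fin 3 × ℕ × ℕ × ℕ) :=
  (((exp3 i q + exp3 i p : ℕ) : ℤ), true, j, low3 i (add3 p q)) ::
    if i = j then [((exp3 0 p : ℤ), true, 0, low3 0 (add3 p q)),
      ((exp3 1 p : ℤ), true, 1, low3 1 (add3 p q)), ((exp3 2 p : ℤ), true, 2, low3 2 (add3 p q))]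
    else []

/-- The brackets of monomials in `𝒮₂(1)`. -/
def sBracket : (Bool × Fin 3 × ℕ × ℕ × ℕ) → (Bool × Fin 3 × ℕ × ℕ × ℕ) →
    List (ℤ × Bool × Fin 3 × ℕ × ℕ × ℕ)
  | (false, i, p), (false, j, q) =>
    [(exp3 i q, false, j, low3 i (add3 p q)), (-exp3 j p, false, i, low3 j (add3 p q))]
  | (false, i, p), (true, j, q) => actMon i p j q
  | (true, j, q), (false, i, p) => scale (-1) (actMon i p j q)
  | (true, i, p), (true, j, q) =>
    if j = i + 1 then [(1, false, i + 2, add3 p q)] else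
      if i = j + 1 then [(-1, false, j + 2, add3 p q)] else []

/-- Omission of the monomials that vanish. -/
def sTrunc (xs : List (ℤ × Bool × Fin 3 × ℕ × ℕ × ℕ)) : List (ℤ × Bool × Fin 3 × ℕ × ℕ × ℕ) :=
  xs.filter fun t => Nat.blt t.2.2.2.1 3 && Nat.blt t.2.2.2.2.1 3 && Nat.blt t.2.2.2.2.2 3

lemma exps_low3 (i : Fin 3) (p : ℕ × ℕ × ℕ) : exps (low3 i p) = exps p - Pi.single i 1 := by
  funext j
  fin_cases i <;> fin_cases j <;> simp [low3, exps]

lemma exps_apply (i : Fin 3) (p : ℕ × ℕ × ℕ) : exps p i = exp3 i p := by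
  fin_cases i <;> simp [exp3, exps]

lemma exps_add3 (p q : ℕ × ℕ × ℕ) : exps (add3 p q) = exps p + exps q := by
  simp [exps, add3]

lemma lc_sTrunc (xs : List (ℤ × Bool × Fin 3 × ℕ × ℕ × ℕ)) :
    lc k (smon k) (sTrunc xs) = lc k (smon k) xs := by
  induction xs with
  | nil => rfl
  | cons t xs ih =>
    rw [lc_cons, sTrunc, List.filter_cons]
    split_ifs with h
    · rw [lc_cons, ← sTrunc, ih]
    · rw [← sTrunc, ih]
      obtain ⟨c, b, i, p1, p2, p3⟩ := t
      have : mon k (exps (p1, p2, p3)) = 0 := by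
        simp only [Bool.and_eq_true, Nat.blt_eq] at h
        rcases not_and_or.1 h with h | h
        · rcases not_and_or.1 h with h | h
          · exact mon_eq_zero 0 (by simpa [exps] using h)
          · exact mon_eq_zero 1 (by simpa [exps] using h)
        · exact mon_eq_zero 2 (by simpa [exps] using h)
      have h0 : smon k (b, i, p1, p2, p3) = 0 := by
        rcases b with _ | _
        · simp only [smon, vmon, this, zero_smul]; rfl
        · simp only [smon, this, Pi.single_zero]; rfl
      rw [h0, smul_zero, zero_add]

lemma lie_pair (D E : W k 3) (f g : Form k) :
    ⁅pair D f, pair E g⁆ = pair (⁅D, E⁆ + cross f g) (act D g - act E f) := rfl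

lemma cross_zero_left (f : Form k) : cross 0 f = 0 := by
  apply ext_x
  intro l
  simp [cross_apply]

lemma act_zero_right (D : W k 3) : act D (0 : Form k) = 0 := by
  have := act_smul_right (0 : k) D 0
  rwa [zero_smul, zero_smul] at this

lemma act_zero_left (f : Form k) : act (0 : W k 3) f = 0 := by
  have := act_smul_left (0 : k) 0 f
  rwa [zero_smul, zero_smul] at this

lemma smon_eq_false (i : Fin 3) (p : ℕ × ℕ × ℕ) :
    smon k (false, i, p) = pair (vmon k i (exps p)) 0 := rfl

lemma smon_eq_true (i : Fin 3) (p : ℕ × ℕ × ℕ) :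
    smon k (true, i, p) = pair 0 (Pi.single i (mon k (exps p))) := rfl

/-- The transport and divergence terms keep the component j; only f d(D xⱼ) spreads over all
components. -/
lemma act_single (D : W k 3) (j : Fin 3) (f : O k 3) :
    act D (Pi.single j f) = Pi.single j (D f + dvg D * f) + fun l => f * pd k l (D (x k j)) := by
  funext l
  have h : ∑ i, (Pi.single j f : Form k) i * pd k l (D (x k i)) = f * pd k l (D (x k j)) := by
    rw [Finset.sum_eq_single j]
    · rw [Pi.single_eq_same]
    · intro i _ hi
      rw [Pi.single_eq_of_ne hi, zero_mul]
    · exact fun h => absurd (Finset.mem_univ j) h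
  simp only [act, h, Pi.add_apply]
  rcases eq_or_ne l j with rfl | hl
  · rw [Pi.single_eq_same, Pi.single_eq_same]
    ring
  · rw [Pi.single_eq_of_ne hl, Pi.single_eq_of_ne hl, map_zero, mul_zero]
    ring

lemma act_vmon (i j : Fin 3) (p q : ℕ × ℕ × ℕ) :
    pair 0 (act (vmon k i (exps p)) (Pi.single j (mon k (exps q)))) =
      lc k (smon k) (actMon i p j q) := by
  have hd : ∀ l : Fin 3, mon k (exps q) * pd k l (mon k (exps p)) =
      (exp3 l p : k) • mon k (exps (low3 l (add3 p q))) := by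
    intro l
    rw [mon_mul_pd_mon, add_comm, exps_apply, exps_low3, exps_add3]
  -- Transport contributes qᵢ and divergence pᵢ times the same monomial, whence the single first
  -- entry of `actMon`.
  have h1 : vmon k i (exps p) (mon k (exps q)) + dvg (vmon k i (exps p)) * mon k (exps q) =
      ((exp3 i q + exp3 i p : ℕ) : k) • mon k (exps (low3 i (add3 p q))) := by
    rw [Nat.cast_add, add_smul, ← hd, dvg_vmon, ← pd_mon, mul_comm (pd k i _), vmon_mon,
      exps_apply, exps_low3, exps_add3]
  rw [act_single, h1, vmon_x, actMon, lc_cons, smon_eq_true, smul_pair, smul_zero, smul_single,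
    Int.cast_natCast]
  split_ifs with hij
  · simp only [lc_cons, lc_nil, smon_eq_true, smul_pair, smul_zero, smul_single, pair_add_pair,
      add_zero, Int.cast_natCast, hd]
    congr 2
    funext l
    simp only [Pi.add_apply]
    fin_cases l <;> simp
  · simp only [lc_nil, add_zero, map_zero, mul_zero]
    congr 1
    funext l
    simp

/-- The product of dxᵢ and dxⱼ is, up to sign, the derivation in the third direction; the indices
are cyclic because addition takes place in `Fin 3`. -/
lemma cross_mon (i j : Fin 3) (p q : ℕ × ℕ × ℕ) :
    pair (cross (Pi.single i (mon k (exps p))) (Pi.single j (mon k (exps q)))) 0 =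
      lc k (smon k) (sBracket (true, i, p) (true, j, q)) := by
  have hm : ∀ l, vmon k l (exps (add3 p q)) = (mon k (exps p) * mon k (exps q)) • pd k l := by
    intro l
    rw [vmon, exps_add3, mon_mul]
  have key : cross (Pi.single i (mon k (exps p))) (Pi.single j (mon k (exps q))) =
      if j = i + 1 then vmon k (i + 2) (exps (add3 p q)) else
        if i = j + 1 then -vmon k (j + 2) (exps (add3 p q)) else 0 := by
    simp only [hm]
    apply ext_x
    intro l
    rw [cross_apply]
    have e : ∀ (a b : Fin 3) (f : O k 3),
        (Pi.single a f : Form k) b = if b = a then f else 0 := fun a b f => Pi.single_apply a f b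
    simp only [e]
    rcases (by decide : ∀ i : Fin 3, i = 0 ∨ i = 1 ∨ i = 2) i with rfl | rfl | rfl <;>
    rcases (by decide : ∀ i : Fin 3, i = 0 ∨ i = 1 ∨ i = 2) j with rfl | rfl | rfl <;>
    simp (decide := true) only [if_true, if_false, mul_zero, zero_mul, sub_zero, zero_sub,
      add_zero, zero_add, Derivation.zero_apply, Derivation.neg_apply, Derivation.smul_apply,
      smul_eq_mul, neg_mul] <;>
    rfl
  rw [key]
  simp only [sBracket]
  split_ifs
  · simp [smon_eq_false]
  · rw [lc_cons, lc_nil, add_zero, smon_eq_false, smul_pair, smul_zero]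
    push_cast
    rw [neg_one_smul]
  · rfl

lemma lie_smon (s t : Bool × Fin 3 × ℕ × ℕ × ℕ) :
    ⁅smon k s, smon k t⁆ = lc k (smon k) (sBracket s t) := by
  obtain ⟨b, i, p⟩ := s
  obtain ⟨c, j, q⟩ := t
  rcases b with _ | _ <;> rcases c with _ | _
  · rw [smon_eq_false, smon_eq_false, lie_pair, cross_zero_left, act_zero_right, act_zero_right,
      lie_vmon]
    simp only [sBracket, lc_cons, lc_nil, smon_eq_false, smul_pair, smul_zero, pair_add_pair, add_zero,
      exps_low3, exps_add3, exps_apply, sub_zero]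
    push_cast
    rw [neg_smul, sub_eq_add_neg]
  · rw [sBracket, ← act_vmon, smon_eq_false, smon_eq_true, lie_pair, cross_zero_left, lie_zero, add_zero,
      act_zero_left, sub_zero]
  · rw [sBracket, lc_scale, ← act_vmon, ← lie_skew, smon_eq_false, smon_eq_true, lie_pair,
      cross_zero_left, lie_zero, add_zero, act_zero_left, sub_zero]
    push_cast
    rw [neg_one_smul]
  · rw [← cross_mon, smon_eq_true, smon_eq_true, lie_pair, act_zero_left, act_zero_left, lie_zero,
      zero_add, sub_zero]

end Cartan

/-! ### The filtration defined by an adapted basis -/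

namespace IntComb

/-- Addition of a term to a formal linear combination without repeated indices. -/
def insertTerm {I : Type*} [DecidableEq I] (t : ℤ × I) : List (ℤ × I) → List (ℤ × I)
  | [] => [t]
  | s :: ss =>
    if t.2 = s.2 then if (t.1 + s.1) % 3 = 0 then ss else (t.1 + s.1, s.2) :: ss
    else s :: insertTerm t ss

/-- Collection of the terms with the same index, modulo `3`. -/
def collect {I : Type*} [DecidableEq I] (xs : List (ℤ × I)) : List (ℤ × I) := xs.foldr insertTerm []

variable {k : Type*} [Field k] [CharP k 3] {I M : Type*} [DecidableEq I] [AddCommGroup M]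
  [Module k M]

lemma lc_insertTerm (v : I → M) (t : ℤ × I) (xs : List (ℤ × I)) :
    lc k v (insertTerm t xs) = (t.1 : k) • v t.2 + lc k v xs := by
  induction xs with
  | nil => simp [insertTerm]
  | cons s ss ih =>
    rw [insertTerm]
    split_ifs with h1 h2
    · rw [lc_cons, h1, ← add_assoc, ← add_smul, ← Int.cast_add, intCast_eq_zero.2 h2, zero_smul,
        zero_add]
    · rw [lc_cons, lc_cons, h1, ← add_assoc, ← add_smul, Int.cast_add]
    · rw [lc_cons, lc_cons, ih, add_left_comm]

lemma lc_collect (v : I → M) (xs : List (ℤ × I)) : lc k v (collect xs) = lc k v xs := by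
  induction xs with
  | nil => rfl
  | cons t xs ih => rw [lc_cons, ← ih]; exact lc_insertTerm v t (collect xs)

lemma mem_insertTerm {t : ℤ × I} {xs : List (ℤ × I)} {P : I → Prop} (ht : P t.2)
    (h : ∀ s ∈ xs, P s.2) : ∀ s ∈ insertTerm t xs, P s.2 := by
  induction xs with
  | nil => simpa [insertTerm] using ht
  | cons s ss ih =>
    have hs : ∀ r ∈ ss, P r.2 := fun r hr => h r (by simp [hr])
    rw [insertTerm]
    split_ifs with h1 h2
    · exact hs
    · exact List.forall_mem_cons.2 ⟨h s (by simp), hs⟩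
    · exact List.forall_mem_cons.2 ⟨h s (by simp), ih hs⟩

lemma mem_collect {xs : List (ℤ × I)} {P : I → Prop} (h : ∀ s ∈ xs, P s.2) :
    ∀ s ∈ collect xs, P s.2 := by
  induction xs with
  | nil => simp [collect]
  | cons s ss ih => exact mem_insertTerm (h s (by simp)) (ih fun r hr => h r (by simp [hr]))

end IntComb

/-! ### Degrees, models and generators of the adapted basis. -/

namespace LieE6

open IntComb Cartan

/-- The degree of the `n`-th vector of an adapted basis. -/
def deg (n : ℕ) : ℤ :=
  if n < 8 then 2 else if n < 17 then 1 else if n < 35 then 0 else if n < 44 then -1 else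
    if n < 62 then -2 else if n < 70 then -3 else -4

/-- The form `d(x₁^i x₂^j x₃^l)`. -/
def dForm (i j l : ℕ) : List (ℤ × Bool × Fin 3 × ℕ × ℕ × ℕ) :=
  [(i, true, 0, i - 1, j, l), (j, true, 1, i, j - 1, l), (l, true, 2, i, j, l - 1)]

/-- The leading part of a vector of an adapted basis, as an element of `𝒮₃(1, ω_S)`. -/
def model (n : ℕ) : List (ℤ × Bool × Fin 3 × ℕ × ℕ × ℕ) :=
  if n < 8 then [(1, false, 2, n / 3, n % 3, 0)] else
  if n < 17 then dForm ((n - 8) / 3) ((n - 8) % 3) 0 else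
  if n < 26 then
    [(1, false, 0, (n - 17) / 3, (n - 17) % 3, 0),
      (-((n - 17) / 3 : ℕ), false, 2, (n - 17) / 3 - 1, (n - 17) % 3, 1)] else
  if n < 35 then
    [(1, false, 1, (n - 26) / 3, (n - 26) % 3, 0),
      (-((n - 26) % 3 : ℕ), false, 2, (n - 26) / 3, (n - 26) % 3 - 1, 1)] else
  if n < 44 then dForm ((n - 35) / 3) ((n - 35) % 3) 1 else
  if n < 53 then
    [(1, false, 0, (n - 44) / 3, (n - 44) % 3, 1),
      (((n - 44) / 3 : ℕ), false, 2, (n - 44) / 3 - 1, (n - 44) % 3, 2)] else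
  if n < 62 then
    [(1, false, 1, (n - 53) / 3, (n - 53) % 3, 1),
      (((n - 53) % 3 : ℕ), false, 2, (n - 53) / 3, (n - 53) % 3 - 1, 2)] else
  if n < 70 then dForm ((n - 62) / 3) ((n - 62) % 3) 2 else
    [(-((n - 69) % 3 : ℕ), false, 0, (n - 69) / 3, (n - 69) % 3 - 1, 2),
      (((n - 69) / 3 : ℕ), false, 1, (n - 69) / 3 - 1, (n - 69) % 3, 2)]

/-- The numbers of the vectors `∂₃`, `∂₁`, `∂₂` and `x₁²x₂²x₃`, which generate the Lie algebra. -/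
def generators : List ℕ := [0, 17, 26, 43]

/-- The vectors of an adapted basis as brackets: the entry `(m, c, p, q)` means that the `m`-th
vector is `c` times the bracket of the `p`-th and the `q`-th one. -/
def recTable : List (ℕ × ℤ × ℕ × ℕ) :=
  [(42, -1, 26, 43), (41, 1, 26, 42), (40, -1, 17, 43), (39, -1, 17, 42), (38, -1, 17, 41),
  (37, 1, 17, 40), (36, 1, 17, 39), (35, 1, 17, 38), (8, -1, 35, 0), (9, -1, 36, 0),
  (10, -1, 37, 0), (11, -1, 38, 0), (12, -1, 39, 0), (13, -1, 40, 0), (14, -1, 41, 0),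
  (15, -1, 42, 0), (16, -1, 43, 0), (34, 1, 43, 11), (25, -1, 43, 9), (33, 1, 42, 11),
  (24, -1, 42, 9), (32, 1, 41, 11), (23, -1, 41, 9), (31, 1, 40, 11), (22, -1, 40, 9),
  (30, 1, 39, 11), (21, -1, 39, 9), (29, 1, 38, 11), (20, -1, 38, 9), (28, 1, 37, 11),
  (19, -1, 37, 9), (27, 1, 36, 11), (18, -1, 36, 9), (1, -1, 11, 10), (2, -1, 9, 13),
  (3, 1, 11, 12), (4, -1, 11, 13), (5, 1, 9, 16), (6, 1, 11, 15), (7, -1, 11, 16),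
  (52, 1, 43, 36), (61, -1, 43, 38), (51, -1, 26, 52), (50, 1, 26, 51), (49, -1, 17, 52),
  (48, -1, 17, 51), (47, -1, 17, 50), (46, 1, 17, 49), (45, 1, 17, 48), (44, 1, 17, 47),
  (60, -1, 26, 61), (59, 1, 26, 60), (58, -1, 17, 61), (57, -1, 17, 60), (56, -1, 17, 59),
  (55, 1, 17, 58), (54, 1, 17, 57), (53, 1, 17, 56), (69, -1, 61, 35), (67, -1, 52, 35),
  (68, 1, 26, 69), (66, -1, 17, 69), (65, -1, 17, 68), (64, 1, 17, 67), (63, 1, 17, 66),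
  (62, 1, 17, 65), (77, -1, 69, 36), (76, -1, 26, 77), (75, 1, 26, 76), (74, -1, 17, 77),
  (73, -1, 17, 76), (72, -1, 17, 75), (71, 1, 17, 74), (70, 1, 17, 73)]

/-- The structure constants of the adapted basis, with collected terms. -/
def redConst (m n : ℕ) : List (ℤ × ℕ) := collect (structConst m n)

/-- The part of degree `d` of a formal linear combination, in `𝒮₂(1)`. -/
def leadList (d : ℤ) (xs : List (ℤ × ℕ)) : List (ℤ × Bool × Fin 3 × ℕ × ℕ × ℕ) :=
  bind (fun l => if deg l = d then model l else []) xs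

/-- The part of degree less than `d` of a formal linear combination. -/
def lowPart (d : ℤ) (xs : List (ℤ × ℕ)) : List (ℤ × ℕ) := xs.filter fun t => deg t.2 < d

/-- The computational core. The first test says that brackets with a generator respect the
filtration, the second that their leading terms are the brackets of the models. The remaining rows
follow from the Jacobi identity. -/
lemma rows_spec : ∀ g ∈ generators, ∀ n ∈ List.range 78,
    isZero (lowPart (deg g + deg n) (redConst g n)) &&
    isZero (collect (sTrunc (leadList (deg g + deg n) (redConst g n) ++
      scale (-1) (mul sBracket (model g) (model n))))) := by
  decide +kernel

lemma recTable_spec : ∀ r ∈ recTable, r.1 < 78 ∧ r.2.2.1 < 78 ∧ r.2.2.2 < 78 ∧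
    deg r.1 = deg r.2.2.1 + deg r.2.2.2 := by
  decide +kernel

lemma recTable_lie : ∀ r ∈ recTable,
    isZero (collect ((-1, r.1) :: scale r.2.1 (redConst r.2.2.1 r.2.2.2))) = true := by
  decide +kernel

/-- The same recursion as in `recTable_lie` builds the models from the models of the generators, so
statements can be carried along simultaneously on both sides. -/
lemma recTable_model : ∀ r ∈ recTable,
    isZero (collect (sTrunc (scale r.2.1 (mul sBracket (model r.2.2.1) (model r.2.2.2)) ++
      scale (-1) (model r.1)))) = true := by
  decide +kernel

/-- The entries of a table of brackets only refer to earlier entries. -/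
def isOrdered : List ℕ → List (ℕ × ℤ × ℕ × ℕ) → Bool
  | _, [] => true
  | xs, r :: rs => xs.elem r.2.2.1 && xs.elem r.2.2.2 && isOrdered (r.1 :: xs) rs

lemma isOrdered_induction {P : ℕ → Prop} (rs : List (ℕ × ℤ × ℕ × ℕ)) :
    ∀ xs : List ℕ, isOrdered xs rs = true → (∀ n ∈ xs, P n) →
      (∀ r ∈ rs, P r.2.2.1 → P r.2.2.2 → P r.1) → ∀ n ∈ rs.map Prod.fst ++ xs, P n := by
  induction rs with
  | nil => exact fun xs _ hx _ n hn => hx n hn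
  | cons r rs ih =>
    intro xs ho hx hr n hn
    simp only [isOrdered, Bool.and_eq_true, List.elem_iff] at ho
    have h1 : P r.1 := hr r (by simp) (hx _ ho.1.1) (hx _ ho.1.2)
    refine ih (r.1 :: xs) ho.2 ?_ (fun s hs => hr s (by simp [hs])) n ?_
    · intro l hl
      rcases List.mem_cons.1 hl with rfl | hl
      · exact h1
      · exact hx l hl
    · simp only [List.map_cons, List.cons_append, List.mem_cons, List.mem_append] at hn ⊢
      tauto

/-- Induction along the construction of the adapted basis from the generators. -/
lemma rec_induction {P : ℕ → Prop} (hg : ∀ n ∈ generators, P n)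
    (hr : ∀ r ∈ recTable, P r.2.2.1 → P r.2.2.2 → P r.1) {n : ℕ} (hn : n < 78) : P n := by
  have h : ∀ n < 78, n ∈ recTable.map Prod.fst ++ generators := by decide +kernel
  exact isOrdered_induction recTable generators (by decide +kernel) hg hr n (h n hn)

variable {k : Type*} [Field k] {L : Type*}

section

variable [AddCommGroup L] [Module k L] (b : Module.Basis (Fin 78) k L)

/-- The filtration by the degree of the vectors of an adapted basis. -/
def Fil (j : ℤ) : Submodule k L where
  carrier := {x | ∀ n : Fin 78, deg n < j → b.repr x n = 0}
  add_mem' {x y} hx hy n hn := by simp [hx n hn, hy n hn]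
  zero_mem' n _ := by simp
  smul_mem' c x hx n hn := by simp [hx n hn]

variable {b}

lemma repr_vec {n : ℕ} (l : Fin 78) : b.repr (vec b n) l = if n = l then 1 else 0 := by
  rw [vec]
  split_ifs with h1 h2 h2
  · subst h2; simp
  · rw [Module.Basis.repr_self, Finsupp.single_apply, if_neg (by rwa [Fin.ext_iff])]
  · exact absurd (h2 ▸ l.2) h1
  · simp

lemma vec_mem_Fil {n : ℕ} {j : ℤ} (h : j ≤ deg n) : vec b n ∈ Fil b j := by
  intro l hl
  rw [repr_vec, if_neg]
  rintro rfl
  omega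

lemma Fil_le {j : ℤ} {V : Submodule k L} (h : ∀ n < 78, j ≤ deg n → vec b n ∈ V) :
    Fil b j ≤ V := by
  intro x hx
  rw [← b.sum_repr x]
  refine V.sum_mem fun n _ => ?_
  by_cases hn : deg n < j
  · rw [hx n hn, zero_smul]
    exact V.zero_mem
  · rw [← vec_val]
    exact V.smul_mem _ (h n n.2 (by omega))

lemma Fil_anti {i j : ℤ} (h : i ≤ j) : Fil b j ≤ Fil b i := fun _ hx n hn => hx n (by omega)

lemma deg_le (n : ℕ) : deg n ≤ 2 := by
  unfold deg; split_ifs <;> norm_num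

lemma le_deg (n : ℕ) : -4 ≤ deg n := by
  unfold deg; split_ifs <;> norm_num

lemma Fil_eq_bot {j : ℤ} (h : 3 ≤ j) : Fil b j = ⊥ :=
  eq_bot_iff.2 (Fil_le fun n _ hn => absurd (deg_le n) (by omega))

lemma Fil_eq_top {j : ℤ} (h : j ≤ -4) : Fil b j = ⊤ :=
  eq_top_iff.2 fun _ _ n hn => absurd (le_deg n) (by omega)

end

section

variable [CharP k 3] [AddCommGroup L] [Module k L] {b : Module.Basis (Fin 78) k L}

lemma lc_mem_Fil {xs : List (ℤ × ℕ)} {j : ℤ} (h : isZero (lowPart j xs) = true) :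
    lc k (vec b) xs ∈ Fil b j := by
  have key : lc k (vec b) xs - lc k (vec b) (lowPart j xs) ∈ Fil b j := by
    clear h
    induction xs with
    | nil => simp [lowPart]
    | cons t xs ih =>
      rw [lowPart, List.filter_cons]
      split_ifs with ht
      · rw [lc_cons, lc_cons, add_sub_add_left_eq_sub]
        exact ih
      · rw [lc_cons, add_sub_assoc]
        refine Submodule.add_mem _ (Submodule.smul_mem _ _ (vec_mem_Fil ?_)) ih
        simpa using ht
  rwa [lc_eq_zero _ _ h, sub_zero] at key

/-- The vector of `𝒮₂(1)` that corresponds to a vector of an adapted basis. -/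
noncomputable def modelVec (k : Type*) [Field k] [CharP k 3] (n : ℕ) : S2 k :=
  lc k (smon k) (model n)

variable (b) in
/-- The part of degree `d`, in `𝒮₂(1)`. -/
noncomputable def leadMap (d : ℤ) : L →ₗ[k] S2 k :=
  b.constr k fun n => if deg n = d then modelVec k n else 0

lemma leadMap_vec {n : ℕ} (hn : n < 78) (d : ℤ) :
    leadMap b d (vec b n) = if deg n = d then modelVec k n else 0 := by
  rw [vec, dif_pos hn, leadMap, Module.Basis.constr_basis]

lemma leadMap_eq_zero {d : ℤ} {x : L} (hx : x ∈ Fil b (d + 1)) : leadMap b d x = 0 := by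
  have : Fil b (d + 1) ≤ LinearMap.ker (leadMap b d) := Fil_le fun n hn hd => by
    rw [LinearMap.mem_ker, leadMap_vec hn, if_neg (by omega)]
  exact this hx

end

/-! ### Multiplicativity of the filtration and of leading parts. -/

variable [CharP k 3] [LieRing L] [LieAlgebra k L] {b : Module.Basis (Fin 78) k L}

lemma redConst_lt {m n : ℕ} (hm : m < 78) (hn : n < 78) : ∀ t ∈ redConst m n, t.2 < 78 := by
  refine mem_collect (P := fun i => i < 78) fun t ht => ?_
  simp only [structConst, IntComb.mul, IntComb.bind, scale, List.mem_flatMap, List.mem_map] at ht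
  obtain ⟨a, ⟨c, hc, s, ⟨d, hd, u, hu, rfl⟩, rfl⟩, v, hv, rfl⟩ := ht
  exact coords_lt _ (codeBracket_isCode (adapted_isCode m hm c hc) (adapted_isCode n hn d hd)
    u hu).mem v hv

lemma lie_vec (hb : HasStructConst b) {m n : ℕ} (hm : m < 78) (hn : n < 78) :
    ⁅vec b m, vec b n⁆ = lc k (vec b) (redConst m n) := by
  rw [hb m n hm hn, redConst, lc_collect]

lemma leadMap_lie_vec (hb : HasStructConst b) {m n : ℕ} (hm : m < 78) (hn : n < 78) (d : ℤ) :
    leadMap b d ⁅vec b m, vec b n⁆ = lc k (smon k) (leadList d (redConst m n)) := by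
  rw [lie_vec hb hm hn, map_lc, leadList, lc_bind]
  refine lc_congr _ fun t ht => ?_
  rw [leadMap_vec (redConst_lt hm hn t ht)]
  split_ifs <;> rfl

/-- The element `x` has degree at least `i`, and `s` is its part of degree `i`. -/
def HasLead (b : Module.Basis (Fin 78) k L) (x : L) (i : ℤ) (s : S2 k) : Prop :=
  ∀ j, ∀ y ∈ Fil b j, ⁅x, y⁆ ∈ Fil b (i + j) ∧ leadMap b (i + j) ⁅x, y⁆ = ⁅s, leadMap b j y⁆

lemma hasLead_of_vec {x : L} {i : ℤ} {s : S2 k} (h1 : ∀ n < 78, ⁅x, vec b n⁆ ∈ Fil b (i + deg n))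
    (h2 : ∀ n < 78, leadMap b (i + deg n) ⁅x, vec b n⁆ = ⁅s, modelVec k n⁆) :
    HasLead b x i s := by
  intro j y hy
  have e1 : Fil b j ≤ (Fil b (i + j)).comap (LieAlgebra.ad k L x : L →ₗ[k] L) :=
    Fil_le fun n hn hd => Fil_anti (by omega) (h1 n hn)
  have e2 : Fil b j ≤ LinearMap.eqLocus (leadMap b (i + j) ∘ₗ (LieAlgebra.ad k L x : L →ₗ[k] L))
      ((LieAlgebra.ad k (S2 k) s : S2 k →ₗ[k] S2 k) ∘ₗ leadMap b j) := by
    refine Fil_le fun n hn hd => ?_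
    rw [LinearMap.mem_eqLocus]
    simp only [LinearMap.comp_apply, LieAlgebra.ad_apply]
    rw [leadMap_vec hn]
    split_ifs with hj
    · rw [← hj, h2 n hn]
    · rw [lie_zero]
      exact leadMap_eq_zero (Fil_anti (by omega) (h1 n hn))
  exact ⟨e1 hy, e2 hy⟩

/-- By the Jacobi identity ad [x, x'] is a commutator, in `L` as well as in 𝒮₂(1), and the condition
only concerns how ad x acts on the filtration and on leading parts. This is why checking generators
suffices. -/
lemma HasLead.lie {x x' : L} {i i' : ℤ} {s s' : S2 k} (h : HasLead b x i s)
    (h' : HasLead b x' i' s') : HasLead b ⁅x, x'⁆ (i + i') ⁅s, s'⁆ := by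
  intro j y hy
  obtain ⟨a1, a2⟩ := h j y hy
  obtain ⟨b1, b2⟩ := h' j y hy
  obtain ⟨c1, c2⟩ := h _ _ b1
  obtain ⟨d1, d2⟩ := h' _ _ a1
  rw [show i' + (i + j) = i + (i' + j) by ring] at d1 d2
  rw [add_assoc, lie_lie, map_sub, c2, d2, a2, b2, lie_lie]
  exact ⟨Submodule.sub_mem _ c1 d1, rfl⟩

lemma HasLead.smul {x : L} {i : ℤ} {s : S2 k} (h : HasLead b x i s) (c : k) :
    HasLead b (c • x) i (c • s) := by
  intro j y hy
  obtain ⟨a1, a2⟩ := h j y hy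
  rw [smul_lie, map_smul, a2, smul_lie]
  exact ⟨Submodule.smul_mem _ _ a1, rfl⟩

lemma lie_modelVec (m n : ℕ) :
    ⁅modelVec k m, modelVec k n⁆ = lc k (smon k) (mul sBracket (model m) (model n)) :=
  lie_lc _ _ _ _ _ _ fun s _ t _ => lie_smon s.2 t.2

lemma lc_eq_of_sTrunc {xs ys : List (ℤ × Bool × Fin 3 × ℕ × ℕ × ℕ)}
    (h : isZero (collect (sTrunc (xs ++ scale (-1) ys))) = true) :
    lc k (smon k) xs = lc k (smon k) ys := by
  have := lc_eq_zero (k := k) (smon k) _ h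
  rw [lc_collect, lc_sTrunc, lc_append, lc_scale] at this
  push_cast at this
  rw [neg_one_smul, ← sub_eq_add_neg] at this
  exact sub_eq_zero.1 this

lemma vec_eq_lie (hb : HasStructConst b) {r : ℕ × ℤ × ℕ × ℕ} (hr : r ∈ recTable) :
    vec b r.1 = (r.2.1 : k) • ⁅vec b r.2.2.1, vec b r.2.2.2⁆ := by
  obtain ⟨h1, h2, h3, -⟩ := recTable_spec r hr
  have := lc_eq_zero (k := k) (vec b) _ (recTable_lie r hr)
  rw [lc_collect, lc_cons, lc_scale, ← lie_vec hb h2 h3] at this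
  push_cast at this
  rw [neg_one_smul, neg_add_eq_zero] at this
  exact this

lemma modelVec_eq_lie {r : ℕ × ℤ × ℕ × ℕ} (hr : r ∈ recTable) :
    modelVec k r.1 = (r.2.1 : k) • ⁅modelVec k r.2.2.1, modelVec k r.2.2.2⁆ := by
  rw [lie_modelVec, ← lc_scale, lc_eq_of_sTrunc (recTable_model r hr)]
  rfl

lemma hasLead_vec (hb : HasStructConst b) {n : ℕ} (hn : n < 78) :
    HasLead b (vec b n) (deg n) (modelVec k n) := by
  refine rec_induction (P := fun n => HasLead b (vec b n) (deg n) (modelVec k n)) ?_ ?_ hn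
  · intro g hg
    have hg' : g < 78 := by
      have : ∀ g ∈ generators, g < 78 := by decide
      exact this g hg
    refine hasLead_of_vec (fun n hn => ?_) (fun n hn => ?_)
    · rw [lie_vec hb hg' hn]
      exact lc_mem_Fil (Bool.and_eq_true_iff.1 (rows_spec g hg n (List.mem_range.2 hn))).1
    · rw [leadMap_lie_vec hb hg' hn, lc_eq_of_sTrunc (Bool.and_eq_true_iff.1
        (rows_spec g hg n (List.mem_range.2 hn))).2, lie_modelVec]
  · intro r hr h1 h2
    rw [vec_eq_lie hb hr, modelVec_eq_lie hr, (recTable_spec r hr).2.2.2]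
    exact (h1.lie h2).smul _

lemma hasLead (hb : HasStructConst b) {i : ℤ} {x : L} (hx : x ∈ Fil b i) :
    HasLead b x i (leadMap b i x) := by
  intro j y hy
  have e1 : Fil b i ≤ (Fil b (i + j)).comap (LieAlgebra.ad k L y : L →ₗ[k] L) := by
    refine Fil_le fun n hn hd => ?_
    rw [Submodule.mem_comap, LieAlgebra.ad_apply, ← lie_skew]
    exact Submodule.neg_mem _ (Fil_anti (by omega) (hasLead_vec hb hn j y hy).1)
  have e2 : Fil b i ≤ LinearMap.eqLocus (leadMap b (i + j) ∘ₗ (LieAlgebra.ad k L y : L →ₗ[k] L))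
      ((LieAlgebra.ad k (S2 k) (leadMap b j y) : S2 k →ₗ[k] S2 k) ∘ₗ leadMap b i) := by
    refine Fil_le fun n hn hd => ?_
    rw [LinearMap.mem_eqLocus]
    simp only [LinearMap.comp_apply, LieAlgebra.ad_apply]
    obtain ⟨a1, a2⟩ := hasLead_vec hb hn j y hy
    rw [leadMap_vec hn, ← lie_skew, map_neg]
    split_ifs with hj
    · rw [← hj, a2, lie_skew]
    · rw [lie_zero, leadMap_eq_zero (Fil_anti (by omega) a1), neg_zero]
  have h1 := e1 hx
  have h2 := e2 hx
  rw [Submodule.mem_comap, LieAlgebra.ad_apply, ← lie_skew, neg_mem_iff] at h1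
  rw [LinearMap.mem_eqLocus] at h2
  simp only [LinearMap.comp_apply, LieAlgebra.ad_apply] at h2
  rw [← lie_skew, map_neg, ← lie_skew (leadMap b j y), neg_inj] at h2
  exact ⟨h1, h2⟩

lemma lie_mem_Fil (hb : HasStructConst b) {i j : ℤ} {x y : L} (hx : x ∈ Fil b i)
    (hy : y ∈ Fil b j) : ⁅x, y⁆ ∈ Fil b (i + j) :=
  (hasLead hb hx j y hy).1

lemma leadMap_lie (hb : HasStructConst b) {i j : ℤ} {x y : L} (hx : x ∈ Fil b i)
    (hy : y ∈ Fil b j) : leadMap b (i + j) ⁅x, y⁆ = ⁅leadMap b i x, leadMap b j y⁆ :=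
  (hasLead hb hx j y hy).2

end LieE6

/-! ### Detection of coordinates by brackets -/

namespace LieE6

open IntComb Cartan

/-- The value on the `m`-th vector of the functional `X ↦ ∑ c ⁅X, b_g⁆_l`, the sum being over the
triples `(c, g, l)` of a list. -/
def pivotVal (m : ℕ) (ps : List (ℤ × ℕ × ℕ)) : ℤ :=
  (ps.map fun p => p.1 * coef p.2.2 (redConst m p.2.1)).sum

/-- The functional given by `ps` is homogeneous and induces `c` times the `m`-th coordinate. -/
def isPivot (m : ℕ) (ps : List (ℤ × ℕ × ℕ)) (c : ℤ) : Bool :=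
  ps.all (fun p => Nat.blt p.2.1 78 && deg p.2.2 == deg m + deg p.2.1) &&
    (List.range 78).all fun n =>
      !(deg n == deg m) || (pivotVal n ps - bif Nat.beq n m then c else 0) % 3 == 0

/-- A functional that detects the `m`-th coordinate, for `deg m < 0`, by brackets with `e`. -/
def nilPivot (m : ℕ) : List (ℤ × ℕ × ℕ) :=
  -- In the model, bracketing with ∂₃ lowers the exponent of x₃, which shifts the numbering by 27.
  -- In degree −4 the result has two components, and one is chosen that no other vector of this
  -- degree contributes to.
  [(1, 0, if m < 70 then m - 27 else [44, 45, 53, 47, 48, 56, 50, 51].getD (m - 70) 0)]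

/-- A functional that detects the `m`-th coordinate, for `-2 ≤ deg m ≤ -1`, by brackets with
vectors of degree `1`. -/
def onePivot (m : ℕ) : List (ℤ × ℕ × ℕ) :=
  -- The vectors 11 and 9 are models of dx₁ and dx₂. For example, d(fx₃) and dx₁ have a bracket with
  -- component f∂₂, and fx₃∂₁ acts on dx₁ with component d(fx₃).
  [(1, if m < 53 then 11 else 9, if m < 53 then m - 9 else m - 18)]

/-- A functional that detects the `m`-th coordinate, for `deg m ≥ 0`, by brackets with vectors of
degree `-1`. -/
def lowPivot (m : ℕ) : List (ℤ × ℕ × ℕ) :=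
  [[(1, 36, 9)], [(1, 35, 9)], [(1, 35, 10)], [(1, 35, 11)], [(1, 35, 12)], [(1, 35, 13)],
  [(1, 35, 14)], [(1, 35, 15)], [], [(1, 35, 17)], [(1, 35, 18)], [(1, 35, 26)], [(1, 35, 20)],
  [(1, 35, 21)], [(1, 35, 29)], [(1, 35, 23)], [(1, 35, 24)], [(1, 38, 35)], [(1, 38, 36)],
  [(1, 38, 37)], [(1, 36, 36)], [(1, 35, 36), (1, 36, 37)], [(1, 35, 37)], [(1, 36, 39)],
  [(-1, 35, 39), (1, 38, 42)], [(1, 35, 40)], [(1, 36, 35)], [(1, 38, 38)], [(1, 38, 39)],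
  [(1, 36, 38)], [(1, 35, 38), (1, 38, 41)], [(-1, 35, 39), (1, 36, 40)], [(1, 36, 41)],
  [(1, 35, 41)], [(1, 35, 42)]].getD m []

/-- The functional induces a nonzero multiple of the `m`-th coordinate. -/
def detects (m : ℕ) (ps : List (ℤ × ℕ × ℕ)) : Bool := isPivot m ps 1 || isPivot m ps (-1)

/-- Injectivity of ad e on the graded parts of negative degree: ∂₃ commutes only with what is free
of x₃. -/
lemma nilPivot_spec : ∀ m ∈ List.range 78, 35 ≤ m → detects m (nilPivot m) = true := by
  decide +kernel

lemma onePivot_spec : ∀ m ∈ List.range 62, 35 ≤ m → detects m (onePivot m) = true := by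
  decide +kernel

/-- Transitivity of the grading in degrees at least 0. The number 8 has to be left out: this vector
is central, so no bracket sees it. -/
lemma lowPivot_spec : ∀ m ∈ List.range 35, m ≠ 8 → detects m (lowPivot m) = true := by
  decide +kernel

variable {k : Type*} [Field k] {L : Type*}

section

variable [AddCommGroup L] [Module k L] (b : Module.Basis (Fin 78) k L)

/-- The `n`-th coordinate. -/
noncomputable def co (n : ℕ) : L →ₗ[k] k := if h : n < 78 then b.coord ⟨n, h⟩ else 0

variable {b}

lemma co_val (n : Fin 78) (x : L) : co b n x = b.repr x n := by
  rw [co, dif_pos n.2]; rfl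

lemma co_vec {m : ℕ} (hm : m < 78) (n : ℕ) : co b n (vec b m) = if m = n then 1 else 0 := by
  by_cases hn : n < 78
  · have := co_val (b := b) ⟨n, hn⟩ (vec b m)
    rw [repr_vec] at this
    exact this
  · rw [co, dif_neg hn, if_neg (by omega)]; rfl

lemma co_lc (n : ℕ) (xs : List (ℤ × ℕ)) (h : ∀ t ∈ xs, t.2 < 78) :
    co b n (lc k (vec b) xs) = (coef n xs : k) := by
  induction xs with
  | nil => simp
  | cons t xs ih =>
    rw [lc_cons, map_add, ih fun s hs => h s (by simp [hs]), map_smul, co_vec (h t (by simp)),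
      coef_cons]
    split_ifs <;> simp

lemma co_eq_zero {n : ℕ} {j : ℤ} {x : L} (hx : x ∈ Fil b j) (hn : deg n < j) : co b n x = 0 := by
  by_cases h : n < 78
  · exact (co_val ⟨n, h⟩ x).trans (hx ⟨n, h⟩ hn)
  · rw [co, dif_neg h]; rfl

lemma mem_Fil_succ {j : ℤ} {x : L} (hx : x ∈ Fil b j)
    (h : ∀ n < 78, deg n = j → co b n x = 0) : x ∈ Fil b (j + 1) := by
  intro n hn
  rw [← co_val]
  rcases (by omega : deg n < j ∨ deg n = j) with h1 | h1
  · exact co_eq_zero hx h1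
  · exact h n n.2 h1

end

variable [LieRing L] [LieAlgebra k L] {b : Module.Basis (Fin 78) k L}

variable (b) in
/-- The functional given by a list of triples. -/
noncomputable def pivotMap (ps : List (ℤ × ℕ × ℕ)) : L →ₗ[k] k :=
  (ps.map fun p => (-p.1 : k) • co b p.2.2 ∘ₗ (LieAlgebra.ad k L (vec b p.2.1) : L →ₗ[k] L)).sum

lemma pivotMap_cons (p : ℤ × ℕ × ℕ) (ps : List (ℤ × ℕ × ℕ)) (x : L) :
    pivotMap b (p :: ps) x = (p.1 : k) * co b p.2.2 ⁅x, vec b p.2.1⁆ + pivotMap b ps x := by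
  simp only [pivotMap, List.map_cons, List.sum_cons, LinearMap.add_apply, LinearMap.smul_apply,
    LinearMap.comp_apply, LieAlgebra.ad_apply]
  rw [← lie_skew x, map_neg, smul_eq_mul, neg_mul_comm]

lemma pivotMap_eq_zero {ps : List (ℤ × ℕ × ℕ)} {x : L}
    (h : ∀ p ∈ ps, co b p.2.2 ⁅x, vec b p.2.1⁆ = 0) : pivotMap b ps x = 0 := by
  induction ps with
  | nil => rfl
  | cons p ps ih =>
    rw [pivotMap_cons, h p (by simp), ih fun q hq => h q (by simp [hq]), mul_zero, add_zero]

variable [CharP k 3]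

lemma pivotMap_vec (hb : HasStructConst b) {n : ℕ} (hn : n < 78) {ps : List (ℤ × ℕ × ℕ)}
    (h : ∀ p ∈ ps, p.2.1 < 78) : pivotMap b ps (vec b n) = (pivotVal n ps : k) := by
  induction ps with
  | nil => simp [pivotMap, pivotVal]
  | cons p ps ih =>
    have hp := h p (by simp)
    rw [pivotMap_cons, ih fun q hq => h q (by simp [hq]), lie_vec hb hn hp,
      co_lc _ _ (redConst_lt hn hp), pivotVal, pivotVal, List.map_cons, List.sum_cons]
    push_cast
    rfl

/-- The functional is homogeneous, so components of x above degree `deg m` contribute only in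
degrees higher than the coordinates that it reads. What remains is the finite check on the vectors
of that degree. -/
lemma pivotMap_eq (hb : HasStructConst b) {m : ℕ} {ps : List (ℤ × ℕ × ℕ)} {c : ℤ}
    (h : isPivot m ps c = true) {x : L} (hx : x ∈ Fil b (deg m)) :
    pivotMap b ps x = (c : k) * co b m x := by
  simp only [isPivot, Bool.and_eq_true, List.all_eq_true, Nat.blt_eq, beq_iff_eq, Bool.or_eq_true,
    Bool.not_eq_true', beq_eq_false_iff_ne, List.mem_range] at h
  obtain ⟨h1, h2⟩ := h
  have key : Fil b (deg m) ≤ LinearMap.eqLocus (pivotMap b ps) ((c : k) • co b m) := by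
    refine Fil_le fun n hn hd => ?_
    rw [LinearMap.mem_eqLocus, LinearMap.smul_apply, co_vec hn, smul_eq_mul]
    by_cases hnm : deg n = deg m
    · rw [pivotMap_vec hb hn fun p hp => (h1 p hp).1]
      have := (intCast_eq_zero (k := k)).2 ((h2 n hn).resolve_left (not_not.2 hnm))
      rw [Int.cast_sub, sub_eq_zero] at this
      rw [this]
      by_cases h : n = m
      · subst h; simp
      · have hf : Nat.beq n m = false := by
          rw [Bool.eq_false_iff]
          exact fun hb => h (Nat.eq_of_beq_eq_true hb)
        rw [hf, if_neg h]
        simp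
    · rw [if_neg (by rintro rfl; exact hnm rfl), mul_zero]
      refine pivotMap_eq_zero fun p hp => ?_
      have := lie_mem_Fil hb (vec_mem_Fil (b := b) (le_refl (deg n)))
        (vec_mem_Fil (b := b) (le_refl (deg p.2.1)))
      refine co_eq_zero this ?_
      have := (h1 p hp).2
      omega
  exact key hx

lemma co_eq_zero_of_detects (hb : HasStructConst b) {m : ℕ} {ps : List (ℤ × ℕ × ℕ)}
    (h : detects m ps = true) {x : L} (hx : x ∈ Fil b (deg m))
    (h0 : ∀ p ∈ ps, co b p.2.2 ⁅x, vec b p.2.1⁆ = 0) : co b m x = 0 := by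
  rcases Bool.or_eq_true_iff.1 h with h | h
  · have := pivotMap_eq hb h hx
    rw [pivotMap_eq_zero h0] at this
    simpa using this.symm
  · have := pivotMap_eq hb h hx
    rw [pivotMap_eq_zero h0] at this
    simpa using this.symm

lemma deg_facts : ∀ m ∈ List.range 78, (deg m < 0 ↔ 35 ≤ m) ∧
    (deg m < 0 → ∀ p ∈ nilPivot m, p.2.1 = 0 ∧ deg p.2.2 = deg m + 2) ∧
    (-2 ≤ deg m → deg m < 0 → ∀ p ∈ onePivot m, m < 62 ∧ deg p.2.1 = 1 ∧ deg p.2.2 = deg m + 1) ∧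
    (0 ≤ deg m → ∀ p ∈ lowPivot m, deg p.2.1 = -1 ∧ deg p.2.2 = deg m - 1 ∧ p.2.2 ≠ 8) := by
  decide +kernel

/-- Bracketing with e raises the degree by exactly 2 on negative degrees, so a bound for [x, e]
gives one for x. The bound i ≤ 2 keeps the degrees that have to be excluded negative. -/
lemma mem_Fil_of_lie_nil (hb : HasStructConst b) {i j : ℤ} {x : L} (hi : i ≤ 2)
    (hx : ⁅x, vec b 0⁆ ∈ Fil b i) (hj : j ≤ i - 2) : x ∈ Fil b j := by
  by_cases h4 : j ≤ -4
  · rw [Fil_eq_top h4]; trivial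
  -- The induction climbs from degree −4, where the filtration is everything, and removes one
  -- leading part at a time.
  have main : ∀ n : ℕ, (n : ℤ) - 4 ≤ i - 2 → x ∈ Fil b ((n : ℤ) - 4) := by
    intro n
    induction n with
    | zero => intro _; rw [Fil_eq_top (by norm_num)]; trivial
    | succ n ih =>
      intro hn
      push_cast at hn ⊢
      rw [show (n : ℤ) + 1 - 4 = n - 4 + 1 by ring]
      have hxn := ih (by omega)
      refine mem_Fil_succ hxn fun m hm hd => ?_
      obtain ⟨f1, f2, -⟩ := deg_facts m (List.mem_range.2 hm)
      have hneg : deg m < 0 := by omega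
      refine co_eq_zero_of_detects hb (nilPivot_spec m (List.mem_range.2 hm) (f1.1 hneg))
        (by rwa [hd]) fun p hp => ?_
      obtain ⟨e1, e2⟩ := f2 hneg p hp
      rw [e1]
      exact co_eq_zero hx (by omega)
  have := main (j + 4).toNat
  rw [Int.toNat_of_nonneg (by omega)] at this
  simpa using this (by omega)

lemma mem_Fil_succ_of_lie_one (hb : HasStructConst b) {j : ℤ} (h2 : -2 ≤ j) (h0 : j < 0) {x : L}
    (hx : x ∈ Fil b j) (h : ∀ y ∈ Fil b 1, ⁅x, y⁆ ∈ Fil b (j + 2)) : x ∈ Fil b (j + 1) := by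
  refine mem_Fil_succ hx fun m hm hd => ?_
  obtain ⟨f1, -, f3, -⟩ := deg_facts m (List.mem_range.2 hm)
  have hneg : deg m < 0 := by omega
  have f3 := f3 (by omega) hneg
  have hm62 : m < 62 := (f3 _ (by rw [onePivot]; exact List.mem_singleton_self _)).1
  refine co_eq_zero_of_detects hb (onePivot_spec m (List.mem_range.2 hm62) (f1.1 hneg))
    (by rwa [hd]) fun p hp => ?_
  obtain ⟨-, e1, e2⟩ := f3 p hp
  exact co_eq_zero (h _ (vec_mem_Fil (by omega))) (by omega)

/-- The coordinate 8 of the brackets is never consulted, so the criterion also works when brackets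
are known only modulo the centre. -/
lemma co_eq_zero_of_lie_low (hb : HasStructConst b) {j : ℤ} (h0 : 0 ≤ j) {x : L}
    (hx : x ∈ Fil b j)
    (h : ∀ y ∈ Fil b (-1), ∀ l, deg l = j - 1 → l ≠ 8 → co b l ⁅x, y⁆ = 0) {m : ℕ} (hm : m < 78)
    (hd : deg m = j) (h8 : m ≠ 8) : co b m x = 0 := by
  obtain ⟨f1, -, -, f4⟩ := deg_facts m (List.mem_range.2 hm)
  have hm35 : m < 35 := by
    by_contra h
    have := f1.2 (by omega)
    omega
  refine co_eq_zero_of_detects hb (lowPivot_spec m (List.mem_range.2 hm35) h8)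
    (by rwa [hd]) fun p hp => ?_
  obtain ⟨e1, e2, e3⟩ := f4 (by omega) p hp
  exact h _ (vec_mem_Fil (by omega)) _ (by omega) e3

end LieE6

/-! ### Bases of the Lie algebras of Cartan type -/

namespace Cartan

open IntComb

variable {k : Type*} [Field k] {m : ℕ}

/-- The family of the monomials with exponents at most `2`. -/
noncomputable def monFam (k : Type*) [Field k] (m : ℕ) (α : Fin m → Fin 3) : O k m :=
  mon k fun i => (α i).1

lemma mk_monomial (α : Fin m →₀ ℕ) (c : k) : mk k m (MvPolynomial.monomial α c) = c • mon k α := by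
  rw [MvPolynomial.monomial_eq, MvPolynomial.C_mul', map_smul, mon, Finsupp.prod_fintype _ _
    (fun i => pow_zero _), map_prod]
  simp only [map_pow]
  rfl

/-- The ideal is generated by monomials, so membership is decided on the support. This gives the
linear independence of the reduced monomials. -/
lemma mem_cubes_support {f : MvPolynomial (Fin m) k} (hf : f ∈ cubes k m) {α : Fin m →₀ ℕ}
    (hα : α ∈ f.support) : ∃ i, 3 ≤ α i := by
  have : cubes k m = Ideal.span ((fun s => MvPolynomial.monomial s (1 : k)) ''
      Set.range fun i : Fin m => Finsupp.single i 3) := by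
    rw [cubes, ← Set.range_comp]
    congr 2
    funext i
    exact MvPolynomial.X_pow_eq_monomial
  rw [this, MvPolynomial.mem_ideal_span_monomial_image] at hf
  obtain ⟨_, ⟨i, rfl⟩, hi⟩ := hf α hα
  exact ⟨i, by simpa using hi i⟩

lemma linearIndependent_monFam : LinearIndependent k (monFam k m) := by
  rw [Fintype.linearIndependent_iff]
  intro g hg α
  let e : (Fin m → Fin 3) → (Fin m →₀ ℕ) := fun α => Finsupp.equivFunOnFinite.symm fun i => (α i).1
  have he : Function.Injective e := by
    intro a c h
    funext i
    exact Fin.ext (DFunLike.congr_fun h i)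
  have h0 : mk k m (∑ a, MvPolynomial.monomial (e a) (g a)) = 0 := by
    rw [map_sum, ← hg]
    exact Finset.sum_congr rfl fun a _ => mk_monomial _ _
  rw [mk_eq_zero] at h0
  by_contra hne
  have hc : MvPolynomial.coeff (e α) (∑ a, MvPolynomial.monomial (e a) (g a)) = g α := by
    rw [MvPolynomial.coeff_sum, Finset.sum_eq_single α]
    · rw [MvPolynomial.coeff_monomial, if_pos rfl]
    · intro a _ ha
      rw [MvPolynomial.coeff_monomial, if_neg fun h => ha (he h)]
    · exact fun h => absurd (Finset.mem_univ α) h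
  obtain ⟨i, hi⟩ := mem_cubes_support h0 (α := e α) (by
    rw [MvPolynomial.mem_support_iff, hc]
    exact hne)
  have : (e α) i = (α i).1 := rfl
  have := (α i).2
  omega

/-- The basis of the truncated polynomial ring that consists of the monomials. -/
noncomputable def monBasis (k : Type*) [Field k] (m : ℕ) : Module.Basis (Fin m → Fin 3) k (O k m) :=
  Module.Basis.mk linearIndependent_monFam (by rw [← span_mon]; exact le_refl _)

lemma monBasis_apply (α : Fin m → Fin 3) : monBasis k m α = mon k fun i => (α i).1 := by
  rw [monBasis, Module.Basis.mk_apply]; rfl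

variable [CharP k 3]

/-- A derivation is given by its coefficients. -/
noncomputable def coeffEquiv (k : Type*) [Field k] [CharP k 3] (m : ℕ) :
    W k m ≃ₗ[k] (Fin m → O k m) where
  toFun D i := D (x k i)
  map_add' D E := rfl
  map_smul' c D := rfl
  invFun f := ∑ i, f i • pd k i
  left_inv D := ext_x fun j => by
    rw [sum_smul_apply]
    simp [pd_x]
  right_inv f := by
    funext j
    beta_reduce
    rw [sum_smul_apply]
    simp [pd_x]

/-- The basis of `W(m; 1)` that consists of the derivations `x^α ∂ᵢ`. -/
noncomputable def vmonBasis (k : Type*) [Field k] [CharP k 3] (m : ℕ) :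
    Module.Basis (Σ _ : Fin m, (Fin m → Fin 3)) k (W k m) :=
  (Pi.basis fun _ : Fin m => monBasis k m).map (coeffEquiv k m).symm

lemma vmonBasis_apply (i : Fin m) (α : Fin m → Fin 3) :
    vmonBasis k m ⟨i, α⟩ = vmon k i fun j => (α j).1 := by
  rw [vmonBasis, Module.Basis.map_apply, LinearEquiv.symm_apply_eq, Pi.basis_apply, monBasis_apply]
  funext j
  change _ = vmon k i _ (x k j)
  rw [vmon_x, Pi.single_apply]
  simp only [eq_comm]

lemma dvg_smul_deg (c : k) : dvg (c • deg k 2) = -algebraMap k (O k 2) c := by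
  have h3 : (2 : O k 2) = -1 := by
    have h : ((3 : ℕ) : k) = 0 := CharP.cast_eq_zero k 3
    have := congrArg (algebraMap k (O k 2)) h
    rw [map_natCast, map_zero] at this
    push_cast at this
    linear_combination this
  rw [map_smul, dvg_deg, Nat.cast_ofNat, h3, Algebra.smul_def, mul_neg_one]

/-- The degree derivation in two variables has divergence 2 = −1, which is nonzero, so a constant
divergence can be corrected by a multiple of it. -/
lemma mem_CH_iff {D : W k 2} : D ∈ CH k ↔ ∃ c : k, dvg D = algebraMap k (O k 2) c := by
  constructor
  · intro h
    obtain ⟨E, hE, _, hF, rfl⟩ := Submodule.mem_sup.1 (show D ∈ (CH k).toSubmodule from h)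
    obtain ⟨c, rfl⟩ := Submodule.mem_span_singleton.1 hF
    refine ⟨-c, ?_⟩
    have hE : dvg E = 0 := hE
    rw [map_add, hE, dvg_smul_deg, zero_add, map_neg]
  · rintro ⟨c, hc⟩
    have h1 : D + c • deg k 2 ∈ H k := by
      change dvg _ = 0
      rw [map_add, hc, dvg_smul_deg, add_neg_cancel]
    have h2 : D = (D + c • deg k 2) + (-c) • deg k 2 := by module
    rw [h2]
    exact Submodule.add_mem_sup h1 (Submodule.mem_span_singleton.2 ⟨-c, rfl⟩)

end Cartan

/-! ### The centraliser of a nilpotent element and its radical -/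

namespace LieE6

open IntComb Cartan

/-- The monomial of `W(2; 1)` that corresponds to the `n`-th vector of an adapted basis, for
`17 ≤ n < 35`. -/
def wIndex (n : ℕ) : Fin 2 × ℕ × ℕ :=
  if n < 26 then (0, (n - 17) / 3, (n - 17) % 3) else (1, (n - 26) / 3, (n - 26) % 3)

/-- The part of degree `0`, in `W(2; 1)`, of a formal linear combination. -/
def zeroList (xs : List (ℤ × ℕ)) : List (ℤ × Fin 2 × ℕ × ℕ) :=
  IntComb.bind (fun l => if 17 ≤ l ∧ l < 35 then [(1, wIndex l)] else []) xs

/-- Degree 0 is compared with W(2;1) directly rather than through the models, whose correction terms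
in x₃∂₃ would have to be discarded. -/
lemma zeroList_spec : ∀ m ∈ List.range' 17 18, ∀ n ∈ List.range' 17 18,
    isZero (collect (wTrunc (zeroList (redConst m n) ++
      scale (-1) (wBracket (wIndex m) (wIndex n))))) = true := by
  decide +kernel

/-- The bracket of two vectors is a multiple of a third one. -/
def isMul (m n : ℕ) (c : ℤ) (l : ℕ) : Bool := isZero (collect ((-c, l) :: redConst m n))

/-- This is div(x^α ∂ᵢ) = αᵢ x^(α − εᵢ). A lowered exponent is never (2, 2), in accordance with the
absence of x₁²x₂²∂₃ among the eight vectors of degree 2. -/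
lemma lie_nil_spec : ∀ n ∈ List.range' 17 18, let t := wIndex n
    (low2 t.1 t.2).1 < 3 ∧ (low2 t.1 t.2).2 < 3 ∧ 3 * (low2 t.1 t.2).1 + (low2 t.1 t.2).2 < 8 ∧
    isMul n 0 (exp2 t.1 t.2) (3 * (low2 t.1 t.2).1 + (low2 t.1 t.2).2) = true := by
  decide +kernel

/-- The number of the vector of degree `0` that corresponds to `x^α ∂ᵢ`. -/
def wNumber (s : Σ _ : Fin 2, (Fin 2 → Fin 3)) : ℕ := 17 + 9 * s.1.1 + 3 * (s.2 0).1 + (s.2 1).1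

lemma exists_wNumber : ∀ n ∈ List.range' 17 18, ∃ s, wNumber s = n := by
  decide +kernel

lemma wNumber_bounds (s : Σ _ : Fin 2, (Fin 2 → Fin 3)) : 17 ≤ wNumber s ∧ wNumber s < 35 := by
  have h1 := s.1.2
  have h2 := (s.2 0).2
  have h3 := (s.2 1).2
  unfold wNumber
  omega

lemma wIndex_wNumber (s : Σ _ : Fin 2, (Fin 2 → Fin 3)) :
    wIndex (wNumber s) = (s.1, (s.2 0).1, (s.2 1).1) := by
  revert s
  decide +kernel

lemma deg_eq_zero_iff {n : ℕ} : deg n = 0 ↔ 17 ≤ n ∧ n < 35 := by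
  unfold deg
  split_ifs <;> norm_num <;> omega

lemma mem_range'_of_deg {n : ℕ} (h : deg n = 0) : n ∈ List.range' 17 18 := by
  rw [List.mem_range'_1]
  have := deg_eq_zero_iff.1 h
  omega

lemma deg_eq_two_iff {n : ℕ} : deg n = 2 ↔ n < 8 := by
  unfold deg
  split_ifs <;> norm_num <;> omega

variable {k : Type*} [Field k] {L : Type*}

section

variable [AddCommGroup L] [Module k L] {b : Module.Basis (Fin 78) k L}

variable (b) in
/-- The part of degree `2`, in `O(2; 1)`. -/
noncomputable def topPart : L →ₗ[k] O k 2 :=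
  b.constr k fun n => if n.1 < 8 then mon k ![n.1 / 3, n.1 % 3] else 0

lemma topPart_vec {n : ℕ} (hn : n < 8) : topPart b (vec b n) = mon k ![n / 3, n % 3] := by
  rw [vec, dif_pos (by omega), topPart, Module.Basis.constr_basis, if_pos hn]

lemma eq_zero_of_topPart {x : L} (hx : x ∈ Fil b 2) (h : topPart b x = 0) : x = 0 := by
  -- A left inverse of `topPart b` on degree 2. Its value at x₁²x₂² is irrelevant, since that
  -- monomial is not reached.
  let f : O k 2 →ₗ[k] L := (monBasis k 2).constr k fun α => vec b (3 * (α 0).1 + (α 1).1)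
  have h1 : Fil b 2 ≤ LinearMap.eqLocus (f ∘ₗ topPart b) LinearMap.id := by
    refine Fil_le fun n hn hd => ?_
    have hn8 : n < 8 := deg_eq_two_iff.1 (le_antisymm (deg_le n) hd)
    rw [LinearMap.mem_eqLocus, LinearMap.comp_apply, topPart_vec hn8]
    have : mon k ![n / 3, n % 3] = monBasis k 2 ![⟨n / 3, by omega⟩, ⟨n % 3, by omega⟩] := by
      rw [monBasis_apply]
      congr 1
      funext j
      fin_cases j <;> rfl
    rw [this, Module.Basis.constr_basis]
    change vec b (3 * (n / 3) + n % 3) = vec b n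
    rw [Nat.div_add_mod]
  have h2 := h1 hx
  rw [LinearMap.mem_eqLocus, LinearMap.comp_apply, h, map_zero] at h2
  exact h2.symm

lemma vec_zero_mem : vec b 0 ∈ Fil b 2 := vec_mem_Fil (by decide)

variable [CharP k 3]

variable (b) in
/-- The part of degree `0`, in `W(2; 1)`. -/
noncomputable def zeroPart : L →ₗ[k] W k 2 :=
  b.constr k fun n => if 17 ≤ n.1 ∧ n.1 < 35 then wmon k (wIndex n) else 0

lemma zeroPart_vec {n : ℕ} (hn : n < 78) :
    zeroPart b (vec b n) = if 17 ≤ n ∧ n < 35 then wmon k (wIndex n) else 0 := by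
  rw [vec, dif_pos hn, zeroPart, Module.Basis.constr_basis]

lemma zeroPart_eq_zero {x : L} (hx : x ∈ Fil b 1) : zeroPart b x = 0 := by
  have : Fil b 1 ≤ LinearMap.ker (zeroPart b) := Fil_le fun n hn hd => by
    rw [LinearMap.mem_ker, zeroPart_vec hn, if_neg]
    intro h
    have := deg_eq_zero_iff.2 h
    omega
  exact this hx

variable (b) in
/-- The section of `zeroPart`. -/
noncomputable def zeroLift : W k 2 →ₗ[k] L :=
  (vmonBasis k 2).constr k fun s => vec b (wNumber s)

lemma wmon_wNumber (s : Σ _ : Fin 2, (Fin 2 → Fin 3)) :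
    wmon k (wIndex (wNumber s)) = vmonBasis k 2 s := by
  obtain ⟨i, α⟩ := s
  rw [vmonBasis_apply, wIndex_wNumber, wmon]
  congr 1
  funext j
  fin_cases j <;> rfl

lemma zeroPart_zeroLift (D : W k 2) : zeroPart b (zeroLift b D) = D := by
  have : zeroPart b ∘ₗ zeroLift b = LinearMap.id := by
    refine (vmonBasis k 2).ext fun s => ?_
    rw [LinearMap.comp_apply, zeroLift, Module.Basis.constr_basis,
      zeroPart_vec ((wNumber_bounds s).2.trans (by norm_num)), if_pos (wNumber_bounds s),
      wmon_wNumber]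
    rfl
  exact LinearMap.congr_fun this D

lemma zeroLift_mem (D : W k 2) : zeroLift b D ∈ Fil b 0 := by
  rw [zeroLift, Module.Basis.constr_apply_fintype]
  exact Submodule.sum_mem _ fun s _ => Submodule.smul_mem _ _
    (vec_mem_Fil (deg_eq_zero_iff.2 (wNumber_bounds s)).ge)

lemma zeroLift_zeroPart {x : L} (hx : x ∈ Fil b 0) : zeroLift b (zeroPart b x) - x ∈ Fil b 1 := by
  have : Fil b 0 ≤ (Fil b 1).comap (zeroLift b ∘ₗ zeroPart b - LinearMap.id) := by
    refine Fil_le fun n hn hd => ?_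
    rw [Submodule.mem_comap, LinearMap.sub_apply, LinearMap.comp_apply, zeroPart_vec hn]
    split_ifs with h
    · obtain ⟨s, rfl⟩ := exists_wNumber n (by rw [List.mem_range'_1]; omega)
      rw [wmon_wNumber, zeroLift, Module.Basis.constr_basis, LinearMap.id_apply, sub_self]
      exact Submodule.zero_mem _
    · rw [map_zero, zero_sub]
      refine Submodule.neg_mem _ (vec_mem_Fil ?_)
      have := deg_eq_zero_iff.not.2 h
      omega
  exact this hx

lemma mem_Fil_one_of_zeroPart {x : L} (hx : x ∈ Fil b 0) (h : zeroPart b x = 0) :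
    x ∈ Fil b 1 := by
  have := zeroLift_zeroPart hx
  rwa [h, map_zero, zero_sub, neg_mem_iff] at this

end

variable [CharP k 3] [LieRing L] [LieAlgebra k L] {b : Module.Basis (Fin 78) k L}

lemma lie_vec_eq (hb : HasStructConst b) {m n l : ℕ} {c : ℤ} (hm : m < 78) (hn : n < 78)
    (h : isMul m n c l = true) : ⁅vec b m, vec b n⁆ = (c : k) • vec b l := by
  have := lc_eq_zero (k := k) (vec b) _ h
  rw [lc_collect, lc_cons, ← lie_vec hb hm hn] at this
  push_cast at this
  rw [neg_smul, neg_add_eq_zero] at this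
  exact this.symm

/-- Components of positive degree produce only positive degree, so the finite comparison in degree 0
decides; bilinearity is used one argument at a time. -/
lemma zeroPart_lie (hb : HasStructConst b) {x y : L} (hx : x ∈ Fil b 0) (hy : y ∈ Fil b 0) :
    zeroPart b ⁅x, y⁆ = ⁅zeroPart b x, zeroPart b y⁆ := by
  have key : ∀ m < 78, 0 ≤ deg m → ∀ n < 78, 0 ≤ deg n →
      zeroPart b ⁅vec b m, vec b n⁆ = ⁅zeroPart b (vec b m), zeroPart b (vec b n)⁆ := by
    intro m hm hm0 n hn hn0
    have hmem := lie_mem_Fil hb (vec_mem_Fil (b := b) (le_refl (deg m)))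
      (vec_mem_Fil (b := b) (le_refl (deg n)))
    by_cases hm1 : 1 ≤ deg m
    · rw [zeroPart_eq_zero (vec_mem_Fil hm1), zero_lie]
      exact zeroPart_eq_zero (Fil_anti (by omega) hmem)
    by_cases hn1 : 1 ≤ deg n
    · rw [zeroPart_eq_zero (vec_mem_Fil hn1), lie_zero]
      exact zeroPart_eq_zero (Fil_anti (by omega) hmem)
    have hm2 : deg m = 0 := by omega
    have hn2 : deg n = 0 := by omega
    have := lc_eq_zero (k := k) (wmon k) _
      (zeroList_spec m (mem_range'_of_deg hm2) n (mem_range'_of_deg hn2))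
    rw [lc_collect, lc_wTrunc, lc_append, lc_scale, ← lie_wmon] at this
    push_cast at this
    rw [neg_one_smul, add_neg_eq_zero] at this
    rw [zeroPart_vec hm, if_pos (deg_eq_zero_iff.1 hm2), zeroPart_vec hn,
      if_pos (deg_eq_zero_iff.1 hn2), ← this, lie_vec hb hm hn, map_lc, zeroList, lc_bind]
    refine lc_congr _ fun t ht => ?_
    rw [zeroPart_vec (redConst_lt hm hn t ht)]
    split_ifs <;> simp
  have h1 : ∀ m < 78, 0 ≤ deg m → ∀ y ∈ Fil b 0,
      zeroPart b ⁅vec b m, y⁆ = ⁅zeroPart b (vec b m), zeroPart b y⁆ := by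
    intro m hm hm0 y hy
    have : Fil b 0 ≤ LinearMap.eqLocus
        (zeroPart b ∘ₗ (LieAlgebra.ad k L (vec b m) : L →ₗ[k] L))
        ((LieAlgebra.ad k (W k 2) (zeroPart b (vec b m)) : W k 2 →ₗ[k] W k 2) ∘ₗ zeroPart b) :=
      Fil_le fun n hn hd => key m hm hm0 n hn hd
    exact this hy
  have : Fil b 0 ≤ LinearMap.eqLocus
      (zeroPart b ∘ₗ (LieAlgebra.ad k L y : L →ₗ[k] L))
      ((LieAlgebra.ad k (W k 2) (zeroPart b y) : W k 2 →ₗ[k] W k 2) ∘ₗ zeroPart b) := by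
    refine Fil_le fun n hn hd => ?_
    rw [LinearMap.mem_eqLocus]
    simp only [LinearMap.comp_apply, LieAlgebra.ad_apply]
    rw [← lie_skew, map_neg, h1 n hn hd y hy, lie_skew]
  have h2 := this hx
  rw [LinearMap.mem_eqLocus] at h2
  simp only [LinearMap.comp_apply, LieAlgebra.ad_apply] at h2
  rw [← lie_skew, map_neg, h2, lie_skew]

/-- The source of H(2;1) and CH(2;1): modulo identifications [D, ∂₃] = div(D)∂₃, because the model
of D carries the correction −div(D)x₃∂₃. No error terms arise, as degree 2 is the top degree. -/
lemma topPart_lie_nil (hb : HasStructConst b) {x : L} (hx : x ∈ Fil b 0) :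
    topPart b ⁅x, vec b 0⁆ = dvg (zeroPart b x) := by
  have : Fil b 0 ≤ LinearMap.eqLocus
      (topPart b ∘ₗ (LieAlgebra.ad k L (vec b 0) : L →ₗ[k] L)) (-(dvg ∘ₗ zeroPart b)) := by
    refine Fil_le fun n hn hd => ?_
    rw [LinearMap.mem_eqLocus]
    simp only [LinearMap.comp_apply, LieAlgebra.ad_apply, LinearMap.neg_apply]
    rw [← lie_skew, map_neg, neg_inj]
    by_cases h0 : deg n = 0
    · obtain ⟨s1, s2, s3, s4⟩ := lie_nil_spec n (mem_range'_of_deg h0)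
      rw [lie_vec_eq hb hn (by norm_num) s4, map_smul, topPart_vec s3, zeroPart_vec hn,
        if_pos (deg_eq_zero_iff.1 h0), wmon, dvg_vmon, vec_exp2, ← vec_low2, Int.cast_natCast,
        Nat.mul_add_mod, Nat.mod_eq_of_lt s2, Nat.mul_add_div (by norm_num), Nat.div_eq_of_lt s2,
        add_zero]
    · have := lie_mem_Fil hb (vec_mem_Fil (b := b) (le_refl (deg n)))
        (vec_mem_Fil (b := b) (show 2 ≤ deg 0 by decide))
      rw [Fil_eq_bot (by omega), Submodule.mem_bot] at this
      rw [this, map_zero, zeroPart_eq_zero (vec_mem_Fil (by omega)), map_zero]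
  have h2 := this hx
  rw [LinearMap.mem_eqLocus] at h2
  simp only [LinearMap.comp_apply, LieAlgebra.ad_apply, LinearMap.neg_apply] at h2
  rw [← lie_skew, map_neg, h2, neg_neg]

lemma centralizer_le (hb : HasStructConst b) {x : L} (hx : ⁅x, vec b 0⁆ = 0) : x ∈ Fil b 0 :=
  mem_Fil_of_lie_nil hb le_rfl (by rw [hx]; exact Submodule.zero_mem _) (by norm_num)

lemma lie_nil_eq_zero (hb : HasStructConst b) {x : L} (hx : x ∈ Fil b 1) : ⁅x, vec b 0⁆ = 0 := by
  have := lie_mem_Fil hb hx (vec_zero_mem (b := b))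
  rwa [Fil_eq_bot (by norm_num), Submodule.mem_bot] at this

lemma lie_nil_eq_smul_iff (hb : HasStructConst b) {x : L} (hx : x ∈ Fil b 0) (c : k) :
    ⁅x, vec b 0⁆ = c • vec b 0 ↔ dvg (zeroPart b x) = algebraMap k (O k 2) c := by
  have h1 : topPart b (c • vec b 0) = algebraMap k (O k 2) c := by
    have : (![0 / 3, 0 % 3] : Fin 2 → ℕ) = 0 := by decide
    rw [map_smul, topPart_vec (by norm_num), this, mon_zero, Algebra.algebraMap_eq_smul_one]
  rw [← topPart_lie_nil hb hx]
  constructor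
  · intro h
    rw [h, h1]
  · intro h
    refine sub_eq_zero.1 (eq_zero_of_topPart (b := b) (Submodule.sub_mem _ ?_
      (Submodule.smul_mem _ _ vec_zero_mem)) (by rw [map_sub, h, h1, sub_self]))
    simpa using lie_mem_Fil hb hx (vec_zero_mem (b := b))

end LieE6

/-! ### Radicals of subalgebras between the centraliser and its normaliser -/

namespace LieE6

open IntComb Cartan

/-- Descent in a two-parameter array of coefficients: the coefficient at `(i, j)` has the number
`3 * i + j`, and `N n x` means that the `n`-th coefficient of `x` vanishes. -/
lemma exists_lowest {α : Type*} (J : α → Prop) (N : ℕ → α → Prop)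
    (h1 : ∀ x, J x → ∃ y, J y ∧ ∀ n ≤ 8, (N n y ↔ (n + 1) % 3 = 0 ∨ N (n + 1) x))
    (h3 : ∀ x, J x → ∃ y, J y ∧ ∀ n ≤ 8, (N n y ↔ 6 ≤ n ∨ N (n + 3) x)) {x : α} (hx : J x)
    (hN : ∃ n ≤ 8, ¬N n x) : ∃ z, J z ∧ ¬N 0 z ∧ ∀ n ≤ 8, 0 < n → N n z := by
  have main : ∀ n : ℕ, ∀ x, J x → n ≤ 8 → ¬N n x → (∀ l ≤ 8, n < l → N l x) →
      ∃ z, J z ∧ ¬N 0 z ∧ ∀ n ≤ 8, 0 < n → N n z := by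
    intro n
    induction n using Nat.strong_induction_on with
    | _ n ih =>
      intro x hx hn8 hn hl
      rcases Nat.eq_zero_or_pos n with rfl | hpos
      · exact ⟨x, hx, hn, hl⟩
      -- Write the greatest surviving number as n = 3i + j. For j = 0 the first derivative lowers it
      -- to n − 3, otherwise the second one to n − 1; the factor i or j is 1 or 2, hence invertible.
      by_cases hmod : n % 3 = 0
      · obtain ⟨y, hy, hyN⟩ := h3 x hx
        refine ih (n - 3) (by omega) y hy (by omega) ?_ fun l hl8 hnl => ?_
        · rw [hyN _ (by omega), show n - 3 + 3 = n by omega]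
          simp only [not_or]
          exact ⟨by omega, hn⟩
        · rw [hyN l hl8]
          by_cases h6 : 6 ≤ l
          · exact Or.inl h6
          · exact Or.inr (hl _ (by omega) (by omega))
      · obtain ⟨y, hy, hyN⟩ := h1 x hx
        refine ih (n - 1) (by omega) y hy (by omega) ?_ fun l hl8 hnl => ?_
        · rw [hyN _ (by omega), show n - 1 + 1 = n by omega]
          simp only [not_or]
          exact ⟨hmod, hn⟩
        · rw [hyN l hl8]
          by_cases h6 : l = 8
          · exact Or.inl (by rw [h6])
          · exact Or.inr (hl _ (by omega) (by omega))
  classical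
  obtain ⟨n, hn, hnN⟩ := hN
  have hs := Nat.findGreatest_spec (P := fun n => ¬N n x) hn hnN
  refine main _ x hx (Nat.findGreatest_le 8) hs fun l hl8 hl => ?_
  by_contra h
  exact Nat.findGreatest_is_greatest hl hl8 h

/-- The vectors from 17, 26 and 35 on are three arrays of nine, on which brackets with the vectors
17 and 26 act as the two partial derivatives up to sign. When the exponent cannot be raised the
multiple is divisible by 3, and the index in the conditional is a placeholder. -/
lemma lower_spec : ∀ a ∈ [17, 26, 35], ∀ n ∈ List.range 9,
    (isPivot (if (n + 1) % 3 = 0 then a + n else a + n + 1) [(1, 26, a + n)] (-(n + 1 : ℕ)) &&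
    isPivot (if 6 ≤ n then a + n else a + n + 3) [(1, 17, a + n)] (-(n / 3 + 1 : ℕ)) &&
    (deg (a + n) == deg a)) = true := by
  decide +kernel

variable {k : Type*} [Field k] [CharP k 3] {L : Type*}
variable [LieRing L] [LieAlgebra k L] {b : Module.Basis (Fin 78) k L}

lemma natCast_ne_zero {n : ℕ} (h : n % 3 ≠ 0) : (n : k) ≠ 0 := by
  have := (intCast_eq_zero (k := k) (n := (n : ℤ))).not.2 (by omega)
  simpa using this

lemma lower_aux {a c m l g : ℕ} {q : Prop} [Decidable q] (hb : HasStructConst b)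
    (h : isPivot (if q then l else m) [(1, g, l)] (-(c : ℤ)) = true) (hl : deg l = deg a)
    (hm : ¬q → deg m = deg a) (hc : q ↔ c % 3 = 0) {x : L} (hx : x ∈ Fil b (deg a)) :
    co b l ⁅x, vec b g⁆ = 0 ↔ q ∨ co b m x = 0 := by
  have := pivotMap_eq hb h (x := x) (by split_ifs with hq <;> simpa [hl, hm, hq] using hx)
  rw [pivotMap_cons, pivotMap, List.map_nil, List.sum_nil] at this
  simp only [Int.cast_one, one_mul, LinearMap.zero_apply, add_zero] at this
  rw [this]
  push_cast
  by_cases hq : q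
  · have h0 : (c : k) = 0 := by
      have := (intCast_eq_zero (k := k) (n := (c : ℤ))).2 (by have := hc.1 hq; omega)
      simpa using this
    simp [h0, hq]
  · have h0 : (c : k) ≠ 0 := natCast_ne_zero (hc.not.1 hq)
    simp [h0, hq]

lemma lower_one (hb : HasStructConst b) {a n : ℕ} (ha : a ∈ [17, 26, 35]) (hn : n ≤ 8) {x : L}
    (hx : x ∈ Fil b (deg a)) :
    co b (a + n) ⁅x, vec b 26⁆ = 0 ↔ (n + 1) % 3 = 0 ∨ co b (a + (n + 1)) x = 0 := by
  have h1 := lower_spec a ha n (List.mem_range.2 (by omega))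
  simp only [Bool.and_eq_true, beq_iff_eq] at h1
  refine lower_aux hb h1.1.1 h1.2 (fun hq => ?_) Iff.rfl hx
  have h2 := lower_spec a ha (n + 1) (List.mem_range.2 (by omega))
  simp only [Bool.and_eq_true, beq_iff_eq] at h2
  exact h2.2

lemma lower_three (hb : HasStructConst b) {a n : ℕ} (ha : a ∈ [17, 26, 35]) (hn : n ≤ 8) {x : L}
    (hx : x ∈ Fil b (deg a)) :
    co b (a + n) ⁅x, vec b 17⁆ = 0 ↔ 6 ≤ n ∨ co b (a + (n + 3)) x = 0 := by
  have h1 := lower_spec a ha n (List.mem_range.2 (by omega))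
  simp only [Bool.and_eq_true, beq_iff_eq] at h1
  refine lower_aux hb h1.1.2 h1.2 (fun hq => ?_) (by omega) hx
  have h2 := lower_spec a ha (n + 3) (List.mem_range.2 (by omega))
  simp only [Bool.and_eq_true, beq_iff_eq] at h2
  exact h2.2

lemma isMul_spec : (isMul 17 29 1 26 && isMul 26 29 0 0 && isMul 17 18 0 0 && isMul 26 18 1 17 &&
    isMul 17 32 (-1) 29 && isMul 18 0 0 0 && isMul 29 0 0 0 && isMul 32 0 0 0 && isMul 17 0 0 0 &&
    isMul 26 0 0 0) = true := by
  decide +kernel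

/-- A subspace of the part of degree `0` that is stable under the centraliser and abelian modulo
the part of degree `1` is contained in the part of degree `1`. -/
lemma le_Fil_one_of_abelian (hb : HasStructConst b) {J : Submodule k L} (h0 : J ≤ Fil b 0)
    (h1 : Fil b 1 ≤ J) (hJ : ∀ x ∈ J, ∀ y, ⁅y, vec b 0⁆ = 0 → ⁅x, y⁆ ∈ J)
    (hab : ∀ x ∈ J, ∀ y ∈ J, ⁅x, y⁆ ∈ Fil b 1) : J ≤ Fil b 1 := by
  have sp := isMul_spec
  simp only [Bool.and_eq_true] at sp
  obtain ⟨⟨⟨⟨⟨⟨⟨⟨⟨s1, s2⟩, s3⟩, s4⟩, s5⟩, z1⟩, z2⟩, z3⟩, z4⟩, z5⟩ := sp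
  have e1 := lie_vec_eq hb (by norm_num) (by norm_num) s1
  have e2 := lie_vec_eq hb (by norm_num) (by norm_num) s2
  have e3 := lie_vec_eq hb (by norm_num) (by norm_num) s3
  have e4 := lie_vec_eq hb (by norm_num) (by norm_num) s4
  have e5 := lie_vec_eq hb (by norm_num) (by norm_num) s5
  have c1 := lie_vec_eq hb (by norm_num) (by norm_num) z1
  have c2 := lie_vec_eq hb (by norm_num) (by norm_num) z2
  have c3 := lie_vec_eq hb (by norm_num) (by norm_num) z3
  have c4 := lie_vec_eq hb (by norm_num) (by norm_num) z4
  have c5 := lie_vec_eq hb (by norm_num) (by norm_num) z5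
  simp only [Int.cast_zero, zero_smul, Int.cast_one, one_smul] at e1 e2 e3 e4 c1 c2 c3 c4 c5
  intro x hx
  by_contra hx1
  have hne : ∃ n ≤ 8, ¬(co b (17 + n) x = 0 ∧ co b (26 + n) x = 0) := by
    by_contra! h
    refine hx1 (mem_Fil_succ (j := 0) (h0 hx) fun m hm hd => ?_)
    obtain ⟨m1, m2⟩ := deg_eq_zero_iff.1 hd
    by_cases h26 : m < 26
    · have := (h (m - 17) (by omega)).1
      rwa [show 17 + (m - 17) = m by omega] at this
    · have := (h (m - 26) (by omega)).2
      rwa [show 26 + (m - 26) = m by omega] at this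
  have d17 : deg 17 = 0 := rfl
  have d26 : deg 26 = 0 := rfl
  -- Differentiation by ∂₁ and ∂₂, both in the centraliser, leads to an element of J that is a
  -- nonzero combination of ∂₁ and ∂₂ modulo Fil 1.
  obtain ⟨z, hz, hz0, hzn⟩ := exists_lowest (fun x => x ∈ J)
    (fun n x => co b (17 + n) x = 0 ∧ co b (26 + n) x = 0)
    (fun x hx => ⟨_, hJ x hx _ c5, fun n hn => by
      rw [lower_one hb (by simp) hn (d17 ▸ h0 hx), lower_one hb (by simp) hn (d26 ▸ h0 hx)]
      tauto⟩)
    (fun x hx => ⟨_, hJ x hx _ c4, fun n hn => by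
      rw [lower_three hb (by simp) hn (d17 ▸ h0 hx), lower_three hb (by simp) hn (d26 ▸ h0 hx)]
      tauto⟩) hx hne
  have hw : co b 17 z • vec b 17 + co b 26 z • vec b 26 ∈ J := by
    have : z - (co b 17 z • vec b 17 + co b 26 z • vec b 26) ∈ Fil b (0 + 1) := by
      refine mem_Fil_succ (Submodule.sub_mem _ (h0 hz) (Submodule.add_mem _
        (Submodule.smul_mem _ _ (vec_mem_Fil (by decide)))
        (Submodule.smul_mem _ _ (vec_mem_Fil (by decide))))) fun m hm hd => ?_
      rw [map_sub, map_add, map_smul, map_smul, co_vec (by norm_num), co_vec (by norm_num)]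
      obtain ⟨m1, m2⟩ := deg_eq_zero_iff.1 hd
      by_cases h17 : m = 17
      · subst h17; simp
      by_cases h26 : m = 26
      · subst h26; simp
      have h0 : co b m z = 0 := by
        by_cases hlt : m < 26
        · have := (hzn (m - 17) (by omega) (by omega)).1
          rwa [show 17 + (m - 17) = m by omega] at this
        · have := (hzn (m - 26) (by omega) (by omega)).2
          rwa [show 26 + (m - 26) = m by omega] at this
      rw [h0, if_neg (Ne.symm h17), if_neg (Ne.symm h26)]
      simp
    have := J.sub_mem hz (h1 this)
    rwa [sub_sub_cancel] at this
  -- Brackets with x₁∂₂ and x₂∂₁ (the vectors 29 and 18), both of divergence zero, separate the two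
  -- summands and put ∂₁ into J.
  have w1 := hJ _ hw _ c2
  have w2 := hJ _ hw _ c1
  rw [add_lie, smul_lie, smul_lie, e1, e2, smul_zero, add_zero] at w1
  rw [add_lie, smul_lie, smul_lie, e3, e4, smul_zero, zero_add] at w2
  have h17 : vec b 17 ∈ J := by
    by_cases h : co b 26 z = 0
    · have ha : co b 17 z ≠ 0 := fun h' => hz0 ⟨h', h⟩
      have := hJ _ ((J.smul_mem_iff ha).1 w1) _ c1
      rwa [e4] at this
    · exact (J.smul_mem_iff h).1 w2
  -- From [∂₁, x₁²∂₂] = −x₁∂₂ it follows that x₁∂₂ lies in J, but [∂₁, x₁∂₂] = ∂₂ is not in Fil 1,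
  -- contrary to the hypothesis on brackets in J.
  have h29 := hJ _ h17 _ c3
  rw [e5, J.smul_mem_iff (by simp)] at h29
  have := hab _ h17 _ h29
  rw [e1] at this
  have := co_eq_zero this (n := 26) (by decide)
  rw [co_vec (by norm_num)] at this
  simp at this

/-- An ideal of a subalgebra. -/
def idealOf (M : LieSubalgebra k L) (V : Submodule k L) (h : ∀ x ∈ M, ∀ v ∈ V, ⁅x, v⁆ ∈ V) :
    LieIdeal k M where
  toSubmodule := V.comap M.toSubmodule.subtype
  lie_mem {x y} hy := h x x.2 y hy

lemma mem_idealOf {M : LieSubalgebra k L} {V : Submodule k L}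
    {h : ∀ x ∈ M, ∀ v ∈ V, ⁅x, v⁆ ∈ V} {x : M} : x ∈ idealOf M V h ↔ x.1 ∈ V := Iff.rfl

lemma lie_mem_Fil_one (hb : HasStructConst b) {M : LieSubalgebra k L}
    (hM : M.toSubmodule ≤ Fil b 0) : ∀ x ∈ M, ∀ v ∈ Fil b 1, ⁅x, v⁆ ∈ Fil b 1 :=
  fun x hx _ hv => lie_mem_Fil hb (hM hx) hv

/-- One argument covers 𝔤_e, 𝔫_e and 𝔴. Modulo Fil 1 a member of the derived series of the radical
whose successor is zero would be an abelian ideal stable under 𝔤_e, hence zero by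
`le_Fil_one_of_abelian`. -/
lemma radical_eq (hb : HasStructConst b) {M : LieSubalgebra k L} (hM : M.toSubmodule ≤ Fil b 0)
    (hc : ∀ y, ⁅y, vec b 0⁆ = 0 → y ∈ M) :
    LieAlgebra.radical k M = idealOf M (Fil b 1) (lie_mem_Fil_one hb hM) := by
  have : Module.Finite k L := Module.Finite.of_basis b
  set I := idealOf M (Fil b 1) (lie_mem_Fil_one hb hM) with hI
  apply le_antisymm
  · obtain ⟨l, hl⟩ := (LieAlgebra.IsSolvable.solvable (R := k) (L := LieAlgebra.radical k M))
    rw [LieIdeal.derivedSeries_eq_bot_iff] at hl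
    -- Descent along the derived series of the radical, from the zero term back to the radical
    -- itself.
    have main : ∀ l, LieAlgebra.derivedSeriesOfIdeal k M l (LieAlgebra.radical k M) ≤ I →
        LieAlgebra.radical k M ≤ I := by
      intro l
      induction l with
      | zero => exact fun h => h
      | succ l ih =>
        intro h
        refine ih ?_
        set D := LieAlgebra.derivedSeriesOfIdeal k M l (LieAlgebra.radical k M)
        rw [LieAlgebra.derivedSeriesOfIdeal_succ] at h
        have key := le_Fil_one_of_abelian hb
          (J := D.toSubmodule.map M.toSubmodule.subtype ⊔ Fil b 1) (sup_le ?_ (Fil_anti (by norm_num)))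
          le_sup_right ?_ ?_
        · intro x hx
          rw [hI, mem_idealOf]
          exact key (Submodule.mem_sup_left ⟨x, hx, rfl⟩)
        · rintro _ ⟨x, -, rfl⟩
          exact hM x.2
        · intro x hx y hy
          obtain ⟨_, ⟨u, hu, rfl⟩, v, hv, rfl⟩ := Submodule.mem_sup.1 hx
          rw [add_lie]
          refine Submodule.add_mem_sup ⟨_, lie_mem_left k M D u ⟨y, hc y hy⟩ hu, rfl⟩ ?_
          simpa using lie_mem_Fil hb hv (hM (hc y hy))
        · intro x hx y hy
          obtain ⟨_, ⟨u, hu, rfl⟩, v, hv, rfl⟩ := Submodule.mem_sup.1 hx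
          obtain ⟨_, ⟨u', hu', rfl⟩, v', hv', rfl⟩ := Submodule.mem_sup.1 hy
          rw [add_lie, lie_add]
          refine Submodule.add_mem _ (Submodule.add_mem _ ?_ ?_) ?_
          · exact h (LieSubmodule.lie_mem_lie hu hu')
          · simpa using lie_mem_Fil hb (hM u.2) hv'
          · have : (M.toSubmodule.subtype u' : L) + v' ∈ Fil b 0 :=
              Submodule.add_mem _ (hM u'.2) (Fil_anti (by norm_num) hv')
            simpa using lie_mem_Fil hb hv this
    exact main l (by rw [hl]; exact bot_le)
  · rw [← LieAlgebra.LieIdeal.solvable_iff_le_radical]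
    -- Two steps suffice: [Fil 1, Fil 1] ⊆ Fil 2 and [Fil 2, Fil 2] ⊆ Fil 4 = 0.
    refine LieAlgebra.IsSolvable.mk (R := k) (k := 2) ?_
    rw [LieIdeal.derivedSeries_eq_bot_iff]
    have h1 : LieAlgebra.derivedSeriesOfIdeal k M 1 I ≤
        idealOf M (Fil b 2) (fun x hx v hv => by simpa using lie_mem_Fil hb (hM hx) hv) := by
      rw [LieAlgebra.derivedSeriesOfIdeal_succ, LieAlgebra.derivedSeriesOfIdeal_zero,
        LieSubmodule.lieIdeal_oper_eq_span, LieSubmodule.lieSpan_le]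
      rintro _ ⟨x, y, rfl⟩
      exact lie_mem_Fil hb x.2 y.2
    rw [LieAlgebra.derivedSeriesOfIdeal_succ, eq_bot_iff, LieSubmodule.lieIdeal_oper_eq_span,
      LieSubmodule.lieSpan_le]
    rintro _ ⟨x, y, rfl⟩
    have := lie_mem_Fil hb (h1 x.2) (h1 y.2)
    rw [Fil_eq_bot (by norm_num), Submodule.mem_bot] at this
    exact Subtype.ext this

lemma rad_eq (hb : HasStructConst b) {M : LieSubalgebra k L} (hM : M.toSubmodule ≤ Fil b 0)
    (hc : ∀ y, ⁅y, vec b 0⁆ = 0 → y ∈ M) : LieSub.rad M = Fil b 1 := by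
  rw [LieSub.rad, radical_eq hb hM hc]
  refine le_antisymm ?_ fun x hx => ?_
  · rintro _ ⟨x, hx, rfl⟩
    exact hx
  · exact ⟨⟨x, hc x (lie_nil_eq_zero hb hx)⟩, hx, rfl⟩

/-- The part of degree `0`, as a homomorphism of Lie algebras to `W(2; 1)`. -/
noncomputable def zeroHom (hb : HasStructConst b) (M : LieSubalgebra k L)
    (hM : M.toSubmodule ≤ Fil b 0) : M →ₗ⁅k⁆ W k 2 :=
  { zeroPart b ∘ₗ M.toSubmodule.subtype with
    map_lie' := fun {x y} => zeroPart_lie hb (hM x.2) (hM y.2) }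

lemma zeroHom_apply (hb : HasStructConst b) (M : LieSubalgebra k L)
    (hM : M.toSubmodule ≤ Fil b 0) (x : M) : zeroHom hb M hM x = zeroPart b x.1 := rfl

/-- The part of degree 0 is a homomorphism with kernel Fil 1, that is, the radical, and `hQ`
together with the section `zeroLift` determines its image. It is applied with Q = H(2;1), CH(2;1)
and the whole of W(2;1). -/
lemma nonempty_quotient_equiv (hb : HasStructConst b) {M : LieSubalgebra k L}
    (hM : M.toSubmodule ≤ Fil b 0) (hc : ∀ y, ⁅y, vec b 0⁆ = 0 → y ∈ M)
    {Q : LieSubalgebra k (W k 2)} (hQ : ∀ x ∈ Fil b 0, x ∈ M ↔ zeroPart b x ∈ Q) :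
    Nonempty ((M ⧸ LieAlgebra.radical k M) ≃ₗ⁅k⁆ Q) := by
  have h1 : LieAlgebra.radical k M = (zeroHom hb M hM).ker := by
    rw [radical_eq hb hM hc]
    ext x
    rw [mem_idealOf, LieHom.mem_ker, zeroHom_apply]
    exact ⟨fun h => zeroPart_eq_zero h, fun h => mem_Fil_one_of_zeroPart (hM x.2) h⟩
  have h2 : (zeroHom hb M hM).range = Q := by
    ext D
    rw [LieHom.mem_range]
    constructor
    · rintro ⟨x, rfl⟩
      rw [zeroHom_apply]
      exact (hQ x (hM x.2)).1 x.2
    · intro hD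
      refine ⟨⟨zeroLift b D, (hQ _ (zeroLift_mem D)).2 ?_⟩, ?_⟩
      · rwa [zeroPart_zeroLift]
      · rw [zeroHom_apply, zeroPart_zeroLift]
  rw [h1, ← h2]
  exact ⟨(zeroHom hb M hM).quotKerEquivRange⟩

/-! ### The centraliser, the normalisers and the transporter in terms of degrees. -/

lemma mem_centralizer_iff (hb : HasStructConst b) {x : L} (hx : x ∈ Fil b 0) :
    x ∈ LieSub.centralizer k (vec b 0) ↔ zeroPart b x ∈ H k := by
  change ⁅x, vec b 0⁆ = 0 ↔ dvg _ = 0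
  have := lie_nil_eq_smul_iff hb hx 0
  rwa [zero_smul, map_zero] at this

lemma mem_normalizer_nil_iff (x : L) :
    x ∈ LieSub.normalizer (k ∙ vec b 0) ↔ ∃ c : k, ⁅x, vec b 0⁆ = c • vec b 0 := by
  constructor
  · intro h
    obtain ⟨c, hc⟩ := Submodule.mem_span_singleton.1 (h _ (Submodule.mem_span_singleton_self _))
    exact ⟨c, hc.symm⟩
  · rintro ⟨c, hc⟩ v hv
    obtain ⟨d, rfl⟩ := Submodule.mem_span_singleton.1 hv
    rw [lie_smul, hc, smul_comm]
    exact Submodule.smul_mem _ _ (Submodule.smul_mem _ _ (Submodule.mem_span_singleton_self _))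

lemma normalizer_nil_le (hb : HasStructConst b) :
    (LieSub.normalizer (k ∙ vec b 0)).toSubmodule ≤ Fil b 0 := by
  intro x hx
  obtain ⟨c, hc⟩ := (mem_normalizer_nil_iff x).1 hx
  exact mem_Fil_of_lie_nil hb le_rfl (by rw [hc]; exact Submodule.smul_mem _ _ vec_zero_mem)
    (by norm_num)

lemma mem_normalizer_iff (hb : HasStructConst b) {x : L} (hx : x ∈ Fil b 0) :
    x ∈ LieSub.normalizer (k ∙ vec b 0) ↔ zeroPart b x ∈ CH k := by
  rw [mem_normalizer_nil_iff, mem_CH_iff]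
  exact exists_congr fun c => lie_nil_eq_smul_iff hb hx c

/-- As e lies in Fil 1, the bracket with e alone forces degree at least −1; brackets with degree 1
then eliminate degree −1. The transporter is treated in the same way, one degree lower. -/
lemma normalizer_Fil_one (hb : HasStructConst b) :
    (LieSub.normalizer (Fil b 1)).toSubmodule = Fil b 0 := by
  refine le_antisymm (fun x hx => ?_) fun x hx v hv => by simpa using lie_mem_Fil hb hx hv
  have hx : ∀ v ∈ Fil b 1, ⁅x, v⁆ ∈ Fil b 1 := hx
  have h1 : x ∈ Fil b (-1) := mem_Fil_of_lie_nil (i := 1) hb (by norm_num)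
    (hx _ (Fil_anti (by norm_num) vec_zero_mem)) (by norm_num)
  exact mem_Fil_succ_of_lie_one hb (by norm_num) (by norm_num) h1 hx

lemma transporter_Fil_one (hb : HasStructConst b) :
    LieSub.transporter (Fil b 1) (LieSub.normalizer (Fil b 1)) = Fil b (-1) := by
  have hw : ∀ x, x ∈ LieSub.normalizer (Fil b 1) ↔ x ∈ Fil b 0 := fun x => by
    rw [← normalizer_Fil_one hb]; rfl
  refine le_antisymm (fun x hx => ?_) fun x hx v hv =>
    (hw _).2 (by simpa using lie_mem_Fil hb hx hv)
  have hx : ∀ v ∈ Fil b 1, ⁅x, v⁆ ∈ Fil b 0 := fun v hv => (hw _).1 (hx v hv)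
  have h1 : x ∈ Fil b (-2) := mem_Fil_of_lie_nil (i := 0) hb (by norm_num)
    (hx _ (Fil_anti (by norm_num) vec_zero_mem)) (by norm_num)
  exact mem_Fil_succ_of_lie_one hb (by norm_num) (by norm_num) h1 hx

lemma finrank_Fil_one : Module.finrank k (Fil b 1) = 17 := by
  have h : Fil b 1 = Submodule.span k (Set.range fun n : Fin 17 => vec b n) := by
    refine le_antisymm (Fil_le fun n hn hd => Submodule.subset_span ⟨⟨n, ?_⟩, rfl⟩) ?_
    · revert hd
      unfold deg
      split_ifs <;> omega
    · rw [Submodule.span_le]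
      rintro _ ⟨n, rfl⟩
      have : ∀ n : Fin 17, 1 ≤ deg n := by decide
      exact vec_mem_Fil (this n)
  have hli : LinearIndependent k fun n : Fin 17 => vec b n := by
    have := b.linearIndependent.comp (Fin.castLE (by norm_num : 17 ≤ 78))
      (Fin.castLE_injective _)
    convert this using 1
    funext n
    exact vec_val b (Fin.castLE (by norm_num : 17 ≤ 78) n)
  rw [h, finrank_span_eq_card hli, Fintype.card_fin]

end LieE6

/-! ### Maximality, irreducibility and simplicity -/

namespace LieE6

open IntComb Cartan

/-- The `l`-th vector is, modulo vectors of higher degree, the linear combination of brackets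
given by a list of triples `(c, m, n)`. -/
def isLead (l : ℕ) (ts : List (ℤ × ℕ × ℕ)) : Bool :=
  ts.all (fun t => Nat.blt t.2.1 78 && Nat.blt t.2.2 78) && isZero (lowPart (deg l + 1)
    (collect ((-1, l) :: ts.flatMap fun t => scale t.1 (redConst t.2.1 t.2.2))))

/-- Every d(x₁ⁱx₂ʲx₃) other than the one with i = j = 2 is a partial derivative of one with a larger
exponent; ∂₁ is needed only for j = 2. The factors 1 and 2 are their own inverses modulo 3. -/
lemma descend_spec : ∀ n ∈ List.range 8, isLead (35 + n) (if (n + 1) % 3 = 0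
    then [((n / 3 + 1 : ℕ), 17, 35 + (n + 3))] else [(((n + 1) % 3 : ℕ), 26, 35 + (n + 1))]) =
    true := by
  decide +kernel

/-- The first two entries climb from dx₃ over d(x₁²x₃) to d(x₁²x₂²x₃) by fields of degree 0. The
others produce ∂₂, ∂₁, dx₂ and ∂₃ from degree −1, for use with ideals. -/
lemma ascend_spec : (isLead 41 [(-1, 33, 35)] && isLead 43 [(1, 22, 41)] &&
    isLead 26 [(1, 35, 11)] && isLead 17 [(-1, 35, 9)] && isLead 9 [(-1, 36, 0)] &&
    isLead 0 [(-1, 9, 11)]) = true := by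
  decide +kernel

/-- The vectors of degree at most `-2`, as linear combinations of brackets with vectors of
degree `-1`, modulo vectors of higher degree. -/
def negTable : List (List (ℤ × ℕ × ℕ)) :=
  [[(1, 36, 35)], [(-1, 37, 35)], [(1, 37, 36)], [(1, 38, 36), (-1, 39, 35)],
  [(1, 38, 37), (-1, 39, 36)], [(1, 40, 36)], [(1, 39, 38)], [(-1, 40, 38)], [(1, 43, 36)],
  [(-1, 38, 35)], [(1, 38, 36), (1, 39, 35)], [(-1, 39, 36)], [(1, 41, 35)],
  [(1, 39, 38), (1, 41, 36)], [(1, 42, 36)], [(-1, 41, 38)], [(-1, 42, 38)], [(-1, 43, 38)],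
  [(1, 47, 35)], [(1, 48, 35)], [(1, 49, 35)], [(-1, 50, 35)], [(-1, 51, 35)], [(-1, 52, 35)],
  [(1, 60, 35)], [(-1, 61, 35)], [(-1, 63, 35)], [(-1, 64, 35)], [(-1, 65, 35)], [(-1, 66, 35)],
  [(-1, 67, 35)], [(-1, 68, 35)], [(-1, 69, 35)], [(-1, 69, 36)]]

/-- The negative part of the graded algebra is generated by degree −1, as required of a Weisfeiler
filtration. -/
lemma negTable_spec : ∀ l ∈ List.range' 44 34, isLead l (negTable.getD (l - 44) []) = true ∧
    ∀ t ∈ negTable.getD (l - 44) [], deg t.2.1 = deg l + 1 ∧ deg t.2.2 = -1 := by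
  decide +kernel

lemma redConst_eight : ∀ n ∈ List.range 78, isZero (redConst 8 n) = true := by
  decide +kernel

variable {k : Type*} [Field k] [CharP k 3] {L : Type*}
variable [LieRing L] [LieAlgebra k L] {b : Module.Basis (Fin 78) k L}

lemma vec_mem_of_isLead (hb : HasStructConst b) {l : ℕ} {ts : List (ℤ × ℕ × ℕ)}
    (h : isLead l ts = true) {V : Submodule k L} (hV : Fil b (deg l + 1) ≤ V)
    (ht : ∀ t ∈ ts, ⁅vec b t.2.1, vec b t.2.2⁆ ∈ V) : vec b l ∈ V := by
  simp only [isLead, Bool.and_eq_true, List.all_eq_true, Nat.blt_eq] at h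
  obtain ⟨h1, h2⟩ := h
  have h3 := hV (lc_mem_Fil (b := b) h2)
  rw [lc_collect, lc_cons] at h3
  have h4 : lc k (vec b) (ts.flatMap fun t => scale t.1 (redConst t.2.1 t.2.2)) ∈ V := by
    clear h2 h3
    induction ts with
    | nil => simp
    | cons t ts ih =>
      rw [List.flatMap_cons, lc_append, lc_scale, ← lie_vec hb (h1 t (by simp)).1
        (h1 t (by simp)).2]
      exact V.add_mem (V.smul_mem _ (ht t (by simp))) (ih (fun s hs => ht s (by simp [hs]))
        fun s hs => h1 s (by simp [hs]))
  have h5 := V.sub_mem h3 h4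
  rw [add_sub_cancel_right] at h5
  push_cast at h5
  rwa [neg_one_smul, neg_mem_iff] at h5

/-- A subspace that contains the part of degree `0`, is stable under it, and contains an element
of degree `-1`, contains the part of degree `-1`. -/
lemma Fil_neg_one_le (hb : HasStructConst b) {U : Submodule k L} (h0 : Fil b 0 ≤ U)
    (hU : ∀ x ∈ Fil b 0, ∀ u ∈ U, ⁅x, u⁆ ∈ U) {x : L} (hx : x ∈ U) (hx1 : x ∈ Fil b (-1))
    (hx0 : x ∉ Fil b 0) : Fil b (-1) ≤ U := by
  have hdeg : ∀ n : ℕ, deg n = -1 ↔ 35 ≤ n ∧ n < 44 := by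
    intro n
    unfold deg
    split_ifs <;> norm_num <;> omega
  have sp := ascend_spec
  simp only [Bool.and_eq_true] at sp
  obtain ⟨⟨⟨⟨⟨s1, s2⟩, -⟩, -⟩, -⟩, -⟩ := sp
  have hne : ∃ n ≤ 8, ¬co b (35 + n) x = 0 := by
    by_contra! h
    refine hx0 (mem_Fil_succ (j := -1) hx1 fun m hm hd => ?_)
    obtain ⟨m1, m2⟩ := (hdeg m).1 hd
    have := h (m - 35) (by omega)
    rwa [show 35 + (m - 35) = m by omega] at this
  have hlie : ∀ x ∈ U, x ∈ Fil b (-1) → ∀ y ∈ Fil b 0, ⁅x, y⁆ ∈ U ∧ ⁅x, y⁆ ∈ Fil b (-1) := by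
    intro x hx hx1 y hy
    refine ⟨?_, by simpa using lie_mem_Fil hb hx1 hy⟩
    rw [← lie_skew]
    exact U.neg_mem (hU y hy x hx)
  -- Differentiation by ∂₁ and ∂₂ brings the element down to a nonzero multiple of dx₃ modulo Fil 0.
  obtain ⟨z, ⟨hz, hz1⟩, hz0, hzn⟩ := exists_lowest (fun x => x ∈ U ∧ x ∈ Fil b (-1))
    (fun n x => co b (35 + n) x = 0)
    (fun x hx => ⟨_, hlie x hx.1 hx.2 _ (vec_mem_Fil (n := 26) (by decide)), fun n hn =>
      lower_one hb (by simp) hn hx.2⟩)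
    (fun x hx => ⟨_, hlie x hx.1 hx.2 _ (vec_mem_Fil (n := 17) (by decide)), fun n hn =>
      lower_three hb (by simp) hn hx.2⟩) ⟨hx, hx1⟩ hne
  have h35 : vec b 35 ∈ U := by
    have h1 : z - co b 35 z • vec b 35 ∈ Fil b (-1 + 1) := by
      refine mem_Fil_succ (Submodule.sub_mem _ hz1
        (Submodule.smul_mem _ _ (vec_mem_Fil (by decide)))) fun m hm hd => ?_
      rw [map_sub, map_smul, co_vec (by norm_num)]
      obtain ⟨m1, m2⟩ := (hdeg m).1 hd
      by_cases h : m = 35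
      · subst h; simp
      · have := hzn (m - 35) (by omega) (by omega)
        rw [show 35 + (m - 35) = m by omega] at this
        rw [this, if_neg (Ne.symm h)]
        simp
    have := U.sub_mem hz (h0 h1)
    rw [sub_sub_cancel] at this
    exact (U.smul_mem_iff hz0).1 this
  -- From dx₃ two fields of degree 0 reach the vector with the largest exponents, from which the
  -- others are obtained by differentiation.
  have h41 : vec b 41 ∈ U := vec_mem_of_isLead hb s1 h0 (by
    rintro t ht
    rw [List.mem_singleton] at ht
    subst ht
    exact hU _ (vec_mem_Fil (by decide)) _ h35)
  have h43 : vec b 43 ∈ U := vec_mem_of_isLead hb s2 h0 (by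
    rintro t ht
    rw [List.mem_singleton] at ht
    subst ht
    exact hU _ (vec_mem_Fil (by decide)) _ h41)
  have hall : ∀ i n : ℕ, n + i = 8 → vec b (35 + n) ∈ U := by
    intro i
    induction i using Nat.strong_induction_on with
    | _ i ih =>
      intro n hn
      rcases Nat.eq_zero_or_pos i with rfl | hi
      · obtain rfl : n = 8 := by omega
        exact h43
      · have hd : deg (35 + n) = -1 := (hdeg _).2 (by omega)
        refine vec_mem_of_isLead hb (descend_spec n (List.mem_range.2 (by omega)))
          (by rw [hd]; exact h0) ?_
        intro t ht
        split_ifs at ht with hm <;> rw [List.mem_singleton] at ht <;> subst ht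
        · exact hU _ (vec_mem_Fil (n := 17) (by decide)) _
            (ih (i - 3) (by omega) (n + 3) (by omega))
        · exact hU _ (vec_mem_Fil (n := 26) (by decide)) _
            (ih (i - 1) (by omega) (n + 1) (by omega))
  refine Fil_le fun n hn hd => ?_
  rcases (by omega : deg n = -1 ∨ 0 ≤ deg n) with h | h
  · obtain ⟨m1, m2⟩ := (hdeg n).1 h
    have := hall (8 - (n - 35)) (n - 35) (by omega)
    rwa [show 35 + (n - 35) = n by omega] at this
  · exact h0 (vec_mem_Fil h)

/-- A subspace stable under the part of degree `1` that is not contained in the part of degree `0`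
contains an element of degree `-1`. -/
lemma exists_mem_Fil_neg_one (hb : HasStructConst b) {V : Submodule k L}
    (hV : ∀ x ∈ V, ∀ y ∈ Fil b 1, ⁅x, y⁆ ∈ V) {x : L} (hx : x ∈ V) (hx0 : x ∉ Fil b 0) :
    ∃ y ∈ V, y ∈ Fil b (-1) ∧ y ∉ Fil b 0 := by
  have step : ∀ x ∈ V, x ∉ Fil b 0 → x ∈ Fil b (-2) → ∃ y ∈ V, y ∈ Fil b (-1) ∧ y ∉ Fil b 0 := by
    intro x hx hx0 hx2
    by_cases h1 : x ∈ Fil b (-1)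
    · exact ⟨x, hx, h1, hx0⟩
    · have : ∃ y ∈ Fil b 1, ⁅x, y⁆ ∉ Fil b 0 := by
        by_contra! h
        exact h1 (mem_Fil_succ_of_lie_one hb (by norm_num) (by norm_num) hx2 h)
      obtain ⟨y, hy, hxy⟩ := this
      exact ⟨_, hV x hx y hy, by simpa using lie_mem_Fil hb hx2 hy, hxy⟩
  by_cases h2 : x ∈ Fil b (-2)
  · exact step x hx hx0 h2
  -- The bracket with e raises degrees by 2, so it lies in Fil (−2); were it in Fil 0, the element
  -- itself would lie in Fil (−2).
  · refine step _ (hV x hx _ (Fil_anti (by norm_num) (vec_zero_mem (b := b)))) (fun h => h2 ?_) ?_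
    · exact mem_Fil_of_lie_nil hb (i := 0) (by norm_num) h (by norm_num)
    · have : x ∈ Fil b (-4) := by rw [Fil_eq_top le_rfl]; trivial
      simpa using lie_mem_Fil hb this (vec_zero_mem (b := b))

/-! ### Maximality, the centre and ideals. -/

lemma eq_top_of_vec_mem {V : Submodule k L} (h : ∀ n < 78, vec b n ∈ V) : V = ⊤ := by
  rw [eq_top_iff, ← Fil_eq_top (b := b) (le_refl (-4))]
  exact Fil_le fun n hn _ => h n hn

lemma eq_top_of_Fil_neg_one_le (hb : HasStructConst b) {M : LieSubalgebra k L}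
    (h : Fil b (-1) ≤ M.toSubmodule) : M = ⊤ := by
  have : M.toSubmodule = ⊤ := by
    refine eq_top_of_vec_mem (b := b) fun n hn => rec_induction (P := fun n => vec b n ∈ M) ?_ ?_ hn
    · intro g hg
      have : ∀ g ∈ generators, -1 ≤ deg g := by decide
      exact h (vec_mem_Fil (this g hg))
    · intro r hr h1 h2
      rw [vec_eq_lie hb hr]
      exact M.smul_mem _ (M.lie_mem h1 h2)
  rw [← LieSubalgebra.toSubmodule_inj, this]
  rfl

lemma isCoatom_of_eq_Fil (hb : HasStructConst b) {M : LieSubalgebra k L}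
    (hM : M.toSubmodule = Fil b 0) : IsCoatom M := by
  constructor
  · rintro rfl
    have h : vec b 35 ∈ Fil b 0 := hM ▸ Submodule.mem_top
    have := co_eq_zero h (n := 35) (by decide)
    rw [co_vec (by norm_num)] at this
    simp at this
  · intro N hN
    obtain ⟨x, hx, hx0⟩ := SetLike.exists_of_lt hN
    have hle : Fil b 0 ≤ N.toSubmodule := hM ▸ (LieSubalgebra.toSubmodule_le_toSubmodule M N).2 hN.le
    have hx0 : x ∉ Fil b 0 := hM ▸ hx0
    obtain ⟨y, hy, hy1, hy0⟩ := exists_mem_Fil_neg_one hb (V := N.toSubmodule)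
      (fun x hx y hy => N.lie_mem hx (hle (Fil_anti (by norm_num) hy))) hx hx0
    exact eq_top_of_Fil_neg_one_le hb (Fil_neg_one_le hb hle
      (fun x hx u hu => N.lie_mem (hle hx) hu) hy hy1 hy0)

lemma lie_eight (hb : HasStructConst b) (x : L) : ⁅vec b 8, x⁆ = 0 := by
  have : x ∈ Fil b (-4) := by rw [Fil_eq_top le_rfl]; trivial
  have h : Fil b (-4) ≤ LinearMap.ker (LieAlgebra.ad k L (vec b 8) : L →ₗ[k] L) :=
    Fil_le fun n hn _ => by
      rw [LinearMap.mem_ker, LieAlgebra.ad_apply, lie_vec hb (by norm_num) hn]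
      exact lc_eq_zero _ _ (redConst_eight n (List.mem_range.2 hn))
  exact h this

lemma deg_eight : deg 8 = 1 := rfl

/-- Detection by brackets with the part of degree `-1`, modulo the centre. -/
lemma exists_sub_mem_Fil (hb : HasStructConst b) {j : ℤ} (hj : 0 ≤ j) {x : L} (hx : x ∈ Fil b j)
    (h : ∀ y ∈ Fil b (-1), ⁅x, y⁆ ∈ Fil b j ⊔ k ∙ vec b 8) :
    ∃ c : k, (j ≠ 1 → c = 0) ∧ x - c • vec b 8 ∈ Fil b (j + 1) := by
  have key : ∀ m < 78, deg m = j → m ≠ 8 → co b m x = 0 := by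
    intro m hm hd h8
    refine co_eq_zero_of_lie_low hb hj hx (fun y hy l hl hl8 => ?_) hm hd h8
    obtain ⟨u, hu, v, hv, huv⟩ := Submodule.mem_sup.1 (h y hy)
    obtain ⟨c, rfl⟩ := Submodule.mem_span_singleton.1 hv
    rw [← huv, map_add, map_smul, co_eq_zero hu (by omega), co_vec (by norm_num),
      if_neg (Ne.symm hl8), smul_zero, add_zero]
  by_cases h1 : j = 1
  · refine ⟨co b 8 x, fun h => absurd h1 h, mem_Fil_succ (Submodule.sub_mem _ hx
      (Submodule.smul_mem _ _ (vec_mem_Fil (by rw [h1]; decide)))) fun m hm hd => ?_⟩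
    rw [map_sub, map_smul, co_vec (by norm_num)]
    by_cases h8 : m = 8
    · subst h8; simp
    · rw [key m hm hd h8, if_neg (Ne.symm h8)]
      simp
  · refine ⟨0, fun _ => rfl, ?_⟩
    rw [zero_smul, sub_zero]
    refine mem_Fil_succ hx fun m hm hd => key m hm hd ?_
    rintro rfl
    exact h1 (hd ▸ deg_eight)

/-- Transitivity is applied three times: an ideal inside Fil 0 lies in Fil 1, then modulo the centre
in Fil 2, then modulo the centre in Fil 3 = 0. The central vector of degree 1 causes the correction
terms. -/
lemma le_span_of_le_Fil_zero (hb : HasStructConst b) {I : Submodule k L}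
    (hI : ∀ x ∈ I, ∀ y, ⁅x, y⁆ ∈ I) (h0 : I ≤ Fil b 0) : I ≤ k ∙ vec b 8 := by
  have h1 : I ≤ Fil b 1 := fun x hx => by
    obtain ⟨c, hc, h⟩ := exists_sub_mem_Fil hb le_rfl (h0 hx) fun y _ =>
      Submodule.mem_sup_left (h0 (hI x hx y))
    rwa [hc (by norm_num), zero_smul, sub_zero] at h
  intro x hx
  have h2 : ∀ x ∈ I, ∃ c : k, x - c • vec b 8 ∈ Fil b 2 := fun x hx => by
    obtain ⟨c, -, h⟩ := exists_sub_mem_Fil hb zero_le_one (h1 hx) fun y _ =>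
      Submodule.mem_sup_left (h1 (hI x hx y))
    exact ⟨c, h⟩
  obtain ⟨c, hc⟩ := h2 x hx
  obtain ⟨d, hd, h⟩ := exists_sub_mem_Fil hb zero_le_two hc fun y _ => by
    obtain ⟨a, ha⟩ := h2 _ (hI x hx y)
    rw [sub_lie, smul_lie, lie_eight hb, smul_zero, sub_zero]
    rw [← sub_add_cancel ⁅x, y⁆ (a • vec b 8)]
    exact Submodule.add_mem_sup ha (Submodule.smul_mem _ _ (Submodule.mem_span_singleton_self _))
  rw [hd (by norm_num), zero_smul, sub_zero, Fil_eq_bot (by norm_num), Submodule.mem_bot,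
    sub_eq_zero] at h
  rw [h]
  exact Submodule.smul_mem _ _ (Submodule.mem_span_singleton_self _)

/-- The centre is an ideal contained in 𝔤_e, hence in Fil 0, so the preceding lemma bounds it. -/
lemma center_eq (hb : HasStructConst b) :
    (LieAlgebra.center k L).toSubmodule = k ∙ vec b 8 := by
  apply le_antisymm
  · refine le_span_of_le_Fil_zero hb (fun x hx y => ?_) fun x hx => ?_
    · have : ⁅x, y⁆ = 0 := by rw [← lie_skew, hx y, neg_zero]
      rw [this]
      exact Submodule.zero_mem _
    · exact centralizer_le hb (by rw [← lie_skew, hx, neg_zero])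
  · rw [Submodule.span_singleton_le_iff_mem]
    intro y
    rw [← lie_skew, lie_eight hb, neg_zero]

/-- An ideal that is not contained in the centre is everything. -/
lemma eq_top_of_ideal (hb : HasStructConst b) {I : Submodule k L}
    (hI : ∀ x ∈ I, ∀ y, ⁅x, y⁆ ∈ I) (hz : ¬I ≤ k ∙ vec b 8) : I = ⊤ := by
  have h0 : ¬I ≤ Fil b 0 := fun h => hz (le_span_of_le_Fil_zero hb hI h)
  have hI' : ∀ x, ∀ y ∈ I, ⁅x, y⁆ ∈ I := fun x y hy => by
    rw [← lie_skew]
    exact I.neg_mem (hI y hy x)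
  obtain ⟨x, hx, hx0⟩ := SetLike.not_le_iff_exists.1 h0
  obtain ⟨y, hy, hy1, hy0⟩ := exists_mem_Fil_neg_one hb (V := I) (fun x hx y _ => hI x hx y) hx hx0
  have h1 : Fil b (-1) ≤ I ⊔ Fil b 0 := by
    refine Fil_neg_one_le hb le_sup_right (fun x hx u hu => ?_) (Submodule.mem_sup_left hy) hy1 hy0
    obtain ⟨v, hv, w, hw, rfl⟩ := Submodule.mem_sup.1 hu
    rw [lie_add]
    exact Submodule.add_mem_sup (hI' x v hv) (by simpa using lie_mem_Fil hb hx hw)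
  -- The vector is in I up to terms of higher degree. This property passes to brackets when one
  -- factor has it, because I is an ideal.
  set P : ℕ → Prop := fun n => vec b n ∈ I ⊔ Fil b (deg n + 1) with hP
  have hl : ∀ {m n : ℕ}, P m → ⁅vec b m, vec b n⁆ ∈ I ⊔ Fil b (deg m + deg n + 1) := by
    intro m n hm
    obtain ⟨v, hv, w, hw, hvw⟩ := Submodule.mem_sup.1 hm
    rw [← hvw, add_lie]
    refine Submodule.add_mem_sup (hI v hv _) ?_
    have := lie_mem_Fil hb hw (vec_mem_Fil (b := b) (le_refl (deg n)))
    rwa [show deg m + 1 + deg n = deg m + deg n + 1 by ring] at this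
  have hs : ∀ {l m n : ℕ} {c : ℤ}, isLead l [(c, m, n)] = true → deg l = deg m + deg n → P m →
      P l := by
    intro l m n c h hd hm
    refine vec_mem_of_isLead hb h le_sup_right fun t ht => ?_
    rw [List.mem_singleton] at ht
    subst ht
    rw [hd]
    exact hl hm
  have hg : ∀ n, deg n = -1 → P n := fun n hn => by
    rw [hP]
    beta_reduce
    rw [hn]
    exact h1 (vec_mem_Fil hn.ge)
  have sp := ascend_spec
  simp only [Bool.and_eq_true] at sp
  obtain ⟨⟨⟨⟨⟨-, -⟩, s1⟩, s2⟩, s3⟩, s4⟩ := sp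
  have hall : ∀ n < 78, P n := by
    intro n hn
    refine rec_induction (P := P) (fun g hg' => ?_) (fun r hr h1 _ => ?_) hn
    · simp only [generators, List.mem_cons, List.not_mem_nil, or_false] at hg'
      rcases hg' with rfl | rfl | rfl | rfl
      · exact hs s4 (by decide) (hs s3 (by decide) (hg 36 (by decide)))
      · exact hs s2 (by decide) (hg 35 (by decide))
      · exact hs s1 (by decide) (hg 35 (by decide))
      · exact hg 43 (by decide)
    · rw [hP]
      beta_reduce
      rw [vec_eq_lie hb hr, (recTable_spec r hr).2.2.2]
      exact Submodule.smul_mem _ _ (hl h1)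
  -- The error terms are pushed up one degree at a time, until they vanish in Fil 3 = 0, which is n
  -- = 7.
  have hle : ∀ n : ℕ, ⊤ ≤ I ⊔ Fil b ((n : ℤ) - 4) := by
    intro n
    induction n with
    | zero => exact le_trans (Fil_eq_top (b := b) (by norm_num)).ge le_sup_right
    | succ n ih =>
      refine ih.trans (sup_le le_sup_left (Fil_le fun m hm hd => ?_))
      push_cast
      rw [show (n : ℤ) + 1 - 4 = n - 4 + 1 by ring]
      exact sup_le_sup_left (Fil_anti (by omega)) I (hall m hm)
  have := hle 7
  rw [Fil_eq_bot (by norm_num), sup_bot_eq] at this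
  exact top_le_iff.1 this

lemma Fil_neg_le (hb : HasStructConst b) {j : ℤ} (hj : j ≤ -2) :
    Fil b j ≤ Submodule.span k {z | ∃ x ∈ Fil b (j + 1), ∃ v ∈ Fil b (-1), ⁅x, v⁆ = z} ⊔
      Fil b (j + 1) := by
  refine Fil_le fun n hn hd => ?_
  rcases (by omega : deg n = j ∨ j + 1 ≤ deg n) with h | h
  · have hn' : n ∈ List.range' 44 34 := by
      rw [List.mem_range'_1]
      refine ⟨?_, by omega⟩
      by_contra hlt
      have : ∀ n < 44, -1 ≤ deg n := by decide
      have := this n (by omega)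
      omega
    obtain ⟨s1, s2⟩ := negTable_spec n hn'
    refine vec_mem_of_isLead hb s1 (by rw [h]; exact le_sup_right) fun t ht => ?_
    obtain ⟨d1, d2⟩ := s2 t ht
    exact Submodule.mem_sup_left (Submodule.subset_span
      ⟨_, vec_mem_Fil (by omega), _, vec_mem_Fil d2.ge, rfl⟩)
  · exact Submodule.mem_sup_right (vec_mem_Fil h)

end LieE6

/-! ### The Weisfeiler filtration of the quotient by the centre -/

namespace LieE6

open IntComb Cartan

variable {k : Type*} [Field k] {L : Type*}
variable [LieRing L] [LieAlgebra k L] {b : Module.Basis (Fin 78) k L}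

variable (k L) in
/-- The projection onto the quotient by the centre. -/
noncomputable abbrev centerProj : L →ₗ⁅k⁆ L ⧸ LieAlgebra.center k L :=
  LieSub.proj (LieAlgebra.center k L)

lemma centerProj_surjective : Function.Surjective (centerProj k L) :=
  Submodule.mkQ_surjective _

variable (b) in
/-- The image of the filtration in the quotient by the centre. -/
noncomputable def barFil (j : ℤ) : Submodule k (L ⧸ LieAlgebra.center k L) :=
  (Fil b j).map (centerProj k L : L →ₗ[k] L ⧸ LieAlgebra.center k L)

lemma proj_mem_barFil {j : ℤ} {x : L} (hx : x ∈ Fil b j) : centerProj k L x ∈ barFil b j :=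
  Submodule.mem_map_of_mem hx

lemma span_eight_le {j : ℤ} (hj : j ≤ 1) : k ∙ vec b 8 ≤ Fil b j := by
  rw [Submodule.span_singleton_le_iff_mem]
  exact vec_mem_Fil hj

lemma barFil_anti {i j : ℤ} (h : i ≤ j) : barFil b j ≤ barFil b i := Submodule.map_mono (Fil_anti h)

lemma vec_zero_not_mem : vec b 0 ∉ k ∙ vec b 8 := by
  intro h
  obtain ⟨c, hc⟩ := Submodule.mem_span_singleton.1 h
  have := congrArg (co b 0) hc
  rw [map_smul, co_vec (by norm_num), co_vec (by norm_num)] at this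
  simp at this

lemma vec_not_mem_Fil {n : ℕ} (hn : n < 78) {j : ℤ} (h : deg n < j) : vec b n ∉ Fil b j := by
  intro hm
  have := co_eq_zero hm h
  rw [co_vec hn, if_pos rfl] at this
  exact one_ne_zero this

lemma map_toSubmodule {M : LieSubalgebra k L} : (M.map (centerProj k L)).toSubmodule =
    M.toSubmodule.map (centerProj k L : L →ₗ[k] L ⧸ LieAlgebra.center k L) := rfl

variable [CharP k 3]

lemma centerProj_eq_zero_iff (hb : HasStructConst b) {x : L} :
    centerProj k L x = 0 ↔ x ∈ k ∙ vec b 8 := by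
  rw [← center_eq hb]
  exact Submodule.Quotient.mk_eq_zero _

lemma mem_of_proj_mem_barFil (hb : HasStructConst b) {j : ℤ} {x : L}
    (hx : centerProj k L x ∈ barFil b j) : x ∈ Fil b j ⊔ k ∙ vec b 8 := by
  obtain ⟨y, hy, hyx⟩ := hx
  have hyx : centerProj k L y = centerProj k L x := hyx
  have : x - y ∈ k ∙ vec b 8 := by
    rw [← centerProj_eq_zero_iff hb, map_sub, hyx, sub_self]
  have h := Submodule.add_mem_sup hy this
  rwa [add_sub_cancel] at h

/-- The central vector has degree 1, so for j ≤ 1 the kernel of the projection lies inside Fil j; in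
degree 2 this fails. -/
lemma proj_mem_barFil_iff (hb : HasStructConst b) {j : ℤ} (hj : j ≤ 1) {x : L} :
    centerProj k L x ∈ barFil b j ↔ x ∈ Fil b j :=
  ⟨fun h => (sup_le le_rfl (span_eight_le hj) : Fil b j ⊔ k ∙ vec b 8 ≤ Fil b j)
    (mem_of_proj_mem_barFil hb h), proj_mem_barFil⟩

lemma lie_mem_barFil (hb : HasStructConst b) {i j : ℤ} {x y : L ⧸ LieAlgebra.center k L}
    (hx : x ∈ barFil b i) (hy : y ∈ barFil b j) : ⁅x, y⁆ ∈ barFil b (i + j) := by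
  obtain ⟨x, hx, rfl⟩ := hx
  obtain ⟨y, hy, rfl⟩ := hy
  have := proj_mem_barFil (lie_mem_Fil hb hx hy)
  rwa [LieHom.map_lie] at this

lemma isSimple_quotient (hb : HasStructConst b) :
    LieAlgebra.IsSimple k (L ⧸ LieAlgebra.center k L) where
  eq_bot_or_eq_top I := by
    have hI : ∀ x ∈ I.toSubmodule.comap (centerProj k L : L →ₗ[k] L ⧸ LieAlgebra.center k L),
        ∀ y, ⁅x, y⁆ ∈ I.toSubmodule.comap (centerProj k L : L →ₗ[k] L ⧸ LieAlgebra.center k L) := by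
      intro x hx y
      change centerProj k L ⁅x, y⁆ ∈ I
      rw [LieHom.map_lie]
      exact lie_mem_left k _ I _ _ hx
    by_cases h : I.toSubmodule.comap (centerProj k L : L →ₗ[k] L ⧸ LieAlgebra.center k L) ≤
        k ∙ vec b 8
    · left
      rw [eq_bot_iff]
      intro x hx
      obtain ⟨y, rfl⟩ := centerProj_surjective x
      rw [LieSubmodule.mem_bot]
      exact (centerProj_eq_zero_iff hb).2 (h hx)
    · right
      have := eq_top_of_ideal hb hI h
      rw [eq_top_iff]
      rintro x -
      obtain ⟨y, rfl⟩ := centerProj_surjective x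
      have hy : y ∈ I.toSubmodule.comap
          (centerProj k L : L →ₗ[k] L ⧸ LieAlgebra.center k L) := this ▸ Submodule.mem_top
      exact hy
  non_abelian h := by
    -- The bracket [∂₁, x₁∂₂] = ∂₂ has degree 0 and so is not in the centre, which sits in degree 1.
    have sp := isMul_spec
    simp only [Bool.and_eq_true] at sp
    have e := lie_vec_eq hb (by norm_num) (by norm_num) sp.1.1.1.1.1.1.1.1.1
    have h0 := h.trivial (centerProj k L (vec b 17)) (centerProj k L (vec b 29))
    rw [← LieHom.map_lie, e, Int.cast_one, one_smul] at h0
    have h1 : vec b 26 ∈ Fil b 1 := span_eight_le le_rfl ((centerProj_eq_zero_iff hb).1 h0)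
    exact vec_not_mem_Fil (by norm_num) (by decide) h1

lemma isWeisfeilerPair {M : LieSubalgebra k L} (hM : M.toSubmodule = Fil b 0)
    (hb : HasStructConst b) :
    Weisfeiler.IsWeisfeilerPair (M.map (centerProj k L)) (barFil b (-1)) := by
  have hmem : ∀ x, x ∈ M.map (centerProj k L) ↔ x ∈ barFil b 0 := by
    intro x
    rw [barFil, ← hM]
    exact Iff.rfl
  have hsub : (M.map (centerProj k L)).toSubmodule = barFil b 0 := by
    rw [map_toSubmodule, hM]; rfl
  have : Module.Finite k L := Module.Finite.of_basis b
  have : Module.Finite k (L ⧸ LieAlgebra.center k L) :=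
    Module.Finite.of_surjective (centerProj k L : L →ₗ[k] L ⧸ LieAlgebra.center k L)
      centerProj_surjective
  refine ⟨isSimple_quotient hb, ?_, ?_, ?_, ?_, ?_⟩
  · have hcomap : ∀ N : LieSubalgebra k (L ⧸ LieAlgebra.center k L),
        M.map (centerProj k L) ≤ N → M ≤ N.comap (centerProj k L) :=
      fun N h x hx => h ⟨x, hx, rfl⟩
    constructor
    · intro h
      have : centerProj k L (vec b 35) ∈ barFil b 0 := by
        rw [← hmem, h]
        trivial
      rw [proj_mem_barFil_iff hb (by norm_num)] at this
      exact vec_not_mem_Fil (by norm_num) (by decide) this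
    · intro N hN
      have hlt : M < N.comap (centerProj k L) := by
        refine lt_of_le_of_ne (hcomap N hN.le) fun h => ?_
        obtain ⟨x, hx, hx0⟩ := SetLike.exists_of_lt hN
        obtain ⟨y, rfl⟩ := centerProj_surjective x
        exact hx0 ⟨y, h ▸ hx, rfl⟩
      have htop := (isCoatom_of_eq_Fil hb hM).2 _ hlt
      rw [eq_top_iff]
      rintro x -
      obtain ⟨y, rfl⟩ := centerProj_surjective x
      have hy : y ∈ N.comap (centerProj k L) := htop ▸ LieSubalgebra.mem_top y
      exact hy
  · intro h
    -- The part of degree 2 is an abelian ideal, as Fil 4 = 0, and contains the nonzero image of e.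
    have hI : ∀ x ∈ M.map (centerProj k L), ∀ v ∈ barFil b 2, ⁅x, v⁆ ∈ barFil b 2 :=
      fun x hx v hv => by simpa using lie_mem_barFil hb ((hmem x).1 hx) hv
    have hab : IsLieAbelian (idealOf (M.map (centerProj k L)) (barFil b 2) hI) := by
      refine ⟨fun x y => ?_⟩
      have := lie_mem_barFil hb x.2 y.2
      rw [barFil, Fil_eq_bot (by norm_num), Submodule.map_bot, Submodule.mem_bot] at this
      exact Subtype.ext (Subtype.ext this)
    have hle : idealOf (M.map (centerProj k L)) (barFil b 2) hI ≤
        LieAlgebra.radical k (M.map (centerProj k L)) := by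
      rw [← LieAlgebra.LieIdeal.solvable_iff_le_radical]
      infer_instance
    rw [h] at hle
    have hv : centerProj k L (vec b 0) ∈ M.map (centerProj k L) :=
      (hmem _).2 (proj_mem_barFil (vec_mem_Fil (by decide)))
    have h0 := hle (show (⟨_, hv⟩ : M.map (centerProj k L)) ∈ _ from proj_mem_barFil vec_zero_mem)
    rw [LieSubmodule.mem_bot] at h0
    exact vec_zero_not_mem ((centerProj_eq_zero_iff hb).1 (congrArg Subtype.val h0))
  · rw [hsub]
    refine lt_of_le_of_ne (barFil_anti (by norm_num)) fun h => ?_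
    have : centerProj k L (vec b 35) ∈ barFil b 0 := h ▸ proj_mem_barFil (vec_mem_Fil (by decide))
    rw [proj_mem_barFil_iff hb (by norm_num)] at this
    exact vec_not_mem_Fil (by norm_num) (by decide) this
  · intro x hx v hv
    simpa using lie_mem_barFil hb ((hmem x).1 hx) hv
  · intro U h0 hU hinv
    rw [hsub] at h0 ⊢
    by_cases hle : U ≤ barFil b 0
    · exact Or.inl (le_antisymm hle h0)
    · right
      obtain ⟨x, hx, hx0⟩ := SetLike.not_le_iff_exists.1 hle
      obtain ⟨y, rfl⟩ := centerProj_surjective x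
      have key := Fil_neg_one_le hb
        (U := U.comap (centerProj k L : L →ₗ[k] L ⧸ LieAlgebra.center k L))
        (fun z hz => h0 (proj_mem_barFil hz)) (fun z hz u hu => by
          change centerProj k L ⁅z, u⁆ ∈ U
          rw [LieHom.map_lie]
          exact hinv _ ((hmem _).2 (proj_mem_barFil hz)) _ hu) hx
        ((proj_mem_barFil_iff hb (by norm_num)).1 (hU hx))
        (fun h => hx0 (proj_mem_barFil h))
      exact le_antisymm hU (Submodule.map_le_iff_le_comap.2 key)

/-- Upwards this is transitivity modulo the centre, downwards generation of the negative part by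
degree −1. -/
lemma fil_eq {M : LieSubalgebra k L} (hM : M.toSubmodule = Fil b 0) (hb : HasStructConst b)
    (i : ℤ) :
    Weisfeiler.fil (M.map (centerProj k L)) (barFil b (-1)) i = barFil b i := by
  rcases i with n | n
  · induction n with
    | zero =>
      change (M.map (centerProj k L)).toSubmodule = _
      rw [map_toSubmodule, hM]; rfl
    | succ n ih =>
      change Weisfeiler.stab _ (Weisfeiler.fil _ _ (Int.ofNat n)) = _
      rw [ih]
      have hn : Int.ofNat (n + 1) = (n : ℤ) + 1 := rfl
      have hn' : Int.ofNat n = (n : ℤ) := rfl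
      rw [hn, hn']
      refine le_antisymm ?_ fun x hx => ⟨barFil_anti (by omega) hx, fun v hv => by
        simpa using lie_mem_barFil hb hx hv⟩
      rintro _ ⟨⟨x, hx, rfl⟩, hv⟩
      -- Brackets are known only in the quotient, so x moves up one step after subtraction of a
      -- central element, which the projection does not see.
      obtain ⟨c, -, hc⟩ := exists_sub_mem_Fil hb (Int.natCast_nonneg n) hx fun y hy => by
        refine mem_of_proj_mem_barFil hb ?_
        rw [LieHom.map_lie]
        exact hv _ (proj_mem_barFil hy)
      have h8 : centerProj k L (vec b 8) = 0 :=
        (centerProj_eq_zero_iff hb).2 (Submodule.mem_span_singleton_self _)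
      have := proj_mem_barFil hc
      rw [map_sub, map_smul, h8, smul_zero, sub_zero] at this
      exact this
  · induction n with
    | zero => rfl
    | succ n ih =>
      change Submodule.span k {z | ∃ x ∈ Weisfeiler.fil (M.map (centerProj k L)) (barFil b (-1))
        (Int.negSucc n), ∃ v ∈ barFil b (-1), ⁅x, v⁆ = z} ⊔
        Weisfeiler.fil (M.map (centerProj k L)) (barFil b (-1)) (Int.negSucc n) = _
      rw [ih]
      have hn : Int.negSucc n = Int.negSucc (n + 1) + 1 := by omega
      rw [hn]
      apply le_antisymm
      · refine sup_le (Submodule.span_le.2 ?_) (barFil_anti (by omega))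
        rintro _ ⟨x, hx, v, hv, rfl⟩
        simpa using lie_mem_barFil hb hx hv
      · rw [barFil, Submodule.map_le_iff_le_comap]
        refine (Fil_neg_le hb (by omega)).trans (sup_le (Submodule.span_le.2 ?_) ?_)
        · rintro _ ⟨x, hx, v, hv, rfl⟩
          have e : (centerProj k L : L →ₗ[k] L ⧸ LieAlgebra.center k L) ⁅x, v⁆ =
            ⁅centerProj k L x, centerProj k L v⁆ := LieHom.map_lie _ _ _
          rw [SetLike.mem_coe, Submodule.mem_comap, e]
          exact Submodule.mem_sup_left (Submodule.subset_span
            ⟨_, proj_mem_barFil hx, _, proj_mem_barFil hv, rfl⟩)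
        · exact fun x hx => Submodule.mem_sup_right (proj_mem_barFil hx)

end LieE6

/-! ### The derived algebra of `𝒮₃(1, ω_S)` -/

namespace LieE6

open IntComb Cartan

/-- The models of the vectors of an adapted basis, and four more elements of `𝒮₃(1, ω_S)`. -/
def fullModel (n : ℕ) : List (ℤ × Bool × Fin 3 × ℕ × ℕ × ℕ) :=
  if n < 78 then model n else
    [[(1, false, 2, 2, 2, 0)], [(1, false, 1, 2, 0, 2)], [(1, false, 0, 0, 2, 2)],
      dForm 2 2 2].getD (n - 78) []

/-- A monomial that occurs only in the model with number `n`. -/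
def mainTerm (n : ℕ) : Bool × Fin 3 × ℕ × ℕ × ℕ :=
  if n < 8 then (false, 2, n / 3, n % 3, 0) else
  if n < 11 then (true, 1, 0, n - 9, 0) else
  if n < 17 then (true, 0, (n - 11) / 3, (n - 11) % 3, 0) else
  if n < 26 then (false, 0, (n - 17) / 3, (n - 17) % 3, 0) else
  if n < 35 then (false, 1, (n - 26) / 3, (n - 26) % 3, 0) else
  if n < 44 then (true, 2, (n - 35) / 3, (n - 35) % 3, 0) else
  if n < 53 then (false, 0, (n - 44) / 3, (n - 44) % 3, 1) else
  if n < 62 then (false, 1, (n - 53) / 3, (n - 53) % 3, 1) else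
  if n < 70 then (true, 2, (n - 62) / 3, (n - 62) % 3, 1) else
  if n < 78 then if n % 3 = 0 then (false, 1, (n - 69) / 3 - 1, 0, 2)
    else (false, 0, (n - 69) / 3, (n - 69) % 3 - 1, 2) else
  [(false, 2, 2, 2, 0), (false, 1, 2, 0, 2), (false, 0, 0, 2, 2)].getD (n - 78) (true, 2, 2, 2, 1)

/-- All exponents are at most `2`. -/
def isReduced (t : Bool × Fin 3 × ℕ × ℕ × ℕ) : Bool :=
  Nat.blt t.2.2.1 3 && Nat.blt t.2.2.2.1 3 && Nat.blt t.2.2.2.2 3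

lemma fullModel_reduced : ∀ n ∈ List.range 82, (n = 8 ∨ isReduced (mainTerm n) = true) ∧
    ∀ t ∈ fullModel n, isReduced t.2 = true := by
  decide +kernel

/-- Each model owns a monomial that occurs in no other one, which makes independence immediate. The
number 8 is excluded because d(1) = 0. -/
lemma mainTerm_spec : ∀ n ∈ List.range 82, n ≠ 8 → ∀ m ∈ List.range 82, m ≠ 8 →
    (coef (mainTerm n) (fullModel m) % 3 = 0 ↔ m ≠ n) := by
  decide +kernel

/-- The generators as brackets. -/
def genTable : List (ℕ × ℤ × ℕ × ℕ) :=
  [(0, -1, 9, 11), (17, -1, 35, 9), (26, 1, 35, 11), (43, 1, 22, 41)]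

/-- The models of the generators are themselves brackets of models, so all models lie in the derived
algebra. -/
lemma genTable_model : ∀ r ∈ genTable, r.2.2.1 < 78 ∧ r.2.2.2 < 78 ∧
    isZero (collect (sTrunc (scale r.2.1 (mul sBracket (model r.2.2.1) (model r.2.2.2)) ++
      scale (-1) (model r.1)))) = true := by
  decide +kernel

/-- The brackets `(m, n, c, l)`, meaning that the bracket of the `m`-th vector, which is one of the
four additional ones, with the `n`-th vector is `c` times the `l`-th one. -/
def extraTable : List (ℕ × ℕ × ℤ × ℕ) :=
  [(78, 0, 0, 0), (78, 17, 1, 5), (78, 26, 1, 7), (78, 43, 0, 0), (79, 0, 1, 59),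
  (79, 17, -1, 75), (79, 26, 0, 0), (79, 43, 0, 0), (80, 0, 1, 46), (80, 17, 0, 0),
  (80, 26, 1, 71), (80, 43, 0, 0), (81, 0, 1, 43), (81, 17, 1, 67), (81, 26, 1, 69),
  (81, 43, 0, 0), (78, 79, 0, 0), (78, 80, 0, 0), (78, 81, 0, 0), (79, 80, 0, 0), (79, 81, 0, 0),
  (80, 81, 0, 0)]

lemma extraTable_spec : ∀ r ∈ extraTable, isZero (collect (sTrunc (scale 1
    (mul sBracket (fullModel r.1) (fullModel r.2.1)) ++
      scale (-1) (scale r.2.2.1 (model r.2.2.2))))) = true := by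
  decide +kernel

variable {k : Type*} [Field k] [CharP k 3]

/-- The coefficient of a monomial, in `𝒮₂(1)`. -/
noncomputable def scoord (k : Type*) [Field k] [CharP k 3] (t : Bool × Fin 3 × ℕ × ℕ × ℕ) :
    S2 k →ₗ[k] k :=
  -- The remainder only supplies an index in `Fin 3`; it changes nothing for the reduced monomials
  -- to which the functional is applied.
  let c := (monBasis k 3).coord fun i => ⟨exps t.2.2 i % 3, Nat.mod_lt _ (by norm_num)⟩
  match t with
  | (false, i, _) => c ∘ₗ LinearMap.proj i ∘ₗ (coeffEquiv k 3).toLinearMap ∘ₗ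
      LinearMap.fst k (W k 3) (Form k)
  | (true, i, _) => c ∘ₗ LinearMap.proj i ∘ₗ LinearMap.snd k (W k 3) (Form k)

lemma coord_mon {p q : ℕ × ℕ × ℕ} (hp : p.1 < 3 ∧ p.2.1 < 3 ∧ p.2.2 < 3)
    (hq : q.1 < 3 ∧ q.2.1 < 3 ∧ q.2.2 < 3) :
    (monBasis k 3).coord (fun i => ⟨exps p i % 3, Nat.mod_lt _ (by norm_num)⟩) (mon k (exps q)) =
      if q = p then 1 else 0 := by
  have h : ∀ q : ℕ × ℕ × ℕ, q.1 < 3 ∧ q.2.1 < 3 ∧ q.2.2 < 3 → ∀ i, exps q i % 3 = exps q i := by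
    intro q hq i
    refine Nat.mod_eq_of_lt ?_
    fin_cases i
    exacts [hq.1, hq.2.1, hq.2.2]
  have h1 : mon k (exps q) =
      monBasis k 3 fun i => ⟨exps q i % 3, Nat.mod_lt _ (by norm_num)⟩ := by
    rw [monBasis_apply]
    simp only [h q hq]
  rw [h1, Module.Basis.coord_apply, Module.Basis.repr_self, Finsupp.single_apply]
  congr 1
  rw [eq_iff_iff, funext_iff]
  simp only [h q hq, h p hp, Fin.mk.injEq]
  constructor
  · intro e
    exact Prod.ext (e 0) (Prod.ext (e 1) (e 2))
  · rintro rfl i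
    rfl

lemma scoord_smon {s t : Bool × Fin 3 × ℕ × ℕ × ℕ} (hs : isReduced s = true)
    (ht : isReduced t = true) : scoord k t (smon k s) = if s = t then 1 else 0 := by
  obtain ⟨b, i, p⟩ := s
  obtain ⟨c, j, q⟩ := t
  simp only [isReduced, Bool.and_eq_true, Nat.blt_eq, and_assoc] at hs ht
  have key := coord_mon (k := k) ht hs
  rcases b with _ | _ <;> rcases c with _ | _
  · change (monBasis k 3).coord _ (vmon k i (exps p) (x k j)) = _
    rw [vmon_x]
    by_cases h : i = j
    · rw [if_pos h, key]
      simp [h]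
    · rw [if_neg h, map_zero, if_neg (by simp [h])]
  · change (monBasis k 3).coord _ ((0 : Form k) j) = _
    rw [Pi.zero_apply, map_zero, if_neg (by simp)]
  · change (monBasis k 3).coord _ ((0 : W k 3) (x k j)) = _
    rw [Derivation.zero_apply, map_zero, if_neg (by simp)]
  · change (monBasis k 3).coord _ ((Pi.single i (mon k (exps p)) : Form k) j) = _
    by_cases h : i = j
    · subst h
      rw [Pi.single_eq_same, key]
      simp
    · rw [Pi.single_eq_of_ne (Ne.symm h), map_zero, if_neg (by simp [h])]

lemma scoord_lc {t : Bool × Fin 3 × ℕ × ℕ × ℕ} (ht : isReduced t = true)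
    {xs : List (ℤ × Bool × Fin 3 × ℕ × ℕ × ℕ)} (hx : ∀ s ∈ xs, isReduced s.2 = true) :
    scoord k t (lc k (smon k) xs) = (coef t xs : k) := by
  induction xs with
  | nil => simp
  | cons s xs ih =>
    rw [lc_cons, map_add, ih fun r hr => hx r (by simp [hr]), map_smul,
      scoord_smon (hx s (by simp)) ht, coef_cons]
    split_ifs <;> simp

/-- The vectors of `𝒮₃(1, ω_S)` given by `fullModel`. -/
noncomputable def fullVec (k : Type*) [Field k] [CharP k 3] (n : ℕ) : S2 k :=
  lc k (smon k) (fullModel n)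

lemma fullVec_of_lt {n : ℕ} (hn : n < 78) : fullVec k n = modelVec k n := by
  rw [fullVec, fullModel, if_pos hn, modelVec]

lemma linearIndependent_fullVec :
    LinearIndependent k fun n : {n : Fin 82 // n ≠ 8} => fullVec k n.1 := by
  rw [Fintype.linearIndependent_iff]
  intro g hg m
  have hne : ∀ m : {n : Fin 82 // n ≠ 8}, m.1.1 ≠ 8 := fun m h => m.2 (Fin.ext h)
  have hmem : ∀ m : {n : Fin 82 // n ≠ 8}, m.1.1 ∈ List.range 82 := fun m =>
    List.mem_range.2 m.1.2
  have h0 := congrArg (scoord k (mainTerm m.1)) hg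
  have hc : ∀ n : {n : Fin 82 // n ≠ 8}, scoord k (mainTerm m.1) (fullVec k n.1) =
      (coef (mainTerm m.1) (fullModel n.1) : k) := fun n =>
    scoord_lc ((fullModel_reduced _ (hmem m)).1.resolve_left (hne m))
      (fullModel_reduced _ (hmem n)).2
  rw [map_sum, map_zero, Finset.sum_eq_single m] at h0
  · rw [map_smul, hc, smul_eq_mul, mul_eq_zero, intCast_eq_zero,
      mainTerm_spec _ (hmem m) (hne m) _ (hmem m) (hne m)] at h0
    simpa using h0
  · intro n _ hn
    rw [map_smul, hc, smul_eq_mul, intCast_eq_zero.2, mul_zero]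
    rw [mainTerm_spec _ (hmem m) (hne m) _ (hmem n) (hne n)]
    exact fun h => hn (Subtype.ext (Fin.ext h))
  · exact fun h => absurd (Finset.mem_univ m) h

lemma lc_dForm (i j l : ℕ) : lc k (smon k) (dForm i j l) = pair 0 (d k (mon k ![i, j, l])) := by
  simp only [dForm, lc_cons, lc_nil, add_zero, smon_eq_true, smul_pair, smul_zero, smul_single,
    pair_add_pair]
  congr 1
  funext a
  rw [d_apply, pd_mon]
  have h0 : exps (i - 1, j, l) = ![i, j, l] - Pi.single 0 1 := exps_low3 0 (i, j, l)
  have h1 : exps (i, j - 1, l) = ![i, j, l] - Pi.single 1 1 := exps_low3 1 (i, j, l)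
  have h2 : exps (i, j, l - 1) = ![i, j, l] - Pi.single 2 1 := exps_low3 2 (i, j, l)
  rw [h0, h1, h2]
  fin_cases a <;> simp

lemma pair_zero_d_mem (f : O k 3) : pair 0 (d k f) ∈ S3 k := ⟨map_zero _, f, rfl⟩

lemma smon_mem_S3 {i : Fin 3} {p : ℕ × ℕ × ℕ} (h : exp3 i p = 0) :
    smon k (false, i, p) ∈ S3 k := by
  refine ⟨?_, 0, map_zero _⟩
  change dvg (vmon k i (exps p)) = 0
  rw [dvg_vmon, exps_apply, h, Nat.cast_zero, zero_smul]

lemma fullVec_mem_S3 {n : ℕ} (hn : n < 82) : fullVec k n ∈ S3 k := by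
  have hs : ∀ t : Fin 3 × ℕ × ℕ × ℕ, exp3 t.1 t.2 = 0 →
      lc k (smon k) [(1, false, t)] ∈ S3 k := by
    intro t ht
    rw [lc_cons, lc_nil, add_zero, Int.cast_one, one_smul]
    exact smon_mem_S3 ht
  by_cases h : n < 78
  · rw [fullVec_of_lt h]
    refine rec_induction (P := fun n => modelVec k n ∈ S3 k) (fun g hg => ?_)
      (fun r hr h1 h2 => ?_) h
    · simp only [generators, List.mem_cons, List.not_mem_nil, or_false] at hg
      rcases hg with rfl | rfl | rfl | rfl
      · exact hs (2, 0, 0, 0) rfl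
      · have := hs (0, 0, 0, 0) rfl
        -- The list that models ∂₁ has a second entry with coefficient 0, which must be appended to
        -- match; the same happens for ∂₂.
        have e : lc k (smon k) [(0, false, 2, 0, 0, 1)] = 0 := by simp
        have := (S3 k).add_mem this (e ▸ (S3 k).zero_mem)
        rwa [← lc_append] at this
      · have := hs (1, 0, 0, 0) rfl
        have e : lc k (smon k) [(0, false, 2, 0, 0, 1)] = 0 := by simp
        have := (S3 k).add_mem this (e ▸ (S3 k).zero_mem)
        rwa [← lc_append] at this
      · change lc k (smon k) (dForm 2 2 1) ∈ S3 k
        rw [lc_dForm]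
        exact pair_zero_d_mem _
    · rw [modelVec_eq_lie hr]
      exact (S3 k).smul_mem _ ((S3 k).lie_mem h1 h2)
  · rcases (by omega : n = 78 ∨ n = 79 ∨ n = 80 ∨ n = 81) with rfl | rfl | rfl | rfl
    · exact hs (2, 2, 2, 0) rfl
    · exact hs (1, 2, 0, 2) rfl
    · exact hs (0, 0, 2, 2) rfl
    · change lc k (smon k) (dForm 2 2 2) ∈ S3 k
      rw [lc_dForm]
      exact pair_zero_d_mem _

instance : Module.Finite k (O k 3) := Module.Finite.of_basis (monBasis k 3)

instance : Module.Finite k (W k 3) := Module.Finite.of_basis (vmonBasis k 3)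

instance : Module.Finite k (S2 k) := inferInstanceAs (Module.Finite k (W k 3 × Form k))

/-! ### The dimension of 𝒮₃(1, ω_S) and its derived algebra. -/

lemma finrank_O : Module.finrank k (O k 3) = 27 := by
  rw [Module.finrank_eq_card_basis (monBasis k 3)]
  simp

lemma finrank_W : Module.finrank k (W k 3) = 81 := by
  rw [(coeffEquiv k 3).finrank_eq, Module.finrank_pi_fintype, finrank_O]
  simp

/-- If αᵢ < 2, then x^α is a nonzero multiple of the divergence of xᵢx^α ∂ᵢ. Only the top monomial
can be missing from the image, so the rank is at least 26 and the kernel has dimension at most 81 −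
26. -/
lemma finrank_ker_dvg : Module.finrank k (LinearMap.ker (dvg (k := k) (m := 3))) ≤ 55 := by
  have h1 := LinearMap.finrank_range_add_finrank_ker (dvg (k := k) (m := 3))
  have h2 : LinearMap.range (dvg (k := k) (m := 3)) ⊔ k ∙ mon k (fun _ : Fin 3 => 2) = ⊤ := by
    rw [eq_top_iff, ← (monBasis k 3).span_eq, Submodule.span_le]
    rintro _ ⟨α, rfl⟩
    rw [monBasis_apply]
    by_cases h : ∀ i, (α i).1 = 2
    · refine Submodule.mem_sup_right ?_
      simp only [h]
      exact Submodule.mem_span_singleton_self _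
    · push Not at h
      obtain ⟨i, hi⟩ := h
      have hlt := (α i).2
      refine Submodule.mem_sup_left ?_
      have e := dvg_vmon (k := k) i ((fun j => (α j).1) + Pi.single i 1)
      rw [add_tsub_cancel_right] at e
      refine ((LinearMap.range dvg).smul_mem_iff (s := (((α i).1 + 1 : ℕ) : k))
        (natCast_ne_zero (by omega))).1 ⟨_, e.trans ?_⟩
      simp
  have h3 := Submodule.finrank_add_le_finrank_add_finrank (LinearMap.range (dvg (k := k) (m := 3)))
    (k ∙ mon k (fun _ : Fin 3 => 2))
  rw [h2, finrank_top, finrank_O] at h3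
  have h4 : Module.finrank k (k ∙ mon k (fun _ : Fin 3 => 2)) ≤ 1 :=
    (finrank_span_le_card _).trans (by simp)
  rw [finrank_W] at h1
  omega

lemma finrank_range_d : Module.finrank k (LinearMap.range (d k)) ≤ 26 := by
  have h1 := LinearMap.finrank_range_add_finrank_ker (d k)
  rw [finrank_O] at h1
  have h2 : LinearMap.ker (d k) ≠ ⊥ := by
    intro h
    have : (1 : O k 3) ∈ LinearMap.ker (d k) := by
      rw [LinearMap.mem_ker]
      funext i
      rw [d_apply, Derivation.map_one_eq_zero]
      rfl
    rw [h, Submodule.mem_bot] at this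
    have h0 := (monBasis k 3).ne_zero 0
    rw [monBasis_apply] at h0
    exact h0 ((mon_zero (k := k) (m := 3)).trans this)
  have h3 := Submodule.one_le_finrank_iff.2 h2
  omega

lemma finrank_S3 : Module.finrank k (S3 k).toSubmodule ≤ 81 := by
  let f : (S3 k).toSubmodule →ₗ[k] LinearMap.ker (dvg (k := k) (m := 3)) × LinearMap.range (d k) :=
    { toFun := fun s => (⟨s.1.1, s.2.1⟩, ⟨s.1.2, s.2.2⟩)
      map_add' := fun _ _ => rfl
      map_smul' := fun _ _ => rfl }
  have hf : Function.Injective f := by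
    intro s t h
    have h1 := congrArg (fun z => z.1.1) h
    have h2 := congrArg (fun z => z.2.1) h
    exact Subtype.ext (Prod.ext h1 h2)
  have := LinearMap.finrank_le_finrank_of_injective hf
  rw [Module.finrank_prod] at this
  have h1 := finrank_ker_dvg (k := k)
  have h2 := finrank_range_d (k := k)
  omega

/-- Upper bound 55 + 26 = 81 for the dimension, against 81 independent elements: the 77 nonzero
models and four more. -/
lemma S3_eq_span :
    (S3 k).toSubmodule = Submodule.span k (Set.range fun n : {n : Fin 82 // n ≠ 8} =>
      fullVec k n.1) := by
  symm
  refine Submodule.eq_of_le_of_finrank_le ?_ ?_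
  · rw [Submodule.span_le]
    rintro _ ⟨n, rfl⟩
    exact fullVec_mem_S3 n.1.2
  · rw [finrank_span_eq_card linearIndependent_fullVec]
    refine finrank_S3.trans (le_of_eq ?_)
    rw [Fintype.card_subtype_compl]
    simp

/-- The span of the models of the vectors of an adapted basis. -/
noncomputable def modelSpan (k : Type*) [Field k] [CharP k 3] : Submodule k (S2 k) :=
  Submodule.span k (Set.range fun n : Fin 78 => modelVec k n)

lemma modelVec_mem {n : ℕ} (hn : n < 78) : modelVec k n ∈ modelSpan k :=
  Submodule.subset_span ⟨⟨n, hn⟩, rfl⟩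

lemma leadMap_mem {L : Type*} [AddCommGroup L] [Module k L] {b : Module.Basis (Fin 78) k L} (j : ℤ)
    (x : L) : leadMap b j x ∈ modelSpan k := by
  rw [leadMap, Module.Basis.constr_apply_fintype]
  refine Submodule.sum_mem _ fun n _ => Submodule.smul_mem _ _ ?_
  split_ifs
  · exact modelVec_mem n.2
  · exact Submodule.zero_mem _

lemma lie_mem_of_basis {L : Type*} [LieRing L] [LieAlgebra k L] {ι κ : Type*} {v : ι → L}
    {w : κ → L} {V : Submodule k L} (h : ∀ i j, ⁅v i, w j⁆ ∈ V) {x y : L}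
    (hx : x ∈ Submodule.span k (Set.range v)) (hy : y ∈ Submodule.span k (Set.range w)) :
    ⁅x, y⁆ ∈ V := by
  induction hx using Submodule.span_induction with
  | mem x hx =>
    obtain ⟨i, rfl⟩ := hx
    induction hy using Submodule.span_induction with
    | mem y hy =>
      obtain ⟨j, rfl⟩ := hy
      exact h i j
    | zero => rw [lie_zero]; exact V.zero_mem
    | add y y' _ _ h1 h2 => rw [lie_add]; exact V.add_mem h1 h2
    | smul c y _ h1 => rw [lie_smul]; exact V.smul_mem c h1
  | zero => rw [zero_lie]; exact V.zero_mem
  | add x x' _ _ h1 h2 => rw [add_lie]; exact V.add_mem h1 h2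
  | smul c x _ h1 => rw [smul_lie]; exact V.smul_mem c h1

/-- Closure under brackets is inherited from 𝔤: a bracket of two models is the leading part of a
bracket of basis vectors. -/
lemma lie_mem_modelSpan {L : Type*} [LieRing L] [LieAlgebra k L] {b : Module.Basis (Fin 78) k L}
    (hb : HasStructConst b) {s t : S2 k} (hs : s ∈ modelSpan k) (ht : t ∈ modelSpan k) :
    ⁅s, t⁆ ∈ modelSpan k := by
  refine lie_mem_of_basis (fun m n => ?_) hs ht
  have := leadMap_lie hb (vec_mem_Fil (b := b) (le_refl (deg m)))
    (vec_mem_Fil (b := b) (le_refl (deg n)))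
  rw [leadMap_vec m.2, leadMap_vec n.2, if_pos rfl, if_pos rfl] at this
  rw [← this]
  exact leadMap_mem _ _

lemma fullVec_lie_of_mem {r : ℕ × ℕ × ℤ × ℕ} (hr : r ∈ extraTable) :
    ⁅fullVec k r.1, fullVec k r.2.1⁆ ∈ modelSpan k := by
  have hlt : ∀ r ∈ extraTable, r.2.2.2 < 78 := by decide
  have h := lie_lc (k := k) (smon k) (smon k) (smon k) sBracket (fullModel r.1) (fullModel r.2.1)
    fun s _ t _ => lie_smon s.2 t.2
  have h2 := lc_eq_of_sTrunc (k := k) (extraTable_spec r hr)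
  rw [lc_scale, lc_scale, Int.cast_one, one_smul, ← h] at h2
  rw [fullVec, fullVec, h2]
  exact Submodule.smul_mem _ _ (modelVec_mem (hlt r hr))

/-- Each additional element acts as a derivation, so it maps the span of the models into itself as
soon as it does so on the four generators. -/
lemma extra_lie_mem {L : Type*} [LieRing L] [LieAlgebra k L] {b : Module.Basis (Fin 78) k L}
    (hb : HasStructConst b) {m n : ℕ} (h1 : 78 ≤ m) (h2 : m < 82) (hn : n < 78) :
    ⁅fullVec k m, modelVec k n⁆ ∈ modelSpan k := by
  refine (rec_induction (P := fun n => n < 78 ∧ ⁅fullVec k m, modelVec k n⁆ ∈ modelSpan k)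
    (fun g hg => ?_) (fun r hr ih1 ih2 => ?_) hn).2
  · have key : ∀ g ∈ generators, g < 78 ∧ ∀ m ∈ List.range' 78 4, ∃ r ∈ extraTable,
        r.1 = m ∧ r.2.1 = g := by decide
    obtain ⟨hg78, hg⟩ := key g hg
    obtain ⟨r, hr, rfl, rfl⟩ := hg m (by rw [List.mem_range'_1]; omega)
    refine ⟨hg78, ?_⟩
    rw [← fullVec_of_lt hg78]
    exact fullVec_lie_of_mem hr
  · refine ⟨(recTable_spec r hr).1, ?_⟩
    rw [modelVec_eq_lie hr, lie_smul, leibniz_lie]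
    exact Submodule.smul_mem _ _ (Submodule.add_mem _ (lie_mem_modelSpan hb ih1.2
      (modelVec_mem ih2.1)) (lie_mem_modelSpan hb (modelVec_mem ih1.1) ih2.2))

lemma lie_mem_modelSpan_of_S3 {L : Type*} [LieRing L] [LieAlgebra k L]
    {b : Module.Basis (Fin 78) k L} (hb : HasStructConst b) {s t : S2 k} (hs : s ∈ S3 k)
    (ht : t ∈ S3 k) : ⁅s, t⁆ ∈ modelSpan k := by
  have hs : s ∈ (S3 k).toSubmodule := hs
  have ht : t ∈ (S3 k).toSubmodule := ht
  rw [S3_eq_span] at hs ht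
  refine lie_mem_of_basis (fun m n => ?_) hs ht
  have hm := m.1.2
  have hn := n.1.2
  by_cases h1 : m.1.1 < 78
  · rw [fullVec_of_lt h1]
    by_cases h2 : n.1.1 < 78
    · rw [fullVec_of_lt h2]
      exact lie_mem_modelSpan hb (modelVec_mem h1) (modelVec_mem h2)
    · rw [← lie_skew]
      exact Submodule.neg_mem _ (extra_lie_mem hb (by omega) hn h1)
  · by_cases h2 : n.1.1 < 78
    · rw [fullVec_of_lt h2]
      exact extra_lie_mem hb (by omega) hm h2
    · have key : ∀ m ∈ List.range' 78 4, ∀ n ∈ List.range' 78 4, m < n → ∃ r ∈ extraTable,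
          r.1 = m ∧ r.2.1 = n := by decide
      have hm' : m.1.1 ∈ List.range' 78 4 := by rw [List.mem_range'_1]; omega
      have hn' : n.1.1 ∈ List.range' 78 4 := by rw [List.mem_range'_1]; omega
      rcases lt_trichotomy m.1.1 n.1.1 with h | h | h
      · obtain ⟨r, hr, e1, e2⟩ := key _ hm' _ hn' h
        rw [← e1, ← e2]
        exact fullVec_lie_of_mem hr
      · rw [h, lie_self]
        exact Submodule.zero_mem _
      · obtain ⟨r, hr, e1, e2⟩ := key _ hn' _ hm' h
        rw [← lie_skew, ← e1, ← e2]
        exact Submodule.neg_mem _ (fullVec_lie_of_mem hr)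

/-- All brackets of 𝒮₃(1, ω_S), including those with the four additional elements, fall into the
span of the models; conversely every model, generators included, is a multiple of a bracket. -/
lemma mem_S3derived_iff {L : Type*} [LieRing L] [LieAlgebra k L] {b : Module.Basis (Fin 78) k L}
    (hb : HasStructConst b) (s : S3 k) : s ∈ S3derived k ↔ s.1 ∈ modelSpan k := by
  have hD : S3derived k = ⁅(⊤ : LieIdeal k (S3 k)), (⊤ : LieIdeal k (S3 k))⁆ := by
    rw [S3derived, LieAlgebra.derivedSeries_def, LieAlgebra.derivedSeriesOfIdeal_succ,
      LieAlgebra.derivedSeriesOfIdeal_zero]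
  have hlie : ∀ x y : S3 k, ⁅x, y⁆ ∈ S3derived k := fun x y => by
    rw [hD]
    exact LieSubmodule.lie_mem_lie (LieSubmodule.mem_top x) (LieSubmodule.mem_top y)
  constructor
  · intro h
    have h : s ∈ (S3derived k).toSubmodule := h
    rw [hD, LieSubmodule.lieIdeal_oper_eq_linear_span'] at h
    have hle : Submodule.span k {t : S3 k | ∃ x ∈ (⊤ : LieIdeal k (S3 k)),
        ∃ y ∈ (⊤ : LieIdeal k (S3 k)), ⁅x, y⁆ = t} ≤
        (modelSpan k).comap (S3 k).toSubmodule.subtype := by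
      rw [Submodule.span_le]
      rintro _ ⟨x, -, y, -, rfl⟩
      exact lie_mem_modelSpan_of_S3 hb x.2 y.2
    exact hle h
  · intro h
    have hle : modelSpan k ≤ (S3derived k).toSubmodule.map (S3 k).toSubmodule.subtype := by
      have hm : ∀ n < 78, modelVec k n ∈ S3 k := fun n hn => by
        rw [← fullVec_of_lt hn]
        exact fullVec_mem_S3 (by omega)
      have hc : ∀ (c : ℤ) (p q : ℕ), p < 78 → q < 78 → (c : k) • ⁅modelVec k p, modelVec k q⁆ ∈
          (S3derived k).toSubmodule.map (S3 k).toSubmodule.subtype := fun c p q hp hq =>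
        Submodule.smul_mem _ _ ⟨_, hlie ⟨_, hm p hp⟩ ⟨_, hm q hq⟩, rfl⟩
      rw [modelSpan, Submodule.span_le]
      rintro _ ⟨n, rfl⟩
      refine rec_induction (P := fun n => modelVec k n ∈
        (S3derived k).toSubmodule.map (S3 k).toSubmodule.subtype) (fun g hg => ?_)
        (fun r hr _ _ => ?_) n.2
      · have key : ∀ g ∈ generators, ∃ r ∈ genTable, r.1 = g := by decide
        obtain ⟨r, hr, rfl⟩ := key g hg
        obtain ⟨h1, h2, h3⟩ := genTable_model r hr
        have := hc r.2.1 _ _ h1 h2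
        rwa [lie_modelVec, ← lc_scale, lc_eq_of_sTrunc h3] at this
      · obtain ⟨-, h1, h2, -⟩ := recTable_spec r hr
        rw [modelVec_eq_lie hr]
        exact hc _ _ _ h1 h2
    obtain ⟨t, ht, hts⟩ := hle h
    have : t = s := Subtype.ext hts
    rwa [← this]

end LieE6

/-! ### The graded Lie algebra of the Weisfeiler filtration -/

namespace LieE6

open IntComb Cartan

variable {k : Type*} [Field k] [CharP k 3] {L : Type*}
variable [LieRing L] [LieAlgebra k L] {b : Module.Basis (Fin 78) k L}

/-- The model of the central vector is d(1) = 0; for this reason leading parts are defined on the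
quotient by the centre. -/
lemma leadMap_eight (d : ℤ) : leadMap b d (vec b 8) = 0 := by
  have h : modelVec k 8 = 0 := by
    simp [modelVec, model, dForm, lc]
  rw [leadMap_vec (by norm_num), h, ite_self]

/-- The part of degree `d` of an element of the quotient by the centre, in `𝒮₂(1)`. -/
noncomputable def barLead (hb : HasStructConst b) (d : ℤ) :
    (L ⧸ LieAlgebra.center k L) →ₗ[k] S2 k :=
  Submodule.liftQ (LieAlgebra.center k L).toSubmodule (leadMap b d) (by
    rw [center_eq hb, Submodule.span_singleton_le_iff_mem]
    exact leadMap_eight d)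

lemma barLead_proj (hb : HasStructConst b) (d : ℤ) (x : L) :
    barLead hb d (centerProj k L x) = leadMap b d x :=
  Submodule.liftQ_apply _ _ _

lemma barLead_eq_zero (hb : HasStructConst b) {d : ℤ} {x : L ⧸ LieAlgebra.center k L}
    (hx : x ∈ barFil b (d + 1)) : barLead hb d x = 0 := by
  obtain ⟨y, hy, rfl⟩ := hx
  exact (barLead_proj hb d y).trans (leadMap_eq_zero hy)

lemma barLead_lie (hb : HasStructConst b) {i j : ℤ} {x y : L ⧸ LieAlgebra.center k L}
    (hx : x ∈ barFil b i) (hy : y ∈ barFil b j) :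
    barLead hb (i + j) ⁅x, y⁆ = ⁅barLead hb i x, barLead hb j y⁆ := by
  obtain ⟨x, hx, rfl⟩ := hx
  obtain ⟨y, hy, rfl⟩ := hy
  change barLead hb (i + j) ⁅centerProj k L x, centerProj k L y⁆ =
    ⁅barLead hb i (centerProj k L x), barLead hb j (centerProj k L y)⁆
  rw [← LieHom.map_lie, barLead_proj, barLead_proj, barLead_proj, leadMap_lie hb hx hy]

lemma barLead_mem (hb : HasStructConst b) (d : ℤ) (x : L ⧸ LieAlgebra.center k L) :
    barLead hb d x ∈ modelSpan k := by
  obtain ⟨y, rfl⟩ := centerProj_surjective x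
  rw [barLead_proj]
  exact leadMap_mem d y

variable {Φ : LieFiltration k (L ⧸ LieAlgebra.center k L)}

/-- The map from the graded algebra to `𝒮₂(1)`. -/
noncomputable def grMap (hb : HasStructConst b) (hΦ : ∀ i, Φ.F i = barFil b i) :
    Φ.Gr →ₗ[k] S2 k :=
  DirectSum.toModule k ℤ (S2 k) fun i => Submodule.liftQ _
    (barLead hb i ∘ₗ (Φ.F i).subtype) (by
      intro x hx
      have hx : x.1 ∈ Φ.F (i + 1) := hx
      rw [hΦ] at hx
      exact barLead_eq_zero hb hx)

lemma grMap_symb (hb : HasStructConst b) (hΦ : ∀ i, Φ.F i = barFil b i) (i : ℤ) (x : Φ.F i) :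
    grMap hb hΦ (Φ.symb i x) = barLead hb i x.1 :=
  (DirectSum.toModule_lof k i _).trans (Submodule.liftQ_apply _ _ _)

lemma grMap_lie (hb : HasStructConst b) (hΦ : ∀ i, Φ.F i = barFil b i) (x y : Φ.Gr) :
    grMap hb hΦ ⁅x, y⁆ = ⁅grMap hb hΦ x, grMap hb hΦ y⁆ := by
  induction x using LieFiltration.gr_induction with
  | h0 => simp
  | hadd x x' h h' => rw [add_lie, map_add, map_add, h, h', add_lie]
  | hs i x =>
    induction y using LieFiltration.gr_induction with
    | h0 => simp
    | hadd y y' h h' => rw [lie_add, map_add, map_add, h, h', lie_add]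
    | hs j y =>
      have hx : x.1 ∈ barFil b i := hΦ i ▸ x.2
      have hy : y.1 ∈ barFil b j := hΦ j ▸ y.2
      change grMap hb hΦ (Φ.grBracket _ _) = _
      rw [LieFiltration.grBracket_symb, grMap_symb, grMap_symb, grMap_symb, barLead_lie hb hx hy]

lemma proj_vec_mem (hΦ : ∀ i, Φ.F i = barFil b i) (n : ℕ) :
    centerProj k L (vec b n) ∈ Φ.F (deg n) := by
  rw [hΦ]
  exact proj_mem_barFil (vec_mem_Fil le_rfl)

/-- The symbols of the basis vectors. -/
noncomputable def grVec (hΦ : ∀ i, Φ.F i = barFil b i) (n : ℕ) : Φ.Gr :=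
  Φ.symb (deg n) ⟨centerProj k L (vec b n), proj_vec_mem hΦ n⟩

lemma grMap_grVec (hb : HasStructConst b) (hΦ : ∀ i, Φ.F i = barFil b i) {n : ℕ} (hn : n < 78) :
    grMap hb hΦ (grVec hΦ n) = modelVec k n := by
  rw [grVec, grMap_symb, barLead_proj, leadMap_vec hn, if_pos rfl]

lemma span_grVec (hb : HasStructConst b) (hΦ : ∀ i, Φ.F i = barFil b i) (x : Φ.Gr) :
    x ∈ Submodule.span k (Set.range fun n : {n : Fin 78 // n ≠ 8} => grVec hΦ (n.1 : ℕ)) := by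
  induction x using LieFiltration.gr_induction with
  | h0 => exact Submodule.zero_mem _
  | hadd x y hx hy => exact Submodule.add_mem _ hx hy
  | hs i x =>
    obtain ⟨x, hx⟩ := x
    have hx' := hx
    rw [hΦ] at hx'
    obtain ⟨y, hy, rfl⟩ := hx'
    let g : Fil b i →ₗ[k] Φ.Gr := Φ.symb i ∘ₗ LinearMap.codRestrict (Φ.F i)
      ((centerProj k L : L →ₗ[k] L ⧸ LieAlgebra.center k L) ∘ₗ (Fil b i).subtype)
      fun z => (hΦ i).symm ▸ proj_mem_barFil z.2
    have key : Fil b i ≤ Submodule.map (Fil b i).subtype (Submodule.comap g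
        (Submodule.span k (Set.range fun n : {n : Fin 78 // n ≠ 8} => grVec hΦ (n.1 : ℕ)))) := by
      refine Fil_le fun n hn hd => ⟨⟨vec b n, vec_mem_Fil hd⟩, ?_, rfl⟩
      change Φ.symb i ⟨centerProj k L (vec b n), _⟩ ∈ Submodule.span k _
      rcases hd.lt_or_eq with h | rfl
      · rw [LieFiltration.symb_eq_zero]
        · exact Submodule.zero_mem _
        · rw [hΦ]
          exact proj_mem_barFil (vec_mem_Fil h)
      -- The central vector has zero image, so its symbol vanishes and 77 symbols span the graded
      -- algebra.
      · by_cases h8 : n = 8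
        · have h0 : centerProj k L (vec b n) = 0 := by
            rw [centerProj_eq_zero_iff hb, h8]
            exact Submodule.mem_span_singleton_self _
          rw [LieFiltration.symb_eq_zero]
          · exact Submodule.zero_mem _
          · simp only [h0]
            exact Submodule.zero_mem _
        · exact Submodule.subset_span ⟨⟨⟨n, hn⟩, fun h => h8 (congrArg Fin.val h)⟩, rfl⟩
    obtain ⟨z, hz, rfl⟩ := key hy
    exact hz

lemma linearIndependent_modelVec :
    LinearIndependent k fun n : {n : Fin 78 // n ≠ 8} => modelVec k (n.1 : ℕ) := by
  have h := linearIndependent_fullVec (k := k)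
  have := h.comp (fun n : {n : Fin 78 // n ≠ 8} =>
    (⟨⟨n.1, by omega⟩, fun h => n.2 (by simpa [Fin.ext_iff] using h)⟩ : {n : Fin 82 // n ≠ 8}))
    fun m n h => Subtype.ext (Fin.ext (congrArg (fun i => (i.1 : ℕ)) h))
  convert this using 2 with n
  exact (fullVec_of_lt n.1.2).symm

/-- The 77 spanning symbols go to the 77 nonzero models, which are linearly independent. -/
lemma grMap_injective (hb : HasStructConst b) (hΦ : ∀ i, Φ.F i = barFil b i) :
    Function.Injective (grMap hb hΦ) := by
  rw [injective_iff_map_eq_zero]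
  intro x hx
  obtain ⟨c, rfl⟩ := (Submodule.mem_span_range_iff_exists_fun k).1 (span_grVec hb hΦ x)
  have h : ∑ n, c n • modelVec k (n.1 : ℕ) = 0 := by
    rw [← hx, map_sum]
    exact Finset.sum_congr rfl fun n _ => by rw [map_smul, grMap_grVec hb hΦ n.1.2]
  have := Fintype.linearIndependent_iff.1 linearIndependent_modelVec c h
  simp [this]

lemma grMap_mem (hb : HasStructConst b) (hΦ : ∀ i, Φ.F i = barFil b i) (x : Φ.Gr) :
    grMap hb hΦ x ∈ modelSpan k := by
  induction x using LieFiltration.gr_induction with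
  | h0 => rw [map_zero]; exact Submodule.zero_mem _
  | hadd x y hx hy => rw [map_add]; exact Submodule.add_mem _ hx hy
  | hs i x => rw [grMap_symb]; exact barLead_mem hb i _

lemma modelSpan_le_S3 : modelSpan k ≤ (S3 k).toSubmodule := by
  rw [modelSpan, Submodule.span_le]
  rintro _ ⟨n, rfl⟩
  change modelVec k n ∈ S3 k
  rw [← fullVec_of_lt n.2]
  exact fullVec_mem_S3 (by omega)

lemma nonempty_gr_equiv (hb : HasStructConst b) (hΦ : ∀ i, Φ.F i = barFil b i) :
    Nonempty (Φ.Gr ≃ₗ⁅k⁆ S3derived k) := by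
  have hS : ∀ x, grMap hb hΦ x ∈ S3 k := fun x => modelSpan_le_S3 (grMap_mem hb hΦ x)
  let f : Φ.Gr →ₗ⁅k⁆ S3derived k :=
    { toFun := fun x => ⟨⟨grMap hb hΦ x, hS x⟩, (mem_S3derived_iff hb _).2 (grMap_mem hb hΦ x)⟩
      map_add' := fun x y => Subtype.ext (Subtype.ext (map_add _ _ _))
      map_smul' := fun c x => Subtype.ext (Subtype.ext (map_smul _ _ _))
      map_lie' := fun {x y} => Subtype.ext (Subtype.ext (grMap_lie hb hΦ x y)) }
  have hf : Function.Bijective f := by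
    constructor
    · intro x y h
      exact grMap_injective hb hΦ (congrArg (fun s => s.1.1) h)
    · rintro ⟨⟨s, hs⟩, hs'⟩
      have hle : modelSpan k ≤ LinearMap.range (grMap hb hΦ) := by
        rw [modelSpan, Submodule.span_le]
        rintro _ ⟨n, rfl⟩
        exact ⟨_, grMap_grVec hb hΦ n.2⟩
      obtain ⟨x, hx⟩ := hle ((mem_S3derived_iff hb _).1 hs')
      exact ⟨x, Subtype.ext (Subtype.ext hx)⟩
  exact ⟨LieEquiv.ofBijective f hf⟩

end LieE6

theorem mainTheorem6 {k : Type*} [Field k] [IsAlgClosed k] [CharP k 3]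
    (e : LieE6.E6 k) (he : e ∈ LieE6.orbitA2A2A1 k) :
    Module.finrank k (LieE6.A e) = 17 ∧
    Nonempty ((LieE6.cent e ⧸ LieAlgebra.radical k (LieE6.cent e)) ≃ₗ⁅k⁆ Cartan.H k) ∧
    LieSub.rad (LieE6.norm e) = LieE6.A e ∧
    Nonempty ((LieE6.norm e ⧸ LieAlgebra.radical k (LieE6.norm e)) ≃ₗ⁅k⁆ Cartan.CH k) ∧
    LieSub.rad (LieE6.w e) = LieE6.A e ∧
    Nonempty ((LieE6.w e ⧸ LieAlgebra.radical k (LieE6.w e)) ≃ₗ⁅k⁆ Cartan.W k 2) ∧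
    IsCoatom (LieE6.w e) ∧
    ∃ h : Weisfeiler.IsWeisfeilerPair (LieE6.wBar e) (LieE6.lMinusOneBar e),
      Nonempty ((Weisfeiler.filtration h).Gr ≃ₗ⁅k⁆ Cartan.S3derived k) := by
  obtain ⟨b, hb, rfl⟩ := LieE6.exists_basis he
  have hcM : (LieE6.cent (LieE6.vec b 0)).toSubmodule ≤ LieE6.Fil b 0 :=
    fun x hx => LieE6.centralizer_le hb hx
  have hA : LieE6.A (LieE6.vec b 0) = LieE6.Fil b 1 := LieE6.rad_eq hb hcM fun y hy => hy
  have hnM : (LieE6.norm (LieE6.vec b 0)).toSubmodule ≤ LieE6.Fil b 0 :=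
    LieE6.normalizer_nil_le hb
  have hnc : ∀ y, ⁅y, LieE6.vec b 0⁆ = 0 → y ∈ LieE6.norm (LieE6.vec b 0) := by
    intro y hy v hv
    obtain ⟨c, rfl⟩ := Submodule.mem_span_singleton.1 hv
    rw [lie_smul, hy, smul_zero]
    exact Submodule.zero_mem _
  have hw : (LieE6.w (LieE6.vec b 0)).toSubmodule = LieE6.Fil b 0 := by
    rw [LieE6.w, hA]
    exact LieE6.normalizer_Fil_one hb
  have hwc : ∀ y, ⁅y, LieE6.vec b 0⁆ = 0 → y ∈ LieE6.w (LieE6.vec b 0) := by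
    intro y hy
    have : y ∈ (LieE6.w (LieE6.vec b 0)).toSubmodule := hw ▸ LieE6.centralizer_le hb hy
    exact this
  -- With A, 𝔴 and L₋₁ identified as the parts of degree at least 1, 0 and −1, all assertions become
  -- statements about the filtration.
  have hV : LieE6.lMinusOneBar (LieE6.vec b 0) = LieE6.barFil b (-1) := by
    rw [LieE6.lMinusOneBar, LieE6.lMinusOne, LieE6.w, hA, LieE6.transporter_Fil_one hb]
    rfl
  refine ⟨by rw [hA, LieE6.finrank_Fil_one], ?_, ?_, ?_, ?_, ?_, ?_, ?_⟩
  · exact LieE6.nonempty_quotient_equiv hb hcM (fun y hy => hy)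
      fun x hx => LieE6.mem_centralizer_iff hb hx
  · rw [hA]
    exact LieE6.rad_eq hb hnM hnc
  · exact LieE6.nonempty_quotient_equiv hb hnM hnc fun x hx => LieE6.mem_normalizer_iff hb hx
  · rw [hA]
    exact LieE6.rad_eq hb hw.le hwc
  · obtain ⟨f⟩ := LieE6.nonempty_quotient_equiv hb hw.le hwc (Q := ⊤) fun x hx =>
      ⟨fun _ => LieSubalgebra.mem_top _, fun _ => (LieSubalgebra.mem_toSubmodule _).1 (hw ▸ hx)⟩
    exact ⟨f.trans LieSubalgebra.topEquiv⟩
  · exact LieE6.isCoatom_of_eq_Fil hb hw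
  · have h : Weisfeiler.IsWeisfeilerPair (LieE6.wBar (LieE6.vec b 0))
        (LieE6.lMinusOneBar (LieE6.vec b 0)) := by
      rw [hV]
      exact LieE6.isWeisfeilerPair hw hb
    refine ⟨h, LieE6.nonempty_gr_equiv hb fun i => ?_⟩
    change Weisfeiler.fil (LieE6.wBar (LieE6.vec b 0)) (LieE6.lMinusOneBar (LieE6.vec b 0)) i = _
    rw [hV]
    exact LieE6.fil_eq hw hb i
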